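/- **Theorem 1.2.** Let $n\ge 2$ and $\alpha\in(0,1)$; functions and distributions are complex-valued. *Notation.* For a tempered distribution $f$ on $\mathbb R^n$ and $t>0$ let $e^{t\Delta}f(x)$ be the pairing of $f$ with $y\mapsto(4\pi t)^{-n/2}e^{-|x-y|^2/(4t)}$. For $T\in(0,\infty]$ put $$\|f\|_{Q^{-1}_{\alpha;T}}=\sup_{x\in\mathbb R^n,\;0<r<T}\Big(r^{2\alpha-n}\int_0^{r^2}\!\!\int_{|y-x|<r}|e^{t\Delta}f(y)|^2t^{-\alpha}\,dy\,dt\Big)^{1/2},$$ and let $\overline{VQ_\alpha^{-1}}$ be the space of tempered distributions $f$ with $\lim_{T\to0}\|f\|_{Q^{-1}_{\alpha;T}}=0$. For a measurable function $g$ on $(0,T)\times\mathbb R^n$ with measurable time slices put $$\|g\|_{X_{\alpha;T}}=\sup_{0<t<T}\sqrt t\,\|g(t,\cdot)\|_{L^\infty}+\sup_{x\in\mathbb R^n,\;0<r^2<T}\Big(r^{2\alpha-n}\int_0^{r^2}\!\!\int_{|y-x|<r}|g(t,y)|^2t^{-\alpha}\,dy\,dt\Big)^{1/2},$$ and let $X_{\alpha;T}$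 be the space of those $g$ with $\|g\|_{X_{\alpha;T}}<\infty$. The norm of a vector with $n$ components is the sum of the norms of its components, and $\nabla\cdot a=0$ is meant in the sense of distributions. A *mild solution* on $(0,T)\times\mathbb R^n$ of the incompressible Navier–Stokes system with initial velocity $a=(a_1,\dots,a_n)$, where the $a_j$ are tempered distributions, is a function $u=(u_1,\dots,u_n)$ such that, for every $t\in(0,T)$ and almost every $x\in\mathbb R^n$, $$u(t,x)=e^{t\Delta}a(x)-\int_0^te^{(t-s)\Delta}P\nabla\cdot(u\otimes u)\,ds .$$ Here $P=(\delta_{jk}+R_jR_k)_{j,k}$ with $R_j=\partial_j(-\Delta)^{-1/2}$. The $j$-th component of the integral is $\int_0^t\int_{\mathbb R^n}\sum_{k,l}K_{jkl}(t-s,x-y)\,u_l(s,y)u_k(s,y)\,dy\,ds$, which is required to converge absolutely (each term separately), where $K_{jkl}(t,\cdot)$ is the inverse Fourier transform $x\mapsto\int_{\mathbb R^n} e^{2\pi i x\cdot\xi}(\cdots)\,d\xi$ of $e^{-4\pi^2t|\xi|^2}\big(\delta_{jk}-\xi_j\xi_k/|\xi|^2\big)\,2\pi i\,\xi_l$, that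 is, the kernel of $e^{t\Delta}P_{jk}\partial_l$. *Claim.* Two solutions are identified if for every $t\in(0,T)$ they agree at almost every $x$. (i) There are $\varepsilon,\delta>0$ and $C\ge 0$ such that for every $a$ with $\nabla\cdot a=0$ and $\|a\|_{(Q^{-1}_{\alpha;\infty})^n}\le\varepsilon$ there is exactly one mild solution $u\in(X_{\alpha;\infty})^n$ on $(0,\infty)\times\mathbb R^n$ with initial velocity $a$ and $\|u\|_{(X_{\alpha;\infty})^n}\le\delta$; moreover $\|u\|_{(X_{\alpha;\infty})^n}\le C\|a\|_{(Q^{-1}_{\alpha;\infty})^n}$. (ii) For every $T\in(0,\infty)$ there are $\varepsilon,\delta>0$ and $C\ge 0$ such that for every $a$ with $\nabla\cdot a=0$ and $\|a\|_{(Q^{-1}_{\alpha;T})^n}\le\varepsilon$ there is exactly one mild solution $u\in(X_{\alpha;T})^n$ on $(0,T)\times\mathbb R^n$ with initial velocity $a$ and $\|u\|_{(X_{\alpha;T})^n}\le\delta$; moreover $\|u\|_{(X_{\alpha;T})^n}\le C\|a\|_{(Q^{-1}_{\alpha;T})^n}$. In particular, there is $\delta>0$ such that for every $a\in\big(\overline{VQ_\alpha^{-1}}\big)^n$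 with $\nabla\cdot a=0$ and every $\eta>0$ there is $T_0\in(0,\infty)$ such that for every $T\in(0,T_0]$ there is exactly one mild solution $u\in(X_{\alpha;T})^n$ on $(0,T)\times\mathbb R^n$ with initial velocity $a$ and $\|u\|_{(X_{\alpha;T})^n}\le\delta$; moreover $\|u\|_{(X_{\alpha;T})^n}\le\eta$. In all these cases, if $a$ is real-valued, then so is $u$ (almost everywhere, at each time). -/

import Mathlib

open Real Set Filter Topology MeasureTheory
open scoped ENNReal NNReal SchwartzMap FourierTransform LineDeriv ContDiff

namespace QNavierStokes

noncomputable section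

/-- The Euclidean space `ℝⁿ`. -/
abbrev Rn (n : ℕ) := EuclideanSpace ℝ (Fin n)

/-! ### The heat semigroup on tempered distributions -/

/-- The heat kernel `(4πt)^{-n/2} exp(-|x - y|² / (4t))`. -/
def heatKernel {n : ℕ} (t : ℝ) (x y : Rn n) : ℝ :=
  (4 * π * t) ^ (-(n : ℝ) / 2) * Real.exp (-(‖x - y‖ ^ 2 / (4 * t)))

theorem one_add_pow_le_gaussian (M : ℕ) {c : ℝ} (hc : 0 < c) :
    ∃ K : ℝ, 0 ≤ K ∧ ∀ r : ℝ, 0 ≤ r → (1 + r) ^ M * Real.exp (-(c * r ^ 2)) ≤ K := by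
  refine ⟨2 ^ M * ((M.factorial : ℝ) / c ^ M * Real.exp c), by positivity, fun r hr => ?_⟩
  have h1 : (1 + r) ^ M ≤ (2 * (1 + r ^ 2)) ^ M := by
    gcongr
    nlinarith [sq_nonneg (r - 1)]
  have h2 := Real.pow_div_factorial_le_exp (c * (1 + r ^ 2)) (by positivity) M
  have hM : (0 : ℝ) < M.factorial := by positivity
  rw [div_le_iff₀ hM, mul_pow] at h2
  have h3 : (1 + r ^ 2) ^ M ≤ (M.factorial : ℝ) / c ^ M * Real.exp (c * (1 + r ^ 2)) := by
    rw [div_mul_eq_mul_div, le_div_iff₀ (by positivity)]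
    nlinarith
  rw [Real.exp_neg, ← div_eq_mul_inv, div_le_iff₀ (Real.exp_pos _)]
  have h4 : Real.exp (c * (1 + r ^ 2)) = Real.exp c * Real.exp (c * r ^ 2) := by
    rw [← Real.exp_add]; ring_nf
  calc (1 + r) ^ M ≤ 2 ^ M * (1 + r ^ 2) ^ M := by rw [← mul_pow]; exact h1
    _ ≤ 2 ^ M * ((M.factorial : ℝ) / c ^ M * Real.exp (c * (1 + r ^ 2))) := by gcongr
    _ = _ := by rw [h4]; ring

theorem hasTemperateGrowth_exponent {n : ℕ} (t : ℝ) (x : Rn n) :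
    (fun y : Rn n => -(‖x - y‖ ^ 2 / (4 * t))).HasTemperateGrowth := by
  have h1 : (fun y : Rn n => x - y).HasTemperateGrowth :=
    (Function.HasTemperateGrowth.const x).sub Function.HasTemperateGrowth.id'
  have h2 : (fun y : Rn n => ‖x - y‖ ^ 2).HasTemperateGrowth :=
    (Function.hasTemperateGrowth_norm_sq (H := Rn n)).comp h1
  have h3 := h2.mul (Function.HasTemperateGrowth.const (-(1 / (4 * t))))
  have h4 : (fun y : Rn n => -(‖x - y‖ ^ 2 / (4 * t)))
      = (fun y : Rn n => ‖x - y‖ ^ 2) * fun _ => -(1 / (4 * t)) := by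
    funext y
    change _ = ‖x - y‖ ^ 2 * -(1 / (4 * t))
    ring
  rw [h4]
  exact h3

theorem norm_iteratedFDeriv_exp (A s : ℝ) (i : ℕ) :
    ‖iteratedFDeriv ℝ i (fun s : ℝ => ((A * Real.exp s : ℝ) : ℂ)) s‖ = |A| * Real.exp s := by
  have hsm : ContDiff ℝ i (fun s : ℝ => A * Real.exp s) := contDiff_const.mul Real.contDiff_exp
  have h := Complex.ofRealLI.norm_iteratedFDeriv_comp_left (hsm.contDiffAt (x := s)) le_rfl
  have h' : (fun s : ℝ => ((A * Real.exp s : ℝ) : ℂ))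
      = Complex.ofRealLI ∘ fun s : ℝ => A * Real.exp s := rfl
  rw [h', h, norm_iteratedFDeriv_eq_norm_iteratedDeriv, iteratedDeriv_const_mul_field,
    iteratedDeriv_eq_iterate, Real.iter_deriv_exp, norm_mul, Real.norm_eq_abs, Real.norm_eq_abs,
    Real.abs_exp]

/-- For `t > 0`, the heat kernel `y ↦ (4πt)^{-n/2} exp(-|x - y|² / (4t))` centred at `x`, as a
Schwartz function. -/
def heatSchwartz {n : ℕ} (t : ℝ) (ht : 0 < t) (x : Rn n) : 𝓢(Rn n, ℂ) where
  toFun y := (heatKernel t x y : ℂ)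
  smooth' := by
    have h := (hasTemperateGrowth_exponent t x).1
    exact Complex.ofRealCLM.contDiff.comp (contDiff_const.mul (Real.contDiff_exp.comp h))
  decay' := by
    intro k m
    set A : ℝ := (4 * π * t) ^ (-(n : ℝ) / 2)
    set f : Rn n → ℝ := fun y => -(‖x - y‖ ^ 2 / (4 * t)) with hf
    obtain ⟨l, C, hC0, hC⟩ := (hasTemperateGrowth_exponent t x).norm_iteratedFDeriv_le_uniform m
    obtain ⟨K, hK0, hK⟩ := one_add_pow_le_gaussian (k + l * m) (c := 1 / (4 * t)) (by positivity)
    refine ⟨m.factorial * |A| * (1 + C) ^ m * (1 + ‖x‖) ^ (k + l * m) * K, fun y => ?_⟩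
    have hgs : ContDiff ℝ ∞ (fun s : ℝ => ((A * Real.exp s : ℝ) : ℂ)) :=
      Complex.ofRealCLM.contDiff.comp (contDiff_const.mul Real.contDiff_exp)
    have hcomp := norm_iteratedFDeriv_comp_le (n := m) (x := y) hgs
      (hasTemperateGrowth_exponent t x).1 (by exact_mod_cast le_top)
      (C := |A| * Real.exp (f y)) (D := (1 + C) * (1 + ‖y‖) ^ l)
      (fun i _ => (norm_iteratedFDeriv_exp A (f y) i).le)
      (fun i hi him => by
        have h1 : (1 : ℝ) ≤ (1 + C) * (1 + ‖y‖) ^ l :=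
          one_le_mul_of_one_le_of_one_le (by linarith)
            (one_le_pow₀ (by linarith [norm_nonneg y]))
        have h2 : C * (1 + ‖y‖) ^ l ≤ (1 + C) * (1 + ‖y‖) ^ l := by
          gcongr; linarith
        exact (hC i him y).trans (h2.trans (le_self_pow₀ h1 (by omega))))
    have hy : 1 + ‖y‖ ≤ (1 + ‖x‖) * (1 + ‖x - y‖) := by
      have : ‖y‖ ≤ ‖x‖ + ‖x - y‖ := by
        have := norm_sub_le x (x - y); simpa using this
      nlinarith [norm_nonneg x, norm_nonneg (x - y), mul_nonneg (norm_nonneg x) (norm_nonneg (x - y))]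
    have hfy : Real.exp (f y) = Real.exp (-(1 / (4 * t) * ‖x - y‖ ^ 2)) := by
      simp only [hf]; congr 1; ring
    have hyk : ‖y‖ ^ k ≤ (1 + ‖y‖) ^ k := by gcongr; linarith
    calc ‖y‖ ^ k * ‖iteratedFDeriv ℝ m (fun y : Rn n => (heatKernel t x y : ℂ)) y‖
        ≤ (1 + ‖y‖) ^ k * (m.factorial * (|A| * Real.exp (f y)) * ((1 + C) * (1 + ‖y‖) ^ l) ^ m) := by
          gcongr
          exact hcomp
      _ = m.factorial * |A| * (1 + C) ^ m * ((1 + ‖y‖) ^ (k + l * m) * Real.exp (f y)) := by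
          rw [mul_pow, ← pow_mul, pow_add]; ring
      _ ≤ m.factorial * |A| * (1 + C) ^ m *
            (((1 + ‖x‖) * (1 + ‖x - y‖)) ^ (k + l * m) * Real.exp (f y)) := by
          gcongr
      _ = m.factorial * |A| * (1 + C) ^ m * (1 + ‖x‖) ^ (k + l * m) *
            ((1 + ‖x - y‖) ^ (k + l * m) * Real.exp (-(1 / (4 * t) * ‖x - y‖ ^ 2))) := by
          rw [mul_pow, hfy]; ring
      _ ≤ _ := by
          gcongr
          exact hK _ (norm_nonneg _)

/-- The heat extension `e^{tΔ} f (x) = (f ∗ heat kernel)(x)` of a tempered distribution `f`: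
for `t > 0` this is the pairing of `f` with the heat kernel centred at `x`
(only times `t > 0` are ever used). -/
def heatExt {n : ℕ} (f : 𝓢'(Rn n, ℂ)) (t : ℝ) (x : Rn n) : ℂ :=
  if ht : 0 < t then f (heatSchwartz t ht x) else 0

/-! ### The function spaces -/

/-- The quantity `r^{2α-n} ∫_0^{r²} ∫_{|y-x|<r} |g(t,y)|² t^{-α} dy dt`. -/
def carleson {n : ℕ} (α : ℝ) (g : ℝ → Rn n → ℂ) (x : Rn n) (r : ℝ) : ℝ≥0∞ :=
  ENNReal.ofReal (r ^ (2 * α - n)) *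
    ∫⁻ t in Ioo 0 (r ^ 2), ∫⁻ y in Metric.ball x r,
      ‖g t y‖ₑ ^ 2 * ENNReal.ofReal (t ^ (-α))

/-- The norm of `Q⁻¹_{α;T}`, for `T ∈ (0,∞]`; the radii range over `0 < r < T`. -/
def qNorm {n : ℕ} (α : ℝ) (T : ℝ≥0∞) (f : 𝓢'(Rn n, ℂ)) : ℝ≥0∞ :=
  ⨆ (x : Rn n) (r : ℝ) (_ : 0 < r) (_ : ENNReal.ofReal r < T),
    carleson α (heatExt f) x r ^ (1 / 2 : ℝ)

/-- The norm of `(Q⁻¹_{α;T})ⁿ`. -/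
def qNormVec {n : ℕ} (α : ℝ) (T : ℝ≥0∞) (a : Fin n → 𝓢'(Rn n, ℂ)) : ℝ≥0∞ :=
  ∑ j, qNorm α T (a j)

/-- The tempered distribution `f` belongs to the space `\overline{VQ_α^{-1}}`. -/
def MemVQ {n : ℕ} (α : ℝ) (f : 𝓢'(Rn n, ℂ)) : Prop :=
  Tendsto (fun T : ℝ≥0∞ => qNorm α T f) (𝓝[>] 0) (𝓝 0)

/-- The norm of `X_{α;T}`, for `T ∈ (0,∞]`; the times range over `0 < t < T` and the radii over
`0 < r² < T`. -/
def xNorm {n : ℕ} (α : ℝ) (T : ℝ≥0∞) (g : ℝ → Rn n → ℂ) : ℝ≥0∞ :=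
  (⨆ (t : ℝ) (_ : 0 < t) (_ : ENNReal.ofReal t < T),
      ENNReal.ofReal (√t) * eLpNorm (g t) ⊤ volume) +
    ⨆ (x : Rn n) (r : ℝ) (_ : 0 < r) (_ : ENNReal.ofReal (r ^ 2) < T),
      carleson α g x r ^ (1 / 2 : ℝ)

/-- The norm of `(X_{α;T})ⁿ`. -/
def xNormVec {n : ℕ} (α : ℝ) (T : ℝ≥0∞) (u : Fin n → ℝ → Rn n → ℂ) : ℝ≥0∞ :=
  ∑ j, xNorm α T (u j)

/-- The function `g` on `(0,T) × ℝⁿ` belongs to `X_{α;T}`: it is (Lebesgue) measurable, all its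
time slices are measurable, and its norm is finite. Values outside `(0,T) × ℝⁿ` are irrelevant. -/
structure MemX {n : ℕ} (α : ℝ) (T : ℝ≥0∞) (g : ℝ → Rn n → ℂ) : Prop where
  aestronglyMeasurable : AEStronglyMeasurable (Function.uncurry g)
    (volume.restrict ({t : ℝ | 0 < t ∧ ENNReal.ofReal t < T} ×ˢ (univ : Set (Rn n))))
  slice (t : ℝ) (ht : 0 < t) (htT : ENNReal.ofReal t < T) : AEStronglyMeasurable (g t) volume
  norm_lt_top : xNorm α T g < ⊤

/-! ### The Navier–Stokes system in mild form -/

/-- `∇ · a = 0` in the sense of tempered distributions. -/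
def DivFree {n : ℕ} (a : Fin n → 𝓢'(Rn n, ℂ)) : Prop :=
  ∑ j, ∂_{(EuclideanSpace.single j (1 : ℝ) : Rn n)} (a j) = 0

/-- The Fourier symbol `exp(-4π²t|ξ|²)` of `e^{tΔ}`. -/
def heatSymbol {n : ℕ} (t : ℝ) (ξ : Rn n) : ℂ :=
  ((Real.exp (-(4 * π ^ 2 * t * ‖ξ‖ ^ 2)) : ℝ) : ℂ)

/-- The Fourier symbol `2πi ξ_l` of `∂_l`. -/
def derivSymbol {n : ℕ} (l : Fin n) (ξ : Rn n) : ℂ :=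
  2 * (π : ℂ) * Complex.I * (ξ l : ℂ)

/-- The Fourier symbol `i ξ_j / |ξ|` of the Riesz transform `R_j = ∂_j (-Δ)^{-1/2}`. -/
def rieszSymbol {n : ℕ} (j : Fin n) (ξ : Rn n) : ℂ :=
  derivSymbol j ξ / ((2 * π * ‖ξ‖ : ℝ) : ℂ)

/-- The Fourier symbol of the entry `P_{jk} = δ_{jk} + R_j R_k` of the Helmholtz–Weyl (Leray)
projection. -/
def leraySymbol {n : ℕ} (j k : Fin n) (ξ : Rn n) : ℂ :=
  (if j = k then 1 else 0) + rieszSymbol j ξ * rieszSymbol k ξ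

/-- The convolution kernel of the operator `e^{tΔ} P_{jk} ∂_l` for `t > 0`: the inverse Fourier
transform of its symbol, which is an integrable function. -/
def oseenKernel {n : ℕ} (j k l : Fin n) (t : ℝ) : Rn n → ℂ :=
  𝓕⁻ (fun ξ : Rn n => heatSymbol t ξ * leraySymbol j k ξ * derivSymbol l ξ)

/-- The `j`-th component of `∫_0^t e^{(t-s)Δ} P ∇·(u ⊗ u) ds`, where
`(P ∇·(u ⊗ u))_j = ∑_{k,l} P_{jk} ∂_l (u_l u_k)`. -/
def nsBilinear {n : ℕ} (u : Fin n → ℝ → Rn n → ℂ) (j : Fin n) (t : ℝ) (x : Rn n) : ℂ :=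
  ∫ s in Ioo 0 t, ∑ k, ∑ l, ∫ y, oseenKernel j k l (t - s) (x - y) * (u l s y * u k s y)

/-- `u` is a mild solution on `(0,T) × ℝⁿ`, with initial velocity `a`, of the incompressible
Navier–Stokes system: for every time `t ∈ (0,T)` and almost every `x`, the integrals over
`(0,t) × ℝⁿ` that make up the Duhamel term converge absolutely and
`u(t,x) = e^{tΔ} a(x) - ∫_0^t e^{(t-s)Δ} P ∇·(u ⊗ u) ds`. -/
def IsMildSolution {n : ℕ} (T : ℝ≥0∞) (a : Fin n → 𝓢'(Rn n, ℂ)) (u : Fin n → ℝ → Rn n → ℂ) :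
    Prop :=
  ∀ t : ℝ, 0 < t → ENNReal.ofReal t < T → ∀ j : Fin n, ∀ᵐ x : Rn n,
    (∀ k l : Fin n, IntegrableOn
      (fun p : ℝ × Rn n => oseenKernel j k l (t - p.1) (x - p.2) * (u l p.1 p.2 * u k p.1 p.2))
      (Ioo 0 t ×ˢ univ)) ∧
    u j t x = heatExt (a j) t x - nsBilinear u j t x

/-- `u` is a mild solution with initial velocity `a` that belongs to `(X_{α;T})ⁿ`. -/
def IsMildSolutionX {n : ℕ} (α : ℝ) (T : ℝ≥0∞) (a : Fin n → 𝓢'(Rn n, ℂ))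
    (u : Fin n → ℝ → Rn n → ℂ) : Prop :=
  (∀ j, MemX α T (u j)) ∧ IsMildSolution T a u

/-- The tempered distribution `f` is real-valued: it takes real values on real test functions. -/
def IsRealDist {n : ℕ} (f : 𝓢'(Rn n, ℂ)) : Prop :=
  ∀ φ : 𝓢(Rn n, ℂ), (∀ x, (φ x).im = 0) → (f φ).im = 0

/-- Within the closed ball of radius `δ` of `(X_{α;T})ⁿ` there is exactly one mild solution with
initial velocity `a` (up to null sets of `ℝⁿ` at each time), its norm is at most `η`, and it
is real-valued if `a` is. -/
def HasUniqueSmallMildSolution {n : ℕ} (α : ℝ) (T : ℝ≥0∞) (a : Fin n → 𝓢'(Rn n, ℂ))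
    (δ η : ℝ≥0∞) : Prop :=
  ∃ u : Fin n → ℝ → Rn n → ℂ, IsMildSolutionX α T a u ∧ xNormVec α T u ≤ δ ∧ xNormVec α T u ≤ η ∧
    ((∀ j, IsRealDist (a j)) →
      ∀ j, ∀ t : ℝ, 0 < t → ENNReal.ofReal t < T → ∀ᵐ x : Rn n, (u j t x).im = 0) ∧
    ∀ v : Fin n → ℝ → Rn n → ℂ, IsMildSolutionX α T a v → xNormVec α T v ≤ δ →
      ∀ j, ∀ t : ℝ, 0 < t → ENNReal.ofReal t < T → v j t =ᵐ[volume] u j t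

end

end QNavierStokes

/-!
The Navier–Stokes system is solved by the contraction principle of Koch and Tataru, in the space
`X_{α;T}`. Three facts carry the argument.

* *The heat extension maps `Q⁻¹_{α;S}` to `X_{α;T}` when `T ≤ S²`* (`exists_xNorm_heatExt_le`). The
  Carleson part of the norm of `X_{α;T}` is bounded by definition. For the pointwise part, the
  semigroup property on tempered distributions (`heatExt_add`) writes `e^{tΔ} f` as a Gaussian
  average of `e^{sΔ} f` over `s < t / 2`, and the square of such an average is bounded by Carleson
  masses. For finite times the norms of `Q⁻¹_{α;S}` and `Q⁻¹_{α;T}` are equivalent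
  (`exists_qNorm_le_mul_qNorm`).

* *The kernel of `e^{tΔ} P_{jk} ∂_l` is at most a multiple of `(√t + |x|)^{-(n+1)}`*
  (`exists_enorm_oseenKernel_le`). Up to the smooth part `δ_{jk}`, its symbol is an integral over
  `τ ∈ (t,∞)` of the symbols of `e^{τΔ} ∂_j ∂_k ∂_l`, which are dilations of one Schwartz function.

* *The bilinear estimate in `X_{α;T}`* (`exists_nsBilinear_sub_bounds`). Because `α > 0`, no
  cancellation is needed: absolute values may be put inside, which leaves the positive operator
  `majorant` applied to a nonnegative source `F` with `t F ≤ A` and Carleson mass at most `A`. Its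
  pointwise bound `majorant F t x ≤ C A t^{-1/2}` comes from splitting time at `t / 2`. One of the two
  factors in the square is then estimated by the pointwise bound, so that the Carleson mass of the
  square becomes linear in `majorant F`, and Tonelli's theorem reduces it to the mass of `F`, since
  `∫_s^∞ t^{-1/2-α} (t-s)^{-1/2} dt` is a multiple of `s^{-α}`.

The Picard iterates started at zero are defined and measurable everywhere. The pointwise form of
the bilinear estimate makes them converge at every point, Fatou's lemma bounds the limit, and the
limit solves the equation at every point. Uniqueness is the contraction estimate once more, and
realness passes from the iterates to the limit. Divergence-free data are not singled out: the
integral equation makes sense, and is solved, for arbitrary small data.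

The semigroup property needs that a tempered distribution commutes with the integral that defines a
convolution of Schwartz functions. By the Hahn–Banach theorem a tempered distribution factors
through finitely many weighted jets in spaces of bounded continuous functions
(`exists_eq_comp_jetFamily`), where Bochner integration is available.
-/

namespace QNavierStokes

noncomputable section

/-! ### Tempered distributions and convolution of Schwartz functions -/

/-- The Banach space of bounded continuous functions with values in the `m`-multilinear maps. -/
def JetSpace (n m : ℕ) : Type := BoundedContinuousFunction (Rn n) (Rn n [×m]→L[ℝ] ℂ)

instance (n m : ℕ) : NormedAddCommGroup (JetSpace n m) :=
  inferInstanceAs (NormedAddCommGroup (BoundedContinuousFunction (Rn n) (Rn n [×m]→L[ℝ] ℂ)))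

instance (n m : ℕ) : NormedSpace ℂ (JetSpace n m) :=
  inferInstanceAs (NormedSpace ℂ (BoundedContinuousFunction (Rn n) (Rn n [×m]→L[ℝ] ℂ)))

instance (n m : ℕ) : CompleteSpace (JetSpace n m) :=
  inferInstanceAs (CompleteSpace (BoundedContinuousFunction (Rn n) (Rn n [×m]→L[ℝ] ℂ)))

/-- Evaluation of a jet at a point and at a tuple of vectors. -/
def jetEval {n m : ℕ} (x : Rn n) (v : Fin m → Rn n) : JetSpace n m →L[ℝ] ℂ :=
  (ContinuousMultilinearMap.apply ℝ (fun _ : Fin m => Rn n) ℂ v).comp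
    (BoundedContinuousFunction.evalCLM ℝ x)

theorem jetSpace_ext {n m : ℕ} {F G : JetSpace n m} (h : ∀ x v, jetEval x v F = jetEval x v G) :
    F = G :=
  BoundedContinuousFunction.ext fun x => ContinuousMultilinearMap.ext fun v => h x v

/-- The bounded continuous function `x ↦ ‖x‖ᵏ Dᵐφ(x)` attached to a Schwartz function `φ`; its
sup norm is the Schwartz seminorm of index `(k, m)`. -/
def weightedJet {n : ℕ} (i : ℕ × ℕ) : 𝓢(Rn n, ℂ) →ₗ[ℂ] JetSpace n i.2 where
  toFun φ := BoundedContinuousFunction.ofNormedAddCommGroup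
    (fun x => (‖x‖ ^ i.1 : ℝ) • iteratedFDeriv ℝ i.2 φ x)
    ((continuous_norm.pow _).smul ((φ.smooth i.2).continuous_iteratedFDeriv le_rfl))
    (SchwartzMap.seminorm ℂ i.1 i.2 φ)
    (fun x => by
      rw [norm_smul, norm_pow, norm_norm]
      exact SchwartzMap.le_seminorm ℂ i.1 i.2 φ x)
  map_add' φ ψ := by
    refine BoundedContinuousFunction.ext fun x => ?_
    have h : iteratedFDeriv ℝ i.2 (φ + ψ : 𝓢(Rn n, ℂ)) x
        = iteratedFDeriv ℝ i.2 φ x + iteratedFDeriv ℝ i.2 ψ x := by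
      have := iteratedFDeriv_add_apply (x := x) (i := i.2) ((φ.smooth i.2).contDiffAt)
        ((ψ.smooth i.2).contDiffAt)
      exact this
    change (‖x‖ ^ i.1 : ℝ) • iteratedFDeriv ℝ i.2 (φ + ψ : 𝓢(Rn n, ℂ)) x
      = (‖x‖ ^ i.1 : ℝ) • iteratedFDeriv ℝ i.2 φ x + (‖x‖ ^ i.1 : ℝ) • iteratedFDeriv ℝ i.2 ψ x
    rw [h, smul_add]
  map_smul' c φ := by
    refine BoundedContinuousFunction.ext fun x => ?_
    have h : iteratedFDeriv ℝ i.2 (c • φ : 𝓢(Rn n, ℂ)) x = c • iteratedFDeriv ℝ i.2 φ x :=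
      iteratedFDeriv_const_smul_apply ((φ.smooth i.2).contDiffAt)
    change (‖x‖ ^ i.1 : ℝ) • iteratedFDeriv ℝ i.2 (c • φ : 𝓢(Rn n, ℂ)) x
      = c • (‖x‖ ^ i.1 : ℝ) • iteratedFDeriv ℝ i.2 φ x
    rw [h, smul_comm]

theorem norm_jetSpace_le {n m : ℕ} (F : BoundedContinuousFunction (Rn n) (Rn n [×m]→L[ℝ] ℂ))
    {C : ℝ} (hC : 0 ≤ C) (h : ∀ x, ‖F x‖ ≤ C) : ‖(F : JetSpace n m)‖ ≤ C :=
  (BoundedContinuousFunction.norm_le hC).2 h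

theorem seminorm_le_norm_weightedJet {n : ℕ} (i : ℕ × ℕ) (φ : 𝓢(Rn n, ℂ)) :
    SchwartzMap.seminorm ℂ i.1 i.2 φ ≤ ‖weightedJet i φ‖ := by
  refine SchwartzMap.seminorm_le_bound ℂ _ _ φ (norm_nonneg (weightedJet i φ)) fun x => ?_
  have h : ‖(‖x‖ ^ i.1 : ℝ) • iteratedFDeriv ℝ i.2 φ x‖ ≤ ‖weightedJet i φ‖ :=
    BoundedContinuousFunction.norm_coe_le_norm
      (weightedJet i φ : BoundedContinuousFunction (Rn n) (Rn n [×i.2]→L[ℝ] ℂ)) x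
  rwa [norm_smul, norm_pow, norm_norm] at h

/-- The finite family of the weighted jets with indices in `s`. -/
def jetFamily {n : ℕ} (s : Finset (ℕ × ℕ)) :
    𝓢(Rn n, ℂ) →ₗ[ℂ] (i : s) → JetSpace n (i : ℕ × ℕ).2 :=
  LinearMap.pi fun i => weightedJet (i : ℕ × ℕ)

/-- A tempered distribution is a continuous functional of finitely many weighted jets: it is
dominated by finitely many seminorms, and the Hahn–Banach theorem applies. -/
theorem exists_eq_comp_jetFamily {n : ℕ} (f : 𝓢'(Rn n, ℂ)) :
    ∃ (s : Finset (ℕ × ℕ)) (G : ((i : s) → JetSpace n (i : ℕ × ℕ).2) →L[ℂ] ℂ),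
      ∀ φ, f φ = G (jetFamily s φ) := by
  obtain ⟨s, C, -, hC⟩ := Seminorm.bound_of_continuous (schwartz_withSeminorms ℂ (Rn n) ℂ)
    ((normSeminorm ℂ ℂ).comp (f : 𝓢(Rn n, ℂ) →ₗ[ℂ] ℂ)) (by
      change Continuous fun φ => ‖f φ‖
      exact continuous_norm.comp (map_continuous f))
  have hb : ∀ φ, ‖f φ‖ ≤ C * ‖jetFamily s φ‖ := fun φ => by
    refine (hC φ).trans ?_
    change (C : ℝ) * _ ≤ _
    gcongr
    refine Seminorm.finset_sup_apply_le (norm_nonneg (jetFamily s φ)) fun i hi => ?_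
    exact (seminorm_le_norm_weightedJet i φ).trans (norm_le_pi_norm (jetFamily s φ) ⟨i, hi⟩)
  set J := jetFamily (n := n) s with hJ
  obtain ⟨R, hR⟩ : ∃ R : LinearMap.range J →ₗ[ℂ] 𝓢(Rn n, ℂ),
      J.rangeRestrict ∘ₗ R = LinearMap.id :=
    have : Module.Projective ℂ (LinearMap.range J) := Module.Projective.of_free
    J.rangeRestrict.exists_rightInverse_of_surjective J.range_rangeRestrict
  have hR' : ∀ w, J (R w) = w := fun w => congrArg Subtype.val (LinearMap.congr_fun hR w)
  let g : StrongDual ℂ (LinearMap.range J) :=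
    ((f : 𝓢(Rn n, ℂ) →ₗ[ℂ] ℂ) ∘ₗ R).mkContinuous C fun w => by
      have := hb (R w)
      rwa [hR'] at this
  obtain ⟨G, hG, -⟩ := exists_extension_norm_eq (LinearMap.range J) g
  refine ⟨s, G, fun φ => ?_⟩
  have h1 : G (J φ) = f (R ⟨J φ, LinearMap.mem_range_self J φ⟩) :=
    hG ⟨J φ, LinearMap.mem_range_self J φ⟩
  have h2 := hb (φ - R ⟨J φ, LinearMap.mem_range_self J φ⟩)
  rw [map_sub, map_sub, hR'] at h2
  simp only [sub_self, norm_zero, mul_zero, norm_le_zero_iff] at h2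
  rw [h1]
  exact sub_eq_zero.1 h2

theorem iteratedFDeriv_compSubConst {n : ℕ} (m : ℕ) (φ : 𝓢(Rn n, ℂ)) (y x : Rn n) :
    iteratedFDeriv ℝ m (SchwartzMap.compSubConstCLM ℂ y φ) x = iteratedFDeriv ℝ m φ (x - y) := by
  have : (SchwartzMap.compSubConstCLM ℂ y φ : Rn n → ℂ) = fun x => φ (x - y) := by
    ext x; simp
  rw [this, iteratedFDeriv_comp_sub]

/-- Each seminorm of a translate of a Schwartz function grows at most polynomially, uniformly
in the evaluation point. -/
theorem exists_pow_mul_iteratedFDeriv_sub_le {n : ℕ} (k m : ℕ) (φ : 𝓢(Rn n, ℂ)) :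
    ∃ C : ℝ, 0 ≤ C ∧ ∀ x y : Rn n,
      ‖x‖ ^ k * ‖iteratedFDeriv ℝ m φ (x - y)‖ ≤ C * (1 + ‖y‖) ^ k := by
  set C := 2 ^ k * (Finset.Iic (k, m)).sup (fun m => SchwartzMap.seminorm ℂ m.1 m.2) φ
  refine ⟨C, by positivity, fun x y => ?_⟩
  have h := SchwartzMap.one_add_le_sup_seminorm_apply (𝕜 := ℂ) (m := (k, m)) le_rfl le_rfl φ (x - y)
  have hx : ‖x‖ ≤ (1 + ‖x - y‖) * (1 + ‖y‖) := by
    have : ‖x‖ ≤ ‖x - y‖ + ‖y‖ := by simpa using norm_add_le (x - y) y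
    nlinarith [norm_nonneg y, norm_nonneg (x - y), mul_nonneg (norm_nonneg (x-y)) (norm_nonneg y)]
  calc ‖x‖ ^ k * ‖iteratedFDeriv ℝ m φ (x - y)‖
      ≤ ((1 + ‖x - y‖) * (1 + ‖y‖)) ^ k * ‖iteratedFDeriv ℝ m φ (x - y)‖ := by gcongr
    _ = ((1 + ‖x - y‖) ^ k * ‖iteratedFDeriv ℝ m φ (x - y)‖) * (1 + ‖y‖) ^ k := by
        rw [mul_pow]; ring
    _ ≤ _ := by gcongr

theorem exists_norm_jetFamily_translate_le {n : ℕ} (s : Finset (ℕ × ℕ)) (φ : 𝓢(Rn n, ℂ)) :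
    ∃ (C : ℝ) (N : ℕ), 0 ≤ C ∧ ∀ y : Rn n,
      ‖jetFamily s (SchwartzMap.compSubConstCLM ℂ y φ)‖ ≤ C * (1 + ‖y‖) ^ N := by
  choose C hC0 hC using fun i : ℕ × ℕ => exists_pow_mul_iteratedFDeriv_sub_le i.1 i.2 φ
  refine ⟨∑ i ∈ s, C i, s.sup Prod.fst, Finset.sum_nonneg fun i _ => hC0 i, fun y => ?_⟩
  have hD : 0 ≤ ∑ i ∈ s, C i := Finset.sum_nonneg fun i _ => hC0 i
  refine (pi_norm_le_iff_of_nonneg (by positivity)).2 fun i => ?_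
  refine norm_jetSpace_le _ (by positivity) fun x => ?_
  change ‖(‖x‖ ^ (i : ℕ × ℕ).1 : ℝ) • iteratedFDeriv ℝ (i : ℕ × ℕ).2
    (SchwartzMap.compSubConstCLM ℂ y φ) x‖ ≤ _
  rw [norm_smul, norm_pow, norm_norm, iteratedFDeriv_compSubConst]
  refine (hC _ x y).trans ?_
  gcongr
  · exact Finset.single_le_sum (f := C) (fun i _ => hC0 i) i.2
  · linarith [norm_nonneg y]
  · exact Finset.le_sup (f := Prod.fst) i.2

theorem continuous_jetFamily_translate {n : ℕ} (s : Finset (ℕ × ℕ)) (φ : 𝓢(Rn n, ℂ)) :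
    Continuous fun y => jetFamily s (SchwartzMap.compSubConstCLM ℂ y φ) := by
  refine continuous_pi fun i => ?_
  change Continuous fun y => weightedJet (i : ℕ × ℕ) (SchwartzMap.compSubConstCLM ℂ y φ)
  obtain ⟨C, hC0, hC⟩ := exists_pow_mul_iteratedFDeriv_sub_le (i : ℕ × ℕ).1 ((i : ℕ × ℕ).2 + 1) φ
  refine continuous_iff_continuousAt.2 fun y => ?_
  rw [ContinuousAt, tendsto_iff_norm_sub_tendsto_zero]
  have hlim : Tendsto (fun y' => C * (2 + ‖y‖) ^ (i : ℕ × ℕ).1 * ‖y' - y‖) (𝓝 y) (𝓝 0) := by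
    have : Continuous fun y' => C * (2 + ‖y‖) ^ (i : ℕ × ℕ).1 * ‖y' - y‖ := by fun_prop
    simpa using this.tendsto y
  refine squeeze_zero' (Eventually.of_forall fun _ => norm_nonneg _) ?_ hlim
  filter_upwards [Metric.ball_mem_nhds y one_pos] with y' hy'
  rw [Metric.mem_ball, dist_eq_norm] at hy'
  refine norm_jetSpace_le _ (by positivity) fun x => ?_
  change ‖(‖x‖ ^ (i : ℕ × ℕ).1 : ℝ) • iteratedFDeriv ℝ (i : ℕ × ℕ).2
      (SchwartzMap.compSubConstCLM ℂ y' φ) x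
    - (‖x‖ ^ (i : ℕ × ℕ).1 : ℝ) • iteratedFDeriv ℝ (i : ℕ × ℕ).2
      (SchwartzMap.compSubConstCLM ℂ y φ) x‖ ≤ _
  rw [← smul_sub, norm_smul, norm_pow, norm_norm,
    iteratedFDeriv_compSubConst, iteratedFDeriv_compSubConst]
  rcases eq_or_ne (‖x‖ ^ (i : ℕ × ℕ).1) 0 with h0 | h0
  · rw [h0, zero_mul]; positivity
  have hpos : 0 < ‖x‖ ^ (i : ℕ × ℕ).1 := lt_of_le_of_ne (by positivity) h0.symm
  have hmv := (convex_ball y 1).norm_image_sub_le_of_norm_fderiv_le (𝕜 := ℝ)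
    (f := fun z => iteratedFDeriv ℝ (i : ℕ × ℕ).2 φ (x - z))
    (C := C * (2 + ‖y‖) ^ (i : ℕ × ℕ).1 / ‖x‖ ^ (i : ℕ × ℕ).1)
    (fun z _ => by
      have : Differentiable ℝ (iteratedFDeriv ℝ (i : ℕ × ℕ).2 φ) :=
        (φ.smooth ⊤).differentiable_iteratedFDeriv (by exact_mod_cast WithTop.coe_lt_top _)
      fun_prop)
    (fun z hz => by
      rw [Metric.mem_ball, dist_eq_norm] at hz
      have h1 : fderiv ℝ (fun z => iteratedFDeriv ℝ (i : ℕ × ℕ).2 φ (x - z)) z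
          = - fderiv ℝ (iteratedFDeriv ℝ (i : ℕ × ℕ).2 φ) (x - z) := by
        have hd : DifferentiableAt ℝ (iteratedFDeriv ℝ (i : ℕ × ℕ).2 φ) (x - z) :=
          (φ.smooth ⊤).differentiable_iteratedFDeriv (by exact_mod_cast WithTop.coe_lt_top _) _
        have := (hd.hasFDerivAt.comp z ((hasFDerivAt_id z).const_sub x)).fderiv
        simpa [Function.comp_def] using this
      rw [h1, norm_neg, norm_fderiv_iteratedFDeriv, le_div_iff₀' hpos]
      have h2 : 1 + ‖z‖ ≤ 2 + ‖y‖ := by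
        have : ‖z‖ ≤ ‖z - y‖ + ‖y‖ := by simpa using norm_add_le (z - y) y
        linarith
      exact (hC x z).trans (by gcongr))
    (Metric.mem_ball_self one_pos) (by rwa [Metric.mem_ball, dist_eq_norm])
  calc _ ≤ ‖x‖ ^ (i : ℕ × ℕ).1 * (C * (2 + ‖y‖) ^ (i : ℕ × ℕ).1 / ‖x‖ ^ (i : ℕ × ℕ).1 * ‖y' - y‖) := by
        gcongr
    _ = _ := by field_simp

theorem continuous_apply_translate {n : ℕ} (f : 𝓢'(Rn n, ℂ)) (φ : 𝓢(Rn n, ℂ)) :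
    Continuous fun y => f (SchwartzMap.compSubConstCLM ℂ y φ) := by
  obtain ⟨s, G, hG⟩ := exists_eq_comp_jetFamily f
  simp_rw [hG]
  exact G.continuous.comp (continuous_jetFamily_translate s φ)

open SchwartzMap in
theorem lineDerivOp_convolution {n : ℕ} (ψ φ : 𝓢(Rn n, ℂ)) (v : Rn n) :
    ∂_{v} (convolution (ContinuousLinearMap.mul ℂ ℂ) ψ φ)
      = convolution (ContinuousLinearMap.mul ℂ ℂ) ψ (∂_{v} φ) := by
  have hinj : Function.Injective (𝓕 : 𝓢(Rn n, ℂ) → 𝓢(Rn n, ℂ)) := fun a b h => by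
    have := congrArg (𝓕⁻ : 𝓢(Rn n, ℂ) → 𝓢(Rn n, ℂ)) h
    simpa using this
  apply hinj
  rw [fourier_lineDerivOp_eq, fourier_convolution, fourier_convolution, fourier_lineDerivOp_eq]
  have hg : (inner ℝ · v : Rn n → ℝ).HasTemperateGrowth := by fun_prop
  ext x
  simp [smulLeftCLM_apply_apply hg, pairing_apply_apply]
  ring

open SchwartzMap in
theorem iteratedFDeriv_convolution {n : ℕ} (ψ φ : 𝓢(Rn n, ℂ)) (m : ℕ) (v : Fin m → Rn n)
    (x : Rn n) :
    iteratedFDeriv ℝ m (convolution (ContinuousLinearMap.mul ℂ ℂ) ψ φ) x v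
      = ∫ y, ψ y * iteratedFDeriv ℝ m φ (x - y) v := by
  have key : ∂^{v} (convolution (ContinuousLinearMap.mul ℂ ℂ) ψ φ)
      = convolution (ContinuousLinearMap.mul ℂ ℂ) ψ (∂^{v} φ) := by
    induction m with
    | zero => simp
    | succ m ih =>
      rw [LineDeriv.iteratedLineDerivOp_succ_left, LineDeriv.iteratedLineDerivOp_succ_left, ih, lineDerivOp_convolution]
  rw [← iteratedLineDerivOp_eq_iteratedFDeriv, key, convolution_apply]
  simp only [← iteratedLineDerivOp_eq_iteratedFDeriv]
  rfl

open SchwartzMap in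
/-- A tempered distribution commutes with the integral defining a convolution. -/
theorem apply_convolution_eq_integral {n : ℕ} (f : 𝓢'(Rn n, ℂ)) (ψ φ : 𝓢(Rn n, ℂ)) :
    Integrable (fun y => ψ y * f (compSubConstCLM ℂ y φ)) ∧
    f (convolution (ContinuousLinearMap.mul ℂ ℂ) ψ φ) = ∫ y, ψ y * f (compSubConstCLM ℂ y φ) := by
  obtain ⟨s, G, hG⟩ := exists_eq_comp_jetFamily f
  obtain ⟨C, N, hC0, hC⟩ := exists_norm_jetFamily_translate_le s φ
  have hint : Integrable fun y => ψ y • jetFamily s (compSubConstCLM ℂ y φ) := by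
    have hd : Integrable fun y => C * (2 ^ N * (‖ψ y‖ + ‖y‖ ^ N * ‖ψ y‖)) :=
      (((ψ.integrable (μ := volume)).norm.add (ψ.integrable_pow_mul volume N)).const_mul _).const_mul _
    refine hd.mono' (ψ.continuous.smul (continuous_jetFamily_translate s φ)).aestronglyMeasurable
      (Eventually.of_forall fun y => ?_)
    rw [norm_smul]
    have h1 : (1 + ‖y‖) ^ N ≤ 2 ^ N * (1 + ‖y‖ ^ N) := by
      refine (add_pow_le zero_le_one (norm_nonneg y) N).trans ?_
      rw [one_pow]
      gcongr
      · norm_num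
      · omega
    calc ‖ψ y‖ * ‖jetFamily s (compSubConstCLM ℂ y φ)‖
        ≤ ‖ψ y‖ * (C * (2 ^ N * (1 + ‖y‖ ^ N))) := by
          gcongr
          exact (hC y).trans (by gcongr)
      _ = _ := by ring
  have hJ : jetFamily s (convolution (ContinuousLinearMap.mul ℂ ℂ) ψ φ)
      = ∫ y, ψ y • jetFamily s (compSubConstCLM ℂ y φ) := by
    funext i
    refine jetSpace_ext fun x v => ?_
    have h1 : (∫ y, ψ y • jetFamily s (compSubConstCLM ℂ y φ)) i
        = ∫ y, ψ y • weightedJet (i : ℕ × ℕ) (compSubConstCLM ℂ y φ) :=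
      ((ContinuousLinearMap.proj (R := ℂ) (φ := fun i : s => JetSpace n (i : ℕ × ℕ).2)
        i).integral_comp_comm hint).symm
    have hint1 : Integrable fun y => ψ y • weightedJet (i : ℕ × ℕ) (compSubConstCLM ℂ y φ) :=
      (ContinuousLinearMap.proj (R := ℂ) (φ := fun i : s => JetSpace n (i : ℕ × ℕ).2)
        i).integrable_comp hint
    rw [h1, ← (jetEval x v).integral_comp_comm hint1]
    change ((‖x‖ ^ (i : ℕ × ℕ).1 : ℝ) • iteratedFDeriv ℝ (i : ℕ × ℕ).2
        (convolution (ContinuousLinearMap.mul ℂ ℂ) ψ φ) x) v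
      = ∫ y, (ψ y • (‖x‖ ^ (i : ℕ × ℕ).1 : ℝ) • iteratedFDeriv ℝ (i : ℕ × ℕ).2
        (compSubConstCLM ℂ y φ) x) v
    rw [smul_apply, iteratedFDeriv_convolution, ← integral_smul]
    congr 1
    funext y
    rw [iteratedFDeriv_compSubConst]
    simp only [smul_apply, smul_eq_mul, Complex.real_smul]
    ring
  refine ⟨?_, ?_⟩
  · refine (G.integrable_comp hint).congr (Eventually.of_forall fun y => ?_)
    simp [hG]
  · rw [hG, hJ, ← G.integral_comp_comm hint]
    congr 1
    funext y
    rw [map_smul, smul_eq_mul, hG]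

/-! ### The heat semigroup -/

theorem heatSchwartz_apply {n : ℕ} {t : ℝ} (ht : 0 < t) (x y : Rn n) :
    heatSchwartz t ht x y = (heatKernel t x y : ℂ) := rfl

theorem heatSchwartz_eq_translate {n : ℕ} {t : ℝ} (ht : 0 < t) (x : Rn n) :
    heatSchwartz t ht x = SchwartzMap.compSubConstCLM ℂ x (heatSchwartz t ht 0) := by
  ext y
  simp [heatSchwartz_apply, heatKernel, norm_sub_rev x y]

theorem fourier_heatSchwartz {n : ℕ} {t : ℝ} (ht : 0 < t) (ξ : Rn n) :
    𝓕 (heatSchwartz t ht (0 : Rn n)) ξ = heatSymbol t ξ := by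
  rw [SchwartzMap.fourier_coe]
  have hb : 0 < ((1 / (4 * t) : ℝ) : ℂ).re := by rw [Complex.ofReal_re]; positivity
  have hg := fourier_gaussian_innerProductSpace hb ξ
  have hfun : (heatSchwartz t ht (0 : Rn n) : Rn n → ℂ) = fun v =>
      (((4 * π * t) ^ (-(n : ℝ) / 2) : ℝ) : ℂ) • Complex.exp (-((1 / (4 * t) : ℝ) : ℂ) * ‖v‖ ^ 2) := by
    funext v
    rw [heatSchwartz_apply, heatKernel, zero_sub, norm_neg, smul_eq_mul, Complex.ofReal_mul,
      Complex.ofReal_exp]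
    congr 2
    push_cast
    ring
  have hsm : 𝓕 (fun v : Rn n => (((4 * π * t) ^ (-(n : ℝ) / 2) : ℝ) : ℂ) •
        Complex.exp (-((1 / (4 * t) : ℝ) : ℂ) * ‖v‖ ^ 2)) ξ
      = (((4 * π * t) ^ (-(n : ℝ) / 2) : ℝ) : ℂ) •
        𝓕 (fun v : Rn n => Complex.exp (-((1 / (4 * t) : ℝ) : ℂ) * ‖v‖ ^ 2)) ξ := by
    simp only [Real.fourier_eq, ← integral_smul]
    congr 1
    funext v
    rw [smul_comm]
  rw [hfun, hsm, hg, heatSymbol, smul_eq_mul, ← mul_assoc]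
  have h1 : ((π : ℂ) / ((1 / (4 * t) : ℝ) : ℂ)) ^ ((Module.finrank ℝ (Rn n) : ℂ) / 2)
      = (((4 * π * t) ^ ((n : ℝ) / 2) : ℝ) : ℂ) := by
    rw [Complex.ofReal_cpow (by positivity)]
    congr 1
    · push_cast
      have : (t : ℂ) ≠ 0 := by exact_mod_cast ht.ne'
      field_simp
    · simp
  rw [h1, ← Complex.ofReal_mul, ← Real.rpow_add (by positivity)]
  have h2 : -(n : ℝ) / 2 + n / 2 = 0 := by ring
  rw [h2, Real.rpow_zero, Complex.ofReal_one, one_mul, Complex.ofReal_exp]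
  congr 1
  push_cast
  have : (t : ℂ) ≠ 0 := by exact_mod_cast ht.ne'
  field_simp

open SchwartzMap in
theorem convolution_heatSchwartz_zero {n : ℕ} {s t : ℝ} (hs : 0 < s) (ht : 0 < t) :
    convolution (ContinuousLinearMap.mul ℂ ℂ) (heatSchwartz s hs (0 : Rn n)) (heatSchwartz t ht 0)
      = heatSchwartz (s + t) (add_pos hs ht) 0 := by
  have hinj : Function.Injective (𝓕 : 𝓢(Rn n, ℂ) → 𝓢(Rn n, ℂ)) := fun a b h => by
    have := congrArg (𝓕⁻ : 𝓢(Rn n, ℂ) → 𝓢(Rn n, ℂ)) h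
    simpa using this
  apply hinj
  ext ξ
  rw [fourier_convolution, pairing_apply_apply, fourier_heatSchwartz, fourier_heatSchwartz,
    fourier_heatSchwartz, heatSymbol, heatSymbol, heatSymbol, ContinuousLinearMap.mul_apply',
    ← Complex.ofReal_mul, ← Real.exp_add]
  congr 2
  ring

open SchwartzMap in
theorem convolution_heatSchwartz {n : ℕ} {s t : ℝ} (hs : 0 < s) (ht : 0 < t) (x : Rn n) :
    convolution (ContinuousLinearMap.mul ℂ ℂ) (heatSchwartz s hs x) (heatSchwartz t ht 0)
      = heatSchwartz (s + t) (add_pos hs ht) x := by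
  rw [heatSchwartz_eq_translate (add_pos hs ht) x, ← convolution_heatSchwartz_zero hs ht,
    heatSchwartz_eq_translate hs x]
  ext z
  rw [compSubConstCLM_apply, convolution_apply, convolution_apply]
  simp only [MeasureTheory.convolution, compSubConstCLM_apply]
  rw [← integral_sub_right_eq_self (fun y => ContinuousLinearMap.mul ℂ ℂ
    (heatSchwartz s hs (0 : Rn n) y) (heatSchwartz t ht 0 (z - x - y))) x]
  simp only [sub_sub_sub_cancel_right]

/-- The semigroup property `e^{(s+t)Δ} = e^{sΔ} e^{tΔ}`, on tempered distributions. -/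
theorem heatExt_add {n : ℕ} (f : 𝓢'(Rn n, ℂ)) {s t : ℝ} (hs : 0 < s) (ht : 0 < t) (x : Rn n) :
    Integrable (fun y => (heatKernel s x y : ℂ) * heatExt f t y) ∧
    heatExt f (s + t) x = ∫ y, (heatKernel s x y : ℂ) * heatExt f t y := by
  have h := apply_convolution_eq_integral f (heatSchwartz s hs x) (heatSchwartz t ht 0)
  rw [convolution_heatSchwartz] at h
  simp only [← heatSchwartz_eq_translate] at h
  simp only [heatExt, ht, add_pos hs ht, dif_pos]
  exact h

theorem continuous_heatExt {n : ℕ} (f : 𝓢'(Rn n, ℂ)) (t : ℝ) : Continuous (heatExt f t) := by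
  by_cases ht : 0 < t
  · have h := continuous_apply_translate f (heatSchwartz t ht 0)
    simp only [← heatSchwartz_eq_translate] at h
    convert h using 2 with x
    simp [heatExt, ht]
  · have : heatExt f t = fun _ => 0 := by
      funext x; simp [heatExt, ht]
    rw [this]
    exact continuous_const

theorem measurable_heatKernel {n : ℕ} :
    Measurable fun p : (ℝ × Rn n) × Rn n => heatKernel p.1.1 p.1.2 p.2 := by
  unfold heatKernel
  fun_prop

theorem measurable_uncurry_heatExt {n : ℕ} (f : 𝓢'(Rn n, ℂ)) :
    Measurable (Function.uncurry (heatExt f)) := by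
  have hint : ∀ δ : ℝ, Measurable fun p : ℝ × Rn n =>
      ∫ y, (heatKernel (p.1 - δ) p.2 y : ℂ) * heatExt f δ y := fun δ => by
    refine (StronglyMeasurable.integral_prod_right (f := fun (p : ℝ × Rn n) y =>
      (heatKernel (p.1 - δ) p.2 y : ℂ) * heatExt f δ y) ?_).measurable
    refine Measurable.stronglyMeasurable ?_
    refine Measurable.mul ?_ ((continuous_heatExt f δ).measurable.comp measurable_snd)
    refine Complex.measurable_ofReal.comp ?_
    exact measurable_heatKernel.comp (f := fun p : (ℝ × Rn n) × Rn n =>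
      ((p.1.1 - δ, p.1.2), p.2)) (by fun_prop)
  -- for each `t` the value is eventually given by the semigroup formula with `δ = 1/(m+1) < t`
  refine measurable_of_tendsto_metrizable (f := fun (m : ℕ) (p : ℝ × Rn n) =>
    ({p : ℝ × Rn n | 1 / ((m : ℝ) + 1) < p.1}).indicator (fun p =>
      ∫ y, (heatKernel (p.1 - 1 / ((m : ℝ) + 1)) p.2 y : ℂ) * heatExt f (1 / ((m : ℝ) + 1)) y) p)
    (fun m => (hint _).indicator (measurableSet_lt measurable_const measurable_fst)) ?_
  refine tendsto_pi_nhds.2 fun ⟨t, x⟩ => ?_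
  refine tendsto_const_nhds.congr' ?_
  by_cases ht : 0 < t
  · filter_upwards [(tendsto_one_div_add_atTop_nhds_zero_nat (𝕜 := ℝ)).eventually (gt_mem_nhds ht)]
      with m hm
    have hmem : (t, x) ∈ {p : ℝ × Rn n | 1 / ((m : ℝ) + 1) < p.1} := hm
    rw [indicator_of_mem hmem, ← (heatExt_add f (sub_pos.2 hm) (by positivity) x).2]
    simp
  · refine Eventually.of_forall fun m => ?_
    have hmem : (t, x) ∉ {p : ℝ × Rn n | 1 / ((m : ℝ) + 1) < p.1} := fun h => ht (lt_trans (by positivity) h)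
    simp only [indicator_of_notMem hmem]
    simp [heatExt, ht]

theorem heatExt_im {n : ℕ} {f : 𝓢'(Rn n, ℂ)} (hf : IsRealDist f) (t : ℝ) (x : Rn n) :
    (heatExt f t x).im = 0 := by
  by_cases ht : 0 < t
  · simp only [heatExt, ht, dif_pos]
    exact hf _ fun y => by simp [heatSchwartz_apply]
  · simp [heatExt, ht]

theorem integral_heatKernel {n : ℕ} {t : ℝ} (ht : 0 < t) (x : Rn n) :
    Integrable (heatKernel t x) ∧ ∫ y, heatKernel t x y = 1 := by
  have h1 : Integrable (heatKernel t x) := by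
    have := ((heatSchwartz t ht x).integrable (μ := volume)).re
    simpa [heatSchwartz_apply] using this
  refine ⟨h1, ?_⟩
  have hb : (0 : ℝ) < 1 / (4 * t) := by positivity
  have h2 := GaussianFourier.integral_rexp_neg_mul_sq_norm (V := Rn n) hb
  simp only [heatKernel]
  rw [integral_const_mul]
  have h3 : ∫ y : Rn n, Real.exp (-(‖x - y‖ ^ 2 / (4 * t))) =
      ∫ y : Rn n, Real.exp (-(1 / (4 * t)) * ‖y‖ ^ 2) := by
    rw [← integral_sub_left_eq_self _ volume x]
    congr 1
    funext y
    rw [sub_sub_cancel]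
    congr 1
    ring
  rw [h3, h2, finrank_euclideanSpace_fin]
  have h4 : π / (1 / (4 * t)) = 4 * π * t := by field_simp
  rw [h4, ← Real.rpow_add (by positivity)]
  have : -(n : ℝ) / 2 + n / 2 = 0 := by ring
  rw [this, Real.rpow_zero]

theorem heatKernel_nonneg {n : ℕ} {t : ℝ} (ht : 0 < t) (x y : Rn n) : 0 ≤ heatKernel t x y := by
  unfold heatKernel
  positivity

/-! ### The majorant kernel -/

/-- The weight `(R + |z|)^{-(n+1)}`; for `R = √t` it majorizes the kernel of `e^{tΔ} P ∇`. -/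
def weight {n : ℕ} (R : ℝ) (z : Rn n) : ℝ := ((R + ‖z‖) ^ (n + 1))⁻¹

theorem weight_pos {n : ℕ} {R : ℝ} (hR : 0 < R) (z : Rn n) : 0 < weight R z := by
  unfold weight; positivity

theorem measurable_weight {n : ℕ} : Measurable fun p : ℝ × Rn n => weight p.1 p.2 := by
  unfold weight; fun_prop

/-- The weight varies slowly: comparable arguments give comparable values. -/
theorem weight_le_mul_weight {n : ℕ} {R S c : ℝ} (hR : 0 < R) (hS : 0 < S) {z w : Rn n}
    (h : S + ‖w‖ ≤ c * (R + ‖z‖)) : weight R z ≤ c ^ (n + 1) * weight S w := by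
  have hz : 0 < R + ‖z‖ := by positivity
  have hw : 0 < S + ‖w‖ := by positivity
  unfold weight
  rw [← div_eq_mul_inv, le_div_iff₀ (by positivity), inv_mul_le_iff₀ (by positivity), ← mul_pow]
  rw [mul_comm] at h
  gcongr

/-- The integral of the weight is a multiple of `1 / R`. -/
theorem exists_lintegral_weight_le (n : ℕ) : ∃ C : ℝ≥0, ∀ (R : ℝ), 0 < R → ∀ x : Rn n,
    ∫⁻ y, ENNReal.ofReal (weight R (x - y)) ≤ C * ENNReal.ofReal (R⁻¹) := by
  have hint : Integrable fun z : Rn n => weight 1 z := by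
    have := integrable_one_add_norm (E := Rn n) (μ := volume) (r := (n + 1 : ℕ)) (by simp)
    refine this.congr (Eventually.of_forall fun z => ?_)
    simp only [weight]
    rw [Real.rpow_neg (by positivity), Real.rpow_natCast]
  refine ⟨(∫ z : Rn n, weight 1 z).toNNReal, fun R hR x => ?_⟩
  have hscale : ∀ z : Rn n, weight R z = (R ^ (n + 1))⁻¹ * weight 1 (R⁻¹ • z) := fun z => by
    unfold weight
    rw [norm_smul, Real.norm_eq_abs, abs_of_pos (inv_pos.2 hR), ← mul_inv, ← mul_pow]
    congr 2
    field_simp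
  have hintR : Integrable fun z : Rn n => weight R z := by
    simp_rw [hscale]
    exact ((integrable_comp_smul_iff volume _ (inv_ne_zero hR.ne')).2 hint).const_mul _
  rw [lintegral_sub_left_eq_self (fun z => ENNReal.ofReal (weight R z)) x,
    ← ofReal_integral_eq_lintegral_ofReal hintR
      (Eventually.of_forall fun z => (weight_pos hR z).le)]
  have : ∫ z : Rn n, weight R z = (∫ z : Rn n, weight 1 z) * R⁻¹ := by
    simp_rw [hscale]
    rw [integral_const_mul, Measure.integral_comp_smul, finrank_euclideanSpace_fin, smul_eq_mul,
      abs_of_pos (by positivity), inv_pow, inv_inv, pow_succ]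
    field_simp
  rw [this, ENNReal.ofReal_mul (integral_nonneg fun z => (weight_pos one_pos z).le)]
  rfl

/-! ### One-dimensional integrals -/

theorem lintegral_rpow_Ioo {b p : ℝ} (hb : 0 < b) (hp : -1 < p) :
    ∫⁻ s in Ioo 0 b, ENNReal.ofReal (s ^ p) = ENNReal.ofReal (b ^ (p + 1) / (p + 1)) := by
  have hint : IntegrableOn (fun s : ℝ => s ^ p) (Ioo 0 b) :=
    (((intervalIntegrable_iff_integrableOn_Ioc_of_le hb.le).1
      (intervalIntegral.intervalIntegrable_rpow' hp)).mono_set Ioo_subset_Ioc_self)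
  rw [← ofReal_integral_eq_lintegral_ofReal hint
    ((ae_restrict_iff' measurableSet_Ioo).2 (Eventually.of_forall fun s hs =>
      Real.rpow_nonneg hs.1.le _)), ← integral_Ioc_eq_integral_Ioo,
    ← intervalIntegral.integral_of_le hb.le, integral_rpow (Or.inl hp),
    Real.zero_rpow (by linarith), sub_zero]

theorem lintegral_sub_rpow_Ioo {a b p : ℝ} (hab : a < b) (hp : -1 < p) :
    ∫⁻ s in Ioo a b, ENNReal.ofReal ((s - a) ^ p)
      = ENNReal.ofReal ((b - a) ^ (p + 1) / (p + 1)) := by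
  rw [← lintegral_rpow_Ioo (sub_pos.2 hab) hp,
    ← lintegral_indicator measurableSet_Ioo, ← lintegral_indicator measurableSet_Ioo,
    ← lintegral_sub_right_eq_self ((Ioo 0 (b - a)).indicator fun s => ENNReal.ofReal (s ^ p)) a]
  congr 1
  funext s
  by_cases hs : s ∈ Ioo a b
  · rw [indicator_of_mem hs, indicator_of_mem (by constructor <;> linarith [hs.1, hs.2])]
  · rw [indicator_of_notMem hs, indicator_of_notMem (fun h => hs
      (by constructor <;> linarith [h.1, h.2]))]

theorem lintegral_sub_left_rpow_Ioo {a b p : ℝ} (hab : a < b) (hp : -1 < p) :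
    ∫⁻ s in Ioo a b, ENNReal.ofReal ((b - s) ^ p)
      = ENNReal.ofReal ((b - a) ^ (p + 1) / (p + 1)) := by
  rw [← lintegral_rpow_Ioo (sub_pos.2 hab) hp,
    ← lintegral_indicator measurableSet_Ioo, ← lintegral_indicator measurableSet_Ioo,
    ← lintegral_sub_left_eq_self ((Ioo 0 (b - a)).indicator fun s => ENNReal.ofReal (s ^ p)) b]
  congr 1
  funext s
  by_cases hs : s ∈ Ioo a b
  · rw [indicator_of_mem hs, indicator_of_mem (by constructor <;> linarith [hs.1, hs.2])]
  · rw [indicator_of_notMem hs, indicator_of_notMem (fun h => hs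
      (by constructor <;> linarith [h.1, h.2]))]

theorem lintegral_rpow_Ioi {a p : ℝ} (ha : 0 < a) (hp : p < -1) :
    ∫⁻ t in Ioi a, ENNReal.ofReal (t ^ p) = ENNReal.ofReal (-a ^ (p + 1) / (p + 1)) := by
  rw [← ofReal_integral_eq_lintegral_ofReal (integrableOn_Ioi_rpow_of_lt hp ha)
    ((ae_restrict_iff' measurableSet_Ioi).2 (Eventually.of_forall fun s hs =>
      Real.rpow_nonneg (ha.trans hs).le _)), integral_Ioi_rpow_of_lt hp ha]

/-- The integral `∫_s^∞ t^{-1/2-α} (t-s)^{-1/2} dt` is a multiple of `s^{-α}`; it converges at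
infinity because `α > 0`. -/
theorem lintegral_beta_le {α s : ℝ} (hα : 0 < α) (hs : 0 < s) :
    ∫⁻ t in Ioi s, ENNReal.ofReal (t ^ (-(1 / 2) - α) * (t - s) ^ (-(1 / 2) : ℝ))
      ≤ ENNReal.ofReal (2 + 2 / α) * ENNReal.ofReal (s ^ (-α)) := by
  have hsplit : Ioi s ⊆ Ioo s (2 * s) ∪ Ici (2 * s) := fun t ht => by
    rcases lt_or_ge t (2 * s) with h | h
    · exact Or.inl ⟨ht, h⟩
    · exact Or.inr h
  have h1 : ∫⁻ t in Ioo s (2 * s),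
      ENNReal.ofReal (t ^ (-(1 / 2) - α) * (t - s) ^ (-(1 / 2) : ℝ))
        ≤ ENNReal.ofReal (2 * s ^ (-α)) := by
    calc _ ≤ ∫⁻ t in Ioo s (2 * s),
          ENNReal.ofReal (s ^ (-(1 / 2) - α)) * ENNReal.ofReal ((t - s) ^ (-(1 / 2) : ℝ)) := by
          refine setLIntegral_mono' measurableSet_Ioo fun t ht => ?_
          rw [← ENNReal.ofReal_mul (by positivity)]
          refine ENNReal.ofReal_le_ofReal ?_
          have := Real.rpow_le_rpow_of_nonpos hs ht.1.le (by linarith : -(1 / 2) - α ≤ 0)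
          have h0 : 0 ≤ (t - s) ^ (-(1 / 2) : ℝ) := Real.rpow_nonneg (by linarith [ht.1]) _
          gcongr
      _ = ENNReal.ofReal (s ^ (-(1 / 2) - α)) * ENNReal.ofReal
            ((2 * s - s) ^ (-(1 / 2) + 1 : ℝ) / (-(1 / 2) + 1)) := by
          rw [lintegral_const_mul _ (by fun_prop), lintegral_sub_rpow_Ioo (by linarith) (by norm_num)]
      _ = _ := by
          rw [← ENNReal.ofReal_mul (by positivity)]
          congr 1
          have e1 : 2 * s - s = s := by ring
          have e2 : s ^ (-α) = s ^ (-(1 / 2) - α) * s ^ (-(1 / 2) + 1 : ℝ) := by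
            rw [← Real.rpow_add hs]; congr 1; ring
          rw [e1, e2]
          norm_num
          ring
  have h2 : ∫⁻ t in Ici (2 * s),
      ENNReal.ofReal (t ^ (-(1 / 2) - α) * (t - s) ^ (-(1 / 2) : ℝ))
        ≤ ENNReal.ofReal (2 / α * s ^ (-α)) := by
    calc _ ≤ ∫⁻ t in Ici (2 * s), ENNReal.ofReal 2 * ENNReal.ofReal (t ^ (-1 - α)) := by
          refine setLIntegral_mono' measurableSet_Ici fun t ht => ?_
          have ht' : 2 * s ≤ t := ht
          have ht0 : 0 < t := by linarith
          rw [← ENNReal.ofReal_mul (by positivity)]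
          refine ENNReal.ofReal_le_ofReal ?_
          have e1 : (t - s) ^ (-(1 / 2) : ℝ) ≤ (t / 4) ^ (-(1 / 2) : ℝ) :=
            Real.rpow_le_rpow_of_nonpos (by linarith) (by linarith) (by norm_num)
          have e2 : (t / 4) ^ (-(1 / 2) : ℝ) = 2 * t ^ (-(1 / 2) : ℝ) := by
            rw [Real.div_rpow ht0.le (by norm_num)]
            have : (4 : ℝ) ^ (-(1 / 2) : ℝ) = 2⁻¹ := by
              rw [show (4 : ℝ) = 2 ^ (2 : ℝ) by norm_num, ← Real.rpow_mul (by norm_num)]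
              norm_num
            rw [this]
            field_simp
          have e3 : t ^ (-1 - α) = t ^ (-(1 / 2) - α) * t ^ (-(1 / 2) : ℝ) := by
            rw [← Real.rpow_add ht0]; congr 1; ring
          calc t ^ (-(1 / 2) - α) * (t - s) ^ (-(1 / 2) : ℝ)
              ≤ t ^ (-(1 / 2) - α) * (2 * t ^ (-(1 / 2) : ℝ)) := by
                rw [← e2]
                gcongr
            _ = _ := by rw [e3]; ring
      _ = ENNReal.ofReal 2 * ENNReal.ofReal (-(2 * s) ^ (-1 - α + 1) / (-1 - α + 1)) := by
          rw [lintegral_const_mul _ (by fun_prop), setLIntegral_congr Ioi_ae_eq_Ici.symm,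
            lintegral_rpow_Ioi (by linarith) (by linarith)]
      _ ≤ _ := by
          rw [← ENNReal.ofReal_mul (by positivity)]
          refine ENNReal.ofReal_le_ofReal ?_
          have e1 : -1 - α + 1 = -α := by ring
          have e2 : (2 * s) ^ (-α) ≤ s ^ (-α) :=
            Real.rpow_le_rpow_of_nonpos hs (by linarith) (by linarith)
          rw [e1, neg_div_neg_eq]
          calc 2 * ((2 * s) ^ (-α) / α) ≤ 2 * (s ^ (-α) / α) := by gcongr
            _ = _ := by ring
  calc _ ≤ _ := lintegral_mono_set hsplit
    _ ≤ _ := lintegral_union_le _ _ _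
    _ ≤ ENNReal.ofReal (2 * s ^ (-α)) + ENNReal.ofReal (2 / α * s ^ (-α)) := add_le_add h1 h2
    _ = _ := by
      rw [← ENNReal.ofReal_add (by positivity) (by positivity), ← ENNReal.ofReal_mul (by positivity)]
      congr 1
      ring

/-! ### Averaging over balls -/

theorem volume_ball_eq {n : ℕ} [NeZero n] (x : Rn n) {r : ℝ} (hr : 0 ≤ r) :
    volume (Metric.ball x r)
      = ENNReal.ofReal (r ^ n) * volume (Metric.ball (0 : Rn n) 1) := by
  have h := Measure.addHaar_ball (volume : Measure (Rn n)) x hr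
  rwa [finrank_euclideanSpace_fin] at h

/-- If the integrals of `H` over balls of radius `r` are at most `M`, then integrating `H` against
a weight of scale `R ≥ r` costs the number of such balls, weighted: the weight is essentially
constant on each ball. -/
theorem exists_lintegral_weight_mul_le (n : ℕ) [NeZero n] : ∃ C : ℝ≥0,
    ∀ (H : Rn n → ℝ≥0∞), Measurable H → ∀ (r R : ℝ), 0 < r → r ≤ R → ∀ M : ℝ≥0∞,
      (∀ z, ∫⁻ y in Metric.ball z r, H y ≤ M) → ∀ x : Rn n,
        ∫⁻ y, ENNReal.ofReal (weight R (x - y)) * H y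
          ≤ C * M * ENNReal.ofReal ((r ^ n)⁻¹ * R⁻¹) := by
  obtain ⟨C₀, hC₀⟩ := exists_lintegral_weight_le n
  set V := volume (Metric.ball (0 : Rn n) 1) with hV
  have hV0 : V ≠ 0 := (Metric.measure_ball_pos volume _ one_pos).ne'
  have hVt : V ≠ ⊤ := measure_ball_lt_top.ne
  refine ⟨2 ^ (n + 1) * C₀ * V.toNNReal⁻¹, fun H hH r R hr hrR M hM x => ?_⟩
  have hR : 0 < R := hr.trans_le hrR
  have hw : Measurable fun z : Rn n => ENNReal.ofReal (weight R (x - z)) :=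
    ENNReal.measurable_ofReal.comp
      (measurable_weight.comp (f := fun z : Rn n => (R, x - z)) (by fun_prop))
  have key : (∫⁻ y, ENNReal.ofReal (weight R (x - y)) * H y) * (ENNReal.ofReal (r ^ n) * V)
      ≤ ENNReal.ofReal (2 ^ (n + 1)) * M * (C₀ * ENNReal.ofReal R⁻¹) := by
    calc _ = ∫⁻ y, ∫⁻ z in Metric.ball y r, ENNReal.ofReal (weight R (x - y)) * H y := by
          have hm : Measurable fun y => ENNReal.ofReal (weight R (x - y)) * H y := hw.mul hH
          rw [← lintegral_mul_const _ hm]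
          congr 1
          funext y
          rw [setLIntegral_const, volume_ball_eq y hr.le]
      _ ≤ ∫⁻ y, ∫⁻ z in Metric.ball y r,
            ENNReal.ofReal (2 ^ (n + 1)) * ENNReal.ofReal (weight R (x - z)) * H y := by
          refine lintegral_mono fun y => setLIntegral_mono' measurableSet_ball fun z hz => ?_
          rw [← ENNReal.ofReal_mul (by positivity)]
          gcongr
          refine weight_le_mul_weight hR hR ?_
          rw [Metric.mem_ball, dist_eq_norm] at hz
          have : ‖x - z‖ ≤ ‖x - y‖ + ‖z - y‖ := by
            have := norm_sub_le (x - y) (z - y)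
            rwa [sub_sub_sub_cancel_right] at this
          linarith [norm_nonneg (x - y)]
      _ = ∫⁻ y, ∫⁻ z, {p : Rn n × Rn n | dist p.2 p.1 < r}.indicator
            (fun p => ENNReal.ofReal (2 ^ (n + 1)) * ENNReal.ofReal (weight R (x - p.2)) * H p.1)
              (y, z) := by
          congr 1
          funext y
          rw [← lintegral_indicator measurableSet_ball]
          rfl
      _ = ∫⁻ z, ∫⁻ y, {p : Rn n × Rn n | dist p.2 p.1 < r}.indicator
            (fun p => ENNReal.ofReal (2 ^ (n + 1)) * ENNReal.ofReal (weight R (x - p.2)) * H p.1)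
              (y, z) := by
          refine lintegral_lintegral_swap (Measurable.aemeasurable ?_)
          refine Measurable.indicator ?_ (measurableSet_lt (by fun_prop) measurable_const)
          exact (measurable_const.mul (hw.comp measurable_snd)).mul (hH.comp measurable_fst)
      _ = ∫⁻ z, ENNReal.ofReal (2 ^ (n + 1)) * ENNReal.ofReal (weight R (x - z)) *
            ∫⁻ y in Metric.ball z r, H y := by
          congr 1
          funext z
          rw [← lintegral_const_mul _ hH, ← lintegral_indicator measurableSet_ball]
          congr 1
          funext y
          by_cases h : dist y z < r
          · rw [indicator_of_mem (show y ∈ Metric.ball z r from h),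
              indicator_of_mem (show (y, z) ∈ {p : Rn n × Rn n | dist p.2 p.1 < r} by
                simpa [dist_comm] using h)]
          · rw [indicator_of_notMem (show y ∉ Metric.ball z r from h),
              indicator_of_notMem (show (y, z) ∉ {p : Rn n × Rn n | dist p.2 p.1 < r} by
                simpa [dist_comm] using h)]
      _ ≤ ∫⁻ z, ENNReal.ofReal (2 ^ (n + 1)) * M * ENNReal.ofReal (weight R (x - z)) := by
          refine lintegral_mono fun z => ?_
          rw [mul_right_comm]
          gcongr
          exact hM z
      _ ≤ _ := by
          rw [lintegral_const_mul _ hw]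
          gcongr
          exact hC₀ R hR x
  have hrn : ENNReal.ofReal (r ^ n) ≠ 0 := by
    rw [Ne, ENNReal.ofReal_eq_zero, not_le]; positivity
  rw [← ENNReal.le_div_iff_mul_le (Or.inl (mul_ne_zero hrn hV0))
    (Or.inl (ENNReal.mul_ne_top ENNReal.ofReal_ne_top hVt))] at key
  refine key.trans (le_of_eq ?_)
  rw [ENNReal.div_eq_inv_mul, ENNReal.mul_inv (Or.inl hrn) (Or.inl ENNReal.ofReal_ne_top),
    ENNReal.ofReal_mul (by positivity), ← ENNReal.ofReal_inv_of_pos (by positivity)]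
  have hVinv : V⁻¹ = ((V.toNNReal⁻¹ : ℝ≥0) : ℝ≥0∞) := by
    rw [ENNReal.coe_inv (by simpa [ENNReal.toNNReal_eq_zero_iff] using ⟨hV0, hVt⟩),
      ENNReal.coe_toNNReal hVt]
  rw [hVinv, ENNReal.ofReal_pow (zero_le_two (α := ℝ)), ENNReal.ofReal_ofNat]
  push_cast
  ring

/-- The quantity `r^{2α-n} ∫_0^{r²} ∫_{|y-x|<r} F(t,y) t^{-α} dy dt`. -/
def carlesonMass {n : ℕ} (α : ℝ) (F : ℝ → Rn n → ℝ≥0∞) (x : Rn n) (r : ℝ) : ℝ≥0∞ :=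
  ENNReal.ofReal (r ^ (2 * α - n)) *
    ∫⁻ t in Ioo 0 (r ^ 2), ∫⁻ y in Metric.ball x r, F t y * ENNReal.ofReal (t ^ (-α))

theorem carleson_eq_carlesonMass {n : ℕ} (α : ℝ) (g : ℝ → Rn n → ℂ) (x : Rn n) (r : ℝ) :
    carleson α g x r = carlesonMass α (fun t y => ‖g t y‖ₑ ^ 2) x r := rfl

/-- The parabolic form of the averaging principle. -/
theorem exists_lintegral_weight_mul_rpow_le (n : ℕ) [NeZero n] (α : ℝ) : ∃ C : ℝ≥0,
    ∀ (F : ℝ → Rn n → ℝ≥0∞), Measurable (Function.uncurry F) → ∀ (r R : ℝ), 0 < r → r ≤ R →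
      ∀ A : ℝ≥0∞, (∀ z, carlesonMass α F z r ≤ A) → ∀ x : Rn n,
        ∫⁻ s in Ioo 0 (r ^ 2), ∫⁻ y,
            ENNReal.ofReal (weight R (x - y)) * (F s y * ENNReal.ofReal (s ^ (-α)))
          ≤ C * A * ENNReal.ofReal (r ^ (-(2 * α)) * R⁻¹) := by
  obtain ⟨C, hC⟩ := exists_lintegral_weight_mul_le n
  refine ⟨C, fun F hF r R hr hrR A hA x => ?_⟩
  have hG : Measurable fun p : Rn n × ℝ => F p.2 p.1 * ENNReal.ofReal (p.2 ^ (-α)) :=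
    (hF.comp measurable_swap).mul (by fun_prop)
  have hw : Measurable fun z : Rn n => ENNReal.ofReal (weight R (x - z)) :=
    ENNReal.measurable_ofReal.comp
      (measurable_weight.comp (f := fun z : Rn n => (R, x - z)) (by fun_prop))
  have hH : Measurable fun y : Rn n => ∫⁻ s in Ioo 0 (r ^ 2), F s y * ENNReal.ofReal (s ^ (-α)) :=
    hG.lintegral_prod_right'
  have h1 := hC _ hH r R hr hrR (A * ENNReal.ofReal (r ^ (n - 2 * α))) (fun z => by
    rw [lintegral_lintegral_swap hG.aemeasurable]
    have h := hA z
    unfold carlesonMass at h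
    have e : ENNReal.ofReal (r ^ (2 * α - n)) = (ENNReal.ofReal (r ^ (n - 2 * α)))⁻¹ := by
      rw [← ENNReal.ofReal_inv_of_pos (by positivity), ← Real.rpow_neg hr.le]
      congr 2; ring
    have hp : ENNReal.ofReal (r ^ (n - 2 * α)) ≠ 0 := by
      rw [Ne, ENNReal.ofReal_eq_zero, not_le]; positivity
    rw [e, mul_comm, ← div_eq_mul_inv] at h
    exact (ENNReal.div_le_iff hp ENNReal.ofReal_ne_top).1 h) x
  calc _ = ∫⁻ y, ENNReal.ofReal (weight R (x - y)) *
        ∫⁻ s in Ioo 0 (r ^ 2), F s y * ENNReal.ofReal (s ^ (-α)) := by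
        rw [lintegral_lintegral_swap]
        · congr 1
          funext y
          have hm : Measurable fun s => F s y * ENNReal.ofReal (s ^ (-α)) :=
            hG.comp measurable_prodMk_left
          rw [lintegral_const_mul _ hm]
        · exact ((hw.comp measurable_snd).mul (hG.comp measurable_swap)).aemeasurable
    _ ≤ _ := h1
    _ = _ := by
        rw [mul_assoc, mul_assoc, mul_assoc, ← ENNReal.ofReal_mul (by positivity)]
        congr 3
        rw [← mul_assoc]
        congr 1
        rw [← Real.rpow_natCast r n, ← Real.rpow_neg hr.le, ← Real.rpow_add hr]
        congr 1; ring

/-! ### Estimates for the majorant of the Duhamel integral -/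

/-- The majorant `∫_0^t ∫ (√(t-s) + |x-y|)^{-(n+1)} F(s,y) dy ds` of the Duhamel integral. -/
def majorant {n : ℕ} (F : ℝ → Rn n → ℝ≥0∞) (t : ℝ) (x : Rn n) : ℝ≥0∞ :=
  ∫⁻ s in Ioo 0 t, ∫⁻ y, ENNReal.ofReal (weight √(t - s) (x - y)) * F s y

theorem inv_sqrt_eq_rpow {t : ℝ} (ht : 0 < t) : (√t)⁻¹ = t ^ (-(1 / 2) : ℝ) := by
  rw [Real.sqrt_eq_rpow, Real.rpow_neg ht.le]

theorem measurable_weight_sub {n : ℕ} (R : ℝ) (x : Rn n) :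
    Measurable fun y => ENNReal.ofReal (weight R (x - y)) :=
  ENNReal.measurable_ofReal.comp
    (measurable_weight.comp (f := fun z : Rn n => (R, x - z)) (by fun_prop))

theorem measurable_weight_sqrt {n : ℕ} : Measurable fun p : (ℝ × Rn n) × (ℝ × Rn n) =>
    ENNReal.ofReal (weight √(p.1.1 - p.2.1) (p.1.2 - p.2.2)) :=
  ENNReal.measurable_ofReal.comp
    (measurable_weight.comp (f := fun p : (ℝ × Rn n) × (ℝ × Rn n) =>
      (√(p.1.1 - p.2.1), p.1.2 - p.2.2)) (by fun_prop))

theorem measurable_majorant {n : ℕ} {F : ℝ → Rn n → ℝ≥0∞} (hF : Measurable (Function.uncurry F)) :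
    Measurable (Function.uncurry (majorant F)) := by
  have h1 : Measurable fun q : (ℝ × Rn n) × ℝ =>
      ∫⁻ y, ENNReal.ofReal (weight √(q.1.1 - q.2) (q.1.2 - y)) * F q.2 y := by
    refine Measurable.lintegral_prod_right' (f := fun z : ((ℝ × Rn n) × ℝ) × Rn n =>
      ENNReal.ofReal (weight √(z.1.1.1 - z.1.2) (z.1.1.2 - z.2)) * F z.1.2 z.2) ?_
    refine Measurable.mul ?_ (hF.comp (g := Function.uncurry F)
      (f := fun z : ((ℝ × Rn n) × ℝ) × Rn n => (z.1.2, z.2)) (by fun_prop))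
    exact measurable_weight_sqrt.comp (f := fun z : ((ℝ × Rn n) × ℝ) × Rn n =>
      (z.1.1, (z.1.2, z.2))) (by fun_prop)
  have h2 : Function.uncurry (majorant F) = fun p : ℝ × Rn n => ∫⁻ s,
      {q : (ℝ × Rn n) × ℝ | 0 < q.2 ∧ q.2 < q.1.1}.indicator (fun q : (ℝ × Rn n) × ℝ =>
        ∫⁻ y, ENNReal.ofReal (weight √(q.1.1 - q.2) (q.1.2 - y)) * F q.2 y) (p, s) := by
    funext ⟨t, x⟩
    change majorant F t x = _
    rw [majorant, ← lintegral_indicator measurableSet_Ioo]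
    rfl
  rw [h2]
  refine Measurable.lintegral_prod_right' (h1.indicator ?_)
  exact (measurableSet_lt measurable_const measurable_snd).inter
    (measurableSet_lt measurable_snd (measurable_fst.comp measurable_fst))

/-- The pointwise bound `√t · majorant ≤ C A`. Times `s > t/2` are controlled by the bound
`s F(s,y) ≤ A`, times `s < t/2` by the averaging principle. -/
theorem exists_majorant_le (n : ℕ) [NeZero n] {α : ℝ} (hα : 0 < α) : ∃ C : ℝ≥0,
    ∀ (F : ℝ → Rn n → ℝ≥0∞), Measurable (Function.uncurry F) → ∀ (t : ℝ), 0 < t →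
      ∀ A : ℝ≥0∞, (∀ z, carlesonMass α F z √(t / 2) ≤ A) →
        (∀ᵐ s ∂(volume.restrict (Ioo 0 t)), ∀ᵐ y, ENNReal.ofReal s * F s y ≤ A) → ∀ x : Rn n,
          majorant F t x ≤ C * A * ENNReal.ofReal (t ^ (-(1 / 2) : ℝ)) := by
  obtain ⟨C₀, hC₀⟩ := exists_lintegral_weight_le n
  obtain ⟨C₁, hC₁⟩ := exists_lintegral_weight_mul_rpow_le n α
  refine ⟨2 ^ (n + 1) * C₁ + 4 * C₀, fun F hF t ht A hA hsup x => ?_⟩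
  set r := √(t / 2) with hr_def
  have hr : 0 < r := Real.sqrt_pos.2 (by positivity)
  have hr2 : r ^ 2 = t / 2 := Real.sq_sqrt (by positivity)
  have hrt : r ≤ √t := Real.sqrt_le_sqrt (by linarith)
  have hsplit : Ioo 0 t ⊆ Ioo 0 (r ^ 2) ∪ Ico (t / 2) t := fun s hs => by
    rw [hr2]
    rcases lt_or_ge s (t / 2) with h | h
    · exact Or.inl ⟨hs.1, h⟩
    · exact Or.inr ⟨h, hs.2⟩
  have hearly : ∫⁻ s in Ioo 0 (r ^ 2), ∫⁻ y, ENNReal.ofReal (weight √(t - s) (x - y)) * F s y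
      ≤ 2 ^ (n + 1) * C₁ * A * ENNReal.ofReal (t ^ (-(1 / 2) : ℝ)) := by
    calc _ ≤ ∫⁻ s in Ioo 0 (r ^ 2), ENNReal.ofReal (2 ^ (n + 1) * (r ^ 2) ^ α) *
          ∫⁻ y, ENNReal.ofReal (weight √t (x - y)) * (F s y * ENNReal.ofReal (s ^ (-α))) := by
          refine setLIntegral_mono' measurableSet_Ioo fun s hs => ?_
          have hst : s < t / 2 := hr2 ▸ hs.2
          have hm : Measurable fun y =>
              ENNReal.ofReal (weight √t (x - y)) * (F s y * ENNReal.ofReal (s ^ (-α))) :=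
            (measurable_weight_sub _ _).mul ((hF.comp measurable_prodMk_left).mul_const _)
          rw [← lintegral_const_mul _ hm]
          refine lintegral_mono fun y => ?_
          have h1 : weight √(t - s) (x - y) ≤ 2 ^ (n + 1) * weight √t (x - y) := by
            refine weight_le_mul_weight (Real.sqrt_pos.2 (by linarith)) (Real.sqrt_pos.2 ht) ?_
            have : √t ≤ 2 * √(t - s) := by
              rw [Real.sqrt_le_left (by positivity), mul_pow, Real.sq_sqrt (by linarith)]
              linarith
            linarith [norm_nonneg (x - y)]
          have h2 : 1 ≤ (r ^ 2) ^ α * s ^ (-α) := by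
            rw [Real.rpow_neg hs.1.le, ← div_eq_mul_inv, one_le_div (Real.rpow_pos_of_pos hs.1 _)]
            exact Real.rpow_le_rpow hs.1.le hs.2.le hα.le
          calc ENNReal.ofReal (weight √(t - s) (x - y)) * F s y
              ≤ ENNReal.ofReal (2 ^ (n + 1) * weight √t (x - y)) * F s y *
                  ENNReal.ofReal ((r ^ 2) ^ α * s ^ (-α)) := by
                rw [← mul_one (ENNReal.ofReal (weight √(t - s) (x - y)) * F s y)]
                gcongr
                rwa [ENNReal.one_le_ofReal]
            _ = _ := by
                rw [ENNReal.ofReal_mul (by positivity), ENNReal.ofReal_mul (by positivity),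
                  ENNReal.ofReal_mul (by positivity)]
                ring
      _ ≤ ENNReal.ofReal (2 ^ (n + 1) * (r ^ 2) ^ α) *
            (C₁ * A * ENNReal.ofReal (r ^ (-(2 * α)) * (√t)⁻¹)) := by
          rw [lintegral_const_mul']
          · gcongr
            exact hC₁ F hF r √t hr hrt A hA x
          · exact ENNReal.ofReal_ne_top
      _ = _ := by
          rw [mul_left_comm, ← ENNReal.ofReal_mul (by positivity)]
          have e : 2 ^ (n + 1) * (r ^ 2) ^ α * (r ^ (-(2 * α)) * (√t)⁻¹)
              = 2 ^ (n + 1) * t ^ (-(1 / 2) : ℝ) := by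
            rw [← Real.rpow_natCast r 2, ← Real.rpow_mul hr.le, ← inv_sqrt_eq_rpow ht]
            rw [show 2 ^ (n + 1) * r ^ ((2 : ℕ) * α) * (r ^ (-(2 * α)) * (√t)⁻¹)
              = 2 ^ (n + 1) * (r ^ ((2 : ℕ) * α) * r ^ (-(2 * α))) * (√t)⁻¹ by ring,
              ← Real.rpow_add hr]
            simp
          rw [e, ENNReal.ofReal_mul (by positivity), ENNReal.ofReal_pow (zero_le_two (α := ℝ)),
            ENNReal.ofReal_ofNat]
          ring
  have hlate : ∫⁻ s in Ico (t / 2) t, ∫⁻ y, ENNReal.ofReal (weight √(t - s) (x - y)) * F s y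
      ≤ 4 * C₀ * A * ENNReal.ofReal (t ^ (-(1 / 2) : ℝ)) := by
    rw [setLIntegral_congr Ioo_ae_eq_Ico.symm]
    have hsub : Ioo (t / 2) t ⊆ Ioo 0 t := Ioo_subset_Ioo_left (by positivity)
    calc _ ≤ ∫⁻ s in Ioo (t / 2) t, A * ENNReal.ofReal (2 / t) * C₀ *
          ENNReal.ofReal ((t - s) ^ (-(1 / 2) : ℝ)) := by
          refine lintegral_mono_ae ?_
          filter_upwards [ae_restrict_of_ae_restrict_of_subset hsub hsup,
            ae_restrict_mem measurableSet_Ioo] with s hs hsm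
          have hs0 : 0 < s := by linarith [hsm.1]
          calc _ ≤ ∫⁻ y, A * ENNReal.ofReal (2 / t) * ENNReal.ofReal (weight √(t - s) (x - y)) := by
                refine lintegral_mono_ae ?_
                filter_upwards [hs] with y hy
                rw [mul_comm]
                gcongr
                have h1 : F s y ≤ A * ENNReal.ofReal s⁻¹ := by
                  rw [ENNReal.ofReal_inv_of_pos hs0, ← div_eq_mul_inv, ENNReal.le_div_iff_mul_le
                    (Or.inl (by rw [Ne, ENNReal.ofReal_eq_zero, not_le]; exact hs0))
                    (Or.inl ENNReal.ofReal_ne_top), mul_comm]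
                  exact hy
                refine h1.trans ?_
                gcongr
                rw [inv_le_comm₀ hs0 (by positivity), inv_div]
                exact hsm.1.le
            _ ≤ A * ENNReal.ofReal (2 / t) * (C₀ * ENNReal.ofReal (√(t - s))⁻¹) := by
                rw [lintegral_const_mul _ (measurable_weight_sub _ _)]
                gcongr
                exact hC₀ _ (Real.sqrt_pos.2 (by linarith [hsm.2])) x
            _ = _ := by
                rw [inv_sqrt_eq_rpow (by linarith [hsm.2]), mul_assoc]
                ring
      _ = A * ENNReal.ofReal (2 / t) * C₀ *
            ENNReal.ofReal ((t - t / 2) ^ (-(1 / 2) + 1 : ℝ) / (-(1 / 2) + 1)) := by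
          rw [lintegral_const_mul _ (by fun_prop), lintegral_sub_left_rpow_Ioo (by linarith)
            (by norm_num)]
      _ = A * C₀ * ENNReal.ofReal (2 / t * ((t - t / 2) ^ (-(1 / 2) + 1 : ℝ) / (-(1 / 2) + 1))) := by
          rw [ENNReal.ofReal_mul (by positivity)]; ring
      _ ≤ A * C₀ * ENNReal.ofReal (4 * t ^ (-(1 / 2) : ℝ)) := by
          gcongr A * C₀ * ENNReal.ofReal ?_
          have e1 : (t - t / 2) ^ (-(1 / 2) + 1 : ℝ) ≤ t ^ (-(1 / 2) + 1 : ℝ) :=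
            Real.rpow_le_rpow (by linarith) (by linarith) (by norm_num)
          have e2 : t ^ (-(1 / 2) + 1 : ℝ) = t ^ (-(1 / 2) : ℝ) * t := by
            rw [Real.rpow_add ht, Real.rpow_one]
          calc 2 / t * ((t - t / 2) ^ (-(1 / 2) + 1 : ℝ) / (-(1 / 2) + 1))
              ≤ 2 / t * (t ^ (-(1 / 2) + 1 : ℝ) / (-(1 / 2) + 1)) := by
                gcongr
            _ = _ := by rw [e2]; field_simp; norm_num
      _ = _ := by
          rw [ENNReal.ofReal_mul (by norm_num), ENNReal.ofReal_ofNat]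
          ring
  calc majorant F t x ≤ _ := lintegral_mono_set hsplit
    _ ≤ _ := lintegral_union_le _ _ _
    _ ≤ _ := add_le_add hearly hlate
    _ = _ := by push_cast; ring

/-- The integral of the kernel over a ball of radius `r ≥ √τ` decays like the weight of scale `r`
at the centre of the ball. -/
theorem exists_setLIntegral_ball_weight_le (n : ℕ) [NeZero n] : ∃ C : ℝ≥0,
    ∀ (τ r : ℝ), 0 < τ → τ ≤ r ^ 2 → 0 < r → ∀ x₀ y : Rn n,
      ∫⁻ x in Metric.ball x₀ r, ENNReal.ofReal (weight √τ (x - y))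
        ≤ C * ENNReal.ofReal (τ ^ (-(1 / 2) : ℝ) * r ^ (n + 1)) *
          ENNReal.ofReal (weight r (x₀ - y)) := by
  obtain ⟨C₀, hC₀⟩ := exists_lintegral_weight_le n
  set V := volume (Metric.ball (0 : Rn n) 1) with hV
  have hVt : V ≠ ⊤ := measure_ball_lt_top.ne
  refine ⟨3 ^ (n + 1) * (C₀ + V.toNNReal), fun τ r hτ hτr hr x₀ y => ?_⟩
  have hsτ : 0 < √τ := Real.sqrt_pos.2 hτ
  have hsr : √τ ≤ r := Real.sqrt_le_iff.2 ⟨hr.le, hτr⟩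
  rw [← inv_sqrt_eq_rpow hτ]
  have h3 : (3 : ℝ≥0∞) = ENNReal.ofReal 3 := by simp
  rcases lt_or_ge ‖x₀ - y‖ (2 * r) with h | h
  · calc _ ≤ ∫⁻ x, ENNReal.ofReal (weight √τ (y - x)) := by
          refine (setLIntegral_le_lintegral _ _).trans (le_of_eq ?_)
          simp only [weight, norm_sub_rev]
      _ ≤ C₀ * ENNReal.ofReal (√τ)⁻¹ := hC₀ _ hsτ y
      _ ≤ C₀ * ENNReal.ofReal (3 ^ (n + 1) * ((√τ)⁻¹ * r ^ (n + 1) * weight r (x₀ - y))) := by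
          gcongr
          have h1 : (r ^ (n + 1))⁻¹ ≤ 3 ^ (n + 1) * weight r (x₀ - y) := by
            have := weight_le_mul_weight (n := n) (R := r) (S := r) (c := 3) (z := 0)
              (w := x₀ - y) hr hr (by rw [norm_zero]; linarith)
            simpa [weight] using this
          calc (√τ)⁻¹ = (√τ)⁻¹ * (r ^ (n + 1) * (r ^ (n + 1))⁻¹) := by
                rw [mul_inv_cancel₀ (by positivity), mul_one]
            _ ≤ (√τ)⁻¹ * (r ^ (n + 1) * (3 ^ (n + 1) * weight r (x₀ - y))) := by gcongr
            _ = _ := by ring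
      _ = 3 ^ (n + 1) * C₀ * ENNReal.ofReal ((√τ)⁻¹ * r ^ (n + 1)) *
            ENNReal.ofReal (weight r (x₀ - y)) := by
          rw [ENNReal.ofReal_mul (by positivity), ENNReal.ofReal_mul (by positivity),
            ENNReal.ofReal_pow (by norm_num), h3]
          ring
      _ ≤ _ := by
          gcongr
          push_cast
          gcongr
          exact le_self_add
  · calc _ ≤ ∫⁻ x in Metric.ball x₀ r, ENNReal.ofReal (3 ^ (n + 1) * weight r (x₀ - y)) := by
          refine setLIntegral_mono' measurableSet_ball fun x hx => ENNReal.ofReal_le_ofReal ?_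
          refine weight_le_mul_weight hsτ hr ?_
          rw [Metric.mem_ball, dist_eq_norm] at hx
          have : ‖x₀ - y‖ ≤ ‖x - y‖ + ‖x - x₀‖ := by
            have := norm_sub_le (x - y) (x - x₀)
            rwa [sub_sub_sub_cancel_left, norm_sub_rev x₀ y, norm_sub_rev y x₀] at this
          linarith
      _ = ENNReal.ofReal (3 ^ (n + 1) * weight r (x₀ - y)) * (ENNReal.ofReal (r ^ n) * V) := by
          rw [setLIntegral_const, volume_ball_eq x₀ hr.le]
      _ ≤ ENNReal.ofReal (3 ^ (n + 1) * weight r (x₀ - y)) *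
            (ENNReal.ofReal ((√τ)⁻¹ * r ^ (n + 1)) * V) := by
          gcongr
          rw [pow_succ', ← mul_assoc]
          refine le_mul_of_one_le_left (by positivity) ?_
          rw [mul_comm, ← div_eq_mul_inv, one_le_div hsτ]
          exact hsr
      _ = 3 ^ (n + 1) * V.toNNReal * ENNReal.ofReal ((√τ)⁻¹ * r ^ (n + 1)) *
            ENNReal.ofReal (weight r (x₀ - y)) := by
          rw [ENNReal.ofReal_mul (by positivity), ENNReal.ofReal_pow (by norm_num), h3,
            ENNReal.coe_toNNReal hVt]
          ring
      _ ≤ _ := by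
          gcongr
          push_cast
          gcongr
          exact le_add_self

/-- The Carleson bound for the square of the majorant. Once one factor is estimated by
`B t^{-1/2}`, the expression is linear in the majorant, and Tonelli's theorem applies. -/
theorem exists_carlesonMass_majorant_sq_le (n : ℕ) [NeZero n] {α : ℝ} (hα : 0 < α) : ∃ C : ℝ≥0,
    ∀ (F : ℝ → Rn n → ℝ≥0∞), Measurable (Function.uncurry F) → ∀ (r : ℝ), 0 < r →
      ∀ A B : ℝ≥0∞, (∀ z, carlesonMass α F z r ≤ A) →
        (∀ t ∈ Ioo 0 (r ^ 2), ∀ x, majorant F t x ≤ B * ENNReal.ofReal (t ^ (-(1 / 2) : ℝ))) →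
          ∀ x₀ : Rn n, carlesonMass α (fun t x => majorant F t x ^ 2) x₀ r ≤ C * A * B := by
  obtain ⟨C₁, hC₁⟩ := exists_lintegral_weight_mul_rpow_le n α
  obtain ⟨C₂, hC₂⟩ := exists_setLIntegral_ball_weight_le n
  have hβ : (0 : ℝ) ≤ 2 + 2 / α := by positivity
  refine ⟨C₂ * (2 + 2 / α).toNNReal * C₁, fun F hF r hr A B hA hB x₀ => ?_⟩
  -- the spatial integral of `F` against the weight at the centre of the ball
  set Ψ : ℝ → ℝ≥0∞ := fun s => ∫⁻ y, ENNReal.ofReal (weight r (x₀ - y)) * F s y with hΨ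
  have hΨm : Measurable Ψ :=
    Measurable.lintegral_prod_right' (f := fun z : ℝ × Rn n =>
      ENNReal.ofReal (weight r (x₀ - z.2)) * F z.1 z.2)
      (((measurable_weight_sub r x₀).comp measurable_snd).mul hF)
  have hball : ∀ t ∈ Ioo 0 (r ^ 2), ∫⁻ x in Metric.ball x₀ r, majorant F t x
      ≤ C₂ * ENNReal.ofReal (r ^ (n + 1)) *
        ∫⁻ s in Ioo 0 t, ENNReal.ofReal ((t - s) ^ (-(1 / 2) : ℝ)) * Ψ s := fun t ht => by
    have hm : Measurable fun z : (Rn n × ℝ) × Rn n =>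
        ENNReal.ofReal (weight √(t - z.1.2) (z.1.1 - z.2)) * F z.1.2 z.2 :=
      (measurable_weight_sqrt.comp (f := fun z : (Rn n × ℝ) × Rn n =>
        ((t, z.1.1), (z.1.2, z.2))) (by fun_prop)).mul
        (hF.comp (g := Function.uncurry F)
          (f := fun z : (Rn n × ℝ) × Rn n => (z.1.2, z.2)) (by fun_prop))
    unfold majorant
    rw [lintegral_lintegral_swap hm.lintegral_prod_right'.aemeasurable,
      ← lintegral_const_mul' _ _ (ENNReal.mul_ne_top ENNReal.coe_ne_top ENNReal.ofReal_ne_top)]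
    refine setLIntegral_mono' measurableSet_Ioo fun s hs => ?_
    rw [lintegral_lintegral_swap]
    · have hmy : Measurable fun y => ENNReal.ofReal (weight r (x₀ - y)) * F s y :=
        (measurable_weight_sub r x₀).mul (hF.comp measurable_prodMk_left)
      rw [← mul_assoc, ← lintegral_const_mul _ hmy]
      refine lintegral_mono fun y => ?_
      have hmx : Measurable fun x => ENNReal.ofReal (weight √(t - s) (x - y)) :=
        measurable_weight_sqrt.comp (f := fun x : Rn n => ((t, x), (s, y))) (by fun_prop)
      rw [lintegral_mul_const _ hmx]
      calc _ ≤ C₂ * ENNReal.ofReal ((t - s) ^ (-(1 / 2) : ℝ) * r ^ (n + 1)) *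
              ENNReal.ofReal (weight r (x₀ - y)) * F s y := by
            gcongr
            exact hC₂ (t - s) r (by linarith [hs.2]) (by linarith [hs.1, ht.2]) hr x₀ y
        _ = _ := by
            rw [ENNReal.ofReal_mul (Real.rpow_nonneg (by linarith [hs.2]) _)]
            ring
    · exact (hm.comp (f := fun p : Rn n × Rn n => ((p.1, s), p.2)) (by fun_prop)).aemeasurable
  unfold carlesonMass
  calc _ ≤ ENNReal.ofReal (r ^ (2 * α - n)) * ∫⁻ t in Ioo 0 (r ^ 2),
        B * (C₂ * ENNReal.ofReal (r ^ (n + 1))) * ∫⁻ s in Ioo 0 t,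
          ENNReal.ofReal (t ^ (-(1 / 2) - α) * (t - s) ^ (-(1 / 2) : ℝ)) * Ψ s := by
        gcongr ENNReal.ofReal _ * ?_
        refine setLIntegral_mono' measurableSet_Ioo fun t ht => ?_
        have hmM : Measurable fun x => majorant F t x :=
          (measurable_majorant hF).comp measurable_prodMk_left
        calc _ ≤ ∫⁻ x in Metric.ball x₀ r,
                B * ENNReal.ofReal (t ^ (-(1 / 2) - α)) * majorant F t x := by
              refine setLIntegral_mono' measurableSet_ball fun x _ => ?_
              have e : t ^ (-(1 / 2) - α) = t ^ (-(1 / 2) : ℝ) * t ^ (-α) := by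
                rw [← Real.rpow_add ht.1]; congr 1
              change majorant F t x ^ 2 * _ ≤ _
              rw [pow_two, e, ENNReal.ofReal_mul (Real.rpow_nonneg ht.1.le _)]
              calc _ ≤ B * ENNReal.ofReal (t ^ (-(1 / 2) : ℝ)) * majorant F t x *
                    ENNReal.ofReal (t ^ (-α)) := by
                    gcongr
                    exact hB t ht x
                _ = _ := by ring
          _ ≤ B * ENNReal.ofReal (t ^ (-(1 / 2) - α)) * (C₂ * ENNReal.ofReal (r ^ (n + 1)) *
                ∫⁻ s in Ioo 0 t, ENNReal.ofReal ((t - s) ^ (-(1 / 2) : ℝ)) * Ψ s) := by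
              rw [lintegral_const_mul _ hmM]
              gcongr
              exact hball t ht
          _ = _ := by
              have hm1 : Measurable fun s => ENNReal.ofReal ((t - s) ^ (-(1 / 2) : ℝ)) * Ψ s :=
                Measurable.mul (by fun_prop) hΨm
              rw [show B * ENNReal.ofReal (t ^ (-(1 / 2) - α)) *
                (C₂ * ENNReal.ofReal (r ^ (n + 1)) *
                  ∫⁻ s in Ioo 0 t, ENNReal.ofReal ((t - s) ^ (-(1 / 2) : ℝ)) * Ψ s)
                = B * (C₂ * ENNReal.ofReal (r ^ (n + 1))) * (ENNReal.ofReal (t ^ (-(1 / 2) - α)) *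
                  ∫⁻ s in Ioo 0 t, ENNReal.ofReal ((t - s) ^ (-(1 / 2) : ℝ)) * Ψ s) by ring,
                ← lintegral_const_mul _ hm1]
              congr 1
              refine lintegral_congr fun s => ?_
              rw [ENNReal.ofReal_mul (Real.rpow_nonneg ht.1.le _), mul_assoc]
    _ = ENNReal.ofReal (r ^ (2 * α - n)) * (B * (C₂ * ENNReal.ofReal (r ^ (n + 1))) *
          ∫⁻ t in Ioo 0 (r ^ 2), ∫⁻ s in Ioo 0 t,
            ENNReal.ofReal (t ^ (-(1 / 2) - α) * (t - s) ^ (-(1 / 2) : ℝ)) * Ψ s) := by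
        rw [lintegral_const_mul]
        have h2 : (fun t => ∫⁻ s in Ioo 0 t,
            ENNReal.ofReal (t ^ (-(1 / 2) - α) * (t - s) ^ (-(1 / 2) : ℝ)) * Ψ s)
            = fun t => ∫⁻ s, {q : ℝ × ℝ | 0 < q.2 ∧ q.2 < q.1}.indicator (fun q =>
              ENNReal.ofReal (q.1 ^ (-(1 / 2) - α) * (q.1 - q.2) ^ (-(1 / 2) : ℝ)) * Ψ q.2)
                (t, s) := by
          funext t
          rw [← lintegral_indicator measurableSet_Ioo]
          rfl
        rw [h2]
        refine Measurable.lintegral_prod_right' (Measurable.indicator ?_ ?_)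
        · exact Measurable.mul (by fun_prop) (hΨm.comp measurable_snd)
        · exact (measurableSet_lt measurable_const measurable_snd).inter
            (measurableSet_lt measurable_snd measurable_fst)
    _ ≤ ENNReal.ofReal (r ^ (2 * α - n)) * (B * (C₂ * ENNReal.ofReal (r ^ (n + 1))) *
          ∫⁻ s in Ioo 0 (r ^ 2), ENNReal.ofReal (2 + 2 / α) *
            (Ψ s * ENNReal.ofReal (s ^ (-α)))) := by
        gcongr ENNReal.ofReal _ * (_ * ?_)
        have hm : Measurable fun q : ℝ × ℝ => {q : ℝ × ℝ | 0 < q.2 ∧ q.2 < q.1}.indicator (fun q =>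
            ENNReal.ofReal (q.1 ^ (-(1 / 2) - α) * (q.1 - q.2) ^ (-(1 / 2) : ℝ)) * Ψ q.2) q := by
          refine Measurable.indicator ?_ ?_
          · exact Measurable.mul (by fun_prop) (hΨm.comp measurable_snd)
          · exact (measurableSet_lt measurable_const measurable_snd).inter
              (measurableSet_lt measurable_snd measurable_fst)
        calc _ = ∫⁻ t in Ioo 0 (r ^ 2), ∫⁻ s in Ioo 0 (r ^ 2),
              {q : ℝ × ℝ | 0 < q.2 ∧ q.2 < q.1}.indicator (fun q =>
                ENNReal.ofReal (q.1 ^ (-(1 / 2) - α) * (q.1 - q.2) ^ (-(1 / 2) : ℝ)) * Ψ q.2)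
                  (t, s) := by
              refine setLIntegral_congr_fun measurableSet_Ioo fun t ht => ?_
              rw [← lintegral_indicator measurableSet_Ioo, ← lintegral_indicator measurableSet_Ioo]
              congr 1
              funext s
              by_cases hs : s ∈ Ioo 0 t
              · have hs' : s ∈ Ioo 0 (r ^ 2) := ⟨hs.1, hs.2.trans ht.2⟩
                have hs'' : (t, s) ∈ {q : ℝ × ℝ | 0 < q.2 ∧ q.2 < q.1} := hs
                rw [indicator_of_mem hs, indicator_of_mem hs', indicator_of_mem hs'']
              · have hs'' : (t, s) ∉ {q : ℝ × ℝ | 0 < q.2 ∧ q.2 < q.1} := hs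
                rw [indicator_of_notMem hs]
                by_cases hs' : s ∈ Ioo 0 (r ^ 2)
                · rw [indicator_of_mem hs', indicator_of_notMem hs'']
                · rw [indicator_of_notMem hs']
          _ = ∫⁻ s in Ioo 0 (r ^ 2), ∫⁻ t in Ioo 0 (r ^ 2),
              {q : ℝ × ℝ | 0 < q.2 ∧ q.2 < q.1}.indicator (fun q =>
                ENNReal.ofReal (q.1 ^ (-(1 / 2) - α) * (q.1 - q.2) ^ (-(1 / 2) : ℝ)) * Ψ q.2)
                  (t, s) := lintegral_lintegral_swap hm.aemeasurable
          _ ≤ _ := by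
              refine setLIntegral_mono' measurableSet_Ioo fun s hs => ?_
              calc _ ≤ ∫⁻ t in Ioi s,
                    ENNReal.ofReal (t ^ (-(1 / 2) - α) * (t - s) ^ (-(1 / 2) : ℝ)) * Ψ s := by
                    rw [← lintegral_indicator measurableSet_Ioo,
                      ← lintegral_indicator measurableSet_Ioi]
                    refine lintegral_mono fun t => ?_
                    refine indicator_le (fun t _ => ?_) t
                    by_cases h : s < t
                    · have h' : (t, s) ∈ {q : ℝ × ℝ | 0 < q.2 ∧ q.2 < q.1} := ⟨hs.1, h⟩
                      rw [indicator_of_mem h', indicator_of_mem (show t ∈ Ioi s from h)]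
                    · have h' : (t, s) ∉ {q : ℝ × ℝ | 0 < q.2 ∧ q.2 < q.1} := fun hq => h hq.2
                      rw [indicator_of_notMem h']
                      exact zero_le
                _ ≤ ENNReal.ofReal (2 + 2 / α) * ENNReal.ofReal (s ^ (-α)) * Ψ s := by
                    rw [lintegral_mul_const _ (by fun_prop)]
                    gcongr
                    exact lintegral_beta_le hα hs.1
                _ = _ := by ring
    _ = ENNReal.ofReal (r ^ (2 * α - n)) * (B * (C₂ * ENNReal.ofReal (r ^ (n + 1))) *
          (ENNReal.ofReal (2 + 2 / α) * ∫⁻ s in Ioo 0 (r ^ 2), ∫⁻ y,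
            ENNReal.ofReal (weight r (x₀ - y)) * (F s y * ENNReal.ofReal (s ^ (-α))))) := by
        rw [lintegral_const_mul' _ _ ENNReal.ofReal_ne_top]
        congr 4
        funext s
        have hmy : Measurable fun y => ENNReal.ofReal (weight r (x₀ - y)) * F s y :=
          (measurable_weight_sub r x₀).mul (hF.comp measurable_prodMk_left)
        rw [hΨ, ← lintegral_mul_const _ hmy]
        simp only [mul_assoc]
    _ ≤ ENNReal.ofReal (r ^ (2 * α - n)) * (B * (C₂ * ENNReal.ofReal (r ^ (n + 1))) *
          (ENNReal.ofReal (2 + 2 / α) * (C₁ * A * ENNReal.ofReal (r ^ (-(2 * α)) * r⁻¹)))) := by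
        gcongr
        exact hC₁ F hF r r hr le_rfl A hA x₀
    _ = C₂ * ENNReal.ofReal (2 + 2 / α) * C₁ * A * B * ENNReal.ofReal
          (r ^ (2 * α - n) * r ^ (n + 1) * (r ^ (-(2 * α)) * r⁻¹)) := by
        rw [ENNReal.ofReal_mul (p := r ^ (2 * α - n) * r ^ (n + 1)) (by positivity),
          ENNReal.ofReal_mul (p := r ^ (2 * α - n)) (by positivity)]
        ring
    _ = _ := by
        have e : r ^ (2 * α - n) * r ^ (n + 1) * (r ^ (-(2 * α)) * r⁻¹) = 1 := by
          rw [← Real.rpow_natCast r (n + 1), ← Real.rpow_neg_one r, ← Real.rpow_add hr,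
            ← Real.rpow_add hr, ← Real.rpow_add hr]
          push_cast
          rw [show 2 * α - n + (n + 1) + (-(2 * α) + -1) = 0 by ring, Real.rpow_zero]
        rw [e, ENNReal.ofReal_one, mul_one]
        rfl

/-! ### Sources of parabolic Carleson type -/

/-- The times `t ∈ (0,T)`, for `T ∈ (0,∞]`. -/
def timeSet (T : ℝ≥0∞) : Set ℝ := {t : ℝ | 0 < t ∧ ENNReal.ofReal t < T}

theorem measurableSet_timeSet (T : ℝ≥0∞) : MeasurableSet (timeSet T) :=
  measurableSet_Ioi.inter (measurableSet_lt ENNReal.measurable_ofReal measurable_const)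

theorem Ioo_subset_timeSet {T : ℝ≥0∞} {b : ℝ} (hb : ENNReal.ofReal b ≤ T) :
    Ioo 0 b ⊆ timeSet T := fun _ ht =>
  ⟨ht.1, ((ENNReal.ofReal_lt_ofReal_iff (ht.1.trans ht.2)).2 ht.2).trans_le hb⟩

theorem restrict_timeSet_prod {n : ℕ} (T : ℝ≥0∞) :
    (volume.restrict (timeSet T ×ˢ (univ : Set (Rn n))) : Measure (ℝ × Rn n))
      = (volume.restrict (timeSet T)).prod volume := by
  rw [Measure.volume_eq_prod, ← Measure.prod_restrict, Measure.restrict_univ]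

/-- `F ≥ 0` is a source of size `A`: it obeys the bounds that `X_{α;T}` gives for the product of
two of its elements. -/
structure IsSource {n : ℕ} (α : ℝ) (T : ℝ≥0∞) (F : ℝ → Rn n → ℝ≥0∞) (A : ℝ≥0∞) : Prop where
  aemeasurable : AEMeasurable (Function.uncurry F)
    (volume.restrict (timeSet T ×ˢ (univ : Set (Rn n))))
  mul_le (t : ℝ) (ht : t ∈ timeSet T) : ∀ᵐ y, ENNReal.ofReal t * F t y ≤ A
  carlesonMass_le (x : Rn n) (r : ℝ) (hr : 0 < r) (hrT : ENNReal.ofReal (r ^ 2) < T) :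
    carlesonMass α F x r ≤ A

theorem carlesonMass_eq_lintegral_prod {n : ℕ} {α : ℝ} {T : ℝ≥0∞} {F : ℝ → Rn n → ℝ≥0∞}
    (hF : AEMeasurable (Function.uncurry F) (volume.restrict (timeSet T ×ˢ (univ : Set (Rn n)))))
    (x : Rn n) {r : ℝ} (hr : ENNReal.ofReal (r ^ 2) < T) :
    carlesonMass α F x r = ENNReal.ofReal (r ^ (2 * α - n)) *
      ∫⁻ p in Ioo 0 (r ^ 2) ×ˢ Metric.ball x r,
        Function.uncurry F p * ENNReal.ofReal (p.1 ^ (-α)) := by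
  have hsub : Ioo 0 (r ^ 2) ×ˢ Metric.ball x r ⊆ timeSet T ×ˢ (univ : Set (Rn n)) :=
    prod_mono (Ioo_subset_timeSet hr.le) (subset_univ _)
  have hm : AEMeasurable (fun p : ℝ × Rn n => Function.uncurry F p * ENNReal.ofReal (p.1 ^ (-α)))
      (volume.restrict (Ioo 0 (r ^ 2) ×ˢ Metric.ball x r)) :=
    (hF.mono_measure (Measure.restrict_mono hsub le_rfl)).mul (by fun_prop)
  rw [Measure.volume_eq_prod, ← Measure.prod_restrict] at hm ⊢
  rw [lintegral_prod _ hm]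
  rfl

theorem IsSource.add {n : ℕ} {α : ℝ} {T : ℝ≥0∞} {F G : ℝ → Rn n → ℝ≥0∞} {A B : ℝ≥0∞}
    (hF : IsSource α T F A) (hG : IsSource α T G B) : IsSource α T (F + G) (A + B) where
  aemeasurable := hF.aemeasurable.add hG.aemeasurable
  mul_le t ht := by
    filter_upwards [hF.mul_le t ht, hG.mul_le t ht] with y h1 h2
    rw [Pi.add_apply, Pi.add_apply, mul_add]
    exact add_le_add h1 h2
  carlesonMass_le x r hr hrT := by
    refine le_trans (le_of_eq ?_) (add_le_add (hF.carlesonMass_le x r hr hrT)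
      (hG.carlesonMass_le x r hr hrT))
    have hsub : Ioo 0 (r ^ 2) ×ˢ Metric.ball x r ⊆ timeSet T ×ˢ (univ : Set (Rn n)) :=
      prod_mono (Ioo_subset_timeSet hrT.le) (subset_univ _)
    rw [carlesonMass_eq_lintegral_prod (hF.aemeasurable.add hG.aemeasurable) x hrT,
      carlesonMass_eq_lintegral_prod hF.aemeasurable x hrT,
      carlesonMass_eq_lintegral_prod hG.aemeasurable x hrT, ← mul_add, ← lintegral_add_left']
    · congr 2
      funext p
      exact add_mul _ _ _
    · exact (hF.aemeasurable.mono_measure (Measure.restrict_mono hsub le_rfl)).mul (by fun_prop)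

theorem isSource_zero {n : ℕ} (α : ℝ) (T : ℝ≥0∞) :
    IsSource α T (0 : ℝ → Rn n → ℝ≥0∞) 0 where
  aemeasurable := measurable_const.aemeasurable (f := fun _ : ℝ × Rn n => (0 : ℝ≥0∞))
  mul_le t _ := by simp
  carlesonMass_le x r _ _ := by simp [carlesonMass]

theorem IsSource.sum {n : ℕ} {α : ℝ} {T : ℝ≥0∞} {ι : Type*} (s : Finset ι)
    {F : ι → ℝ → Rn n → ℝ≥0∞} {A : ι → ℝ≥0∞} (h : ∀ i ∈ s, IsSource α T (F i) (A i)) :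
    IsSource α T (∑ i ∈ s, F i) (∑ i ∈ s, A i) := by
  classical
  induction s using Finset.induction_on with
  | empty => simpa using isSource_zero α T
  | insert i s hi ih =>
    rw [Finset.sum_insert hi, Finset.sum_insert hi]
    exact (h i (Finset.mem_insert_self i s)).add
      (ih fun j hj => h j (Finset.mem_insert_of_mem hj))

/-! ### The norm of `X_{α;T}` -/

theorem eLpNorm_le_xNorm {n : ℕ} {α : ℝ} {T : ℝ≥0∞} (g : ℝ → Rn n → ℂ) {t : ℝ}
    (ht : t ∈ timeSet T) : ENNReal.ofReal √t * eLpNorm (g t) ⊤ volume ≤ xNorm α T g := by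
  refine le_trans (le_iSup₂_of_le t ht.1 ?_) le_self_add
  exact le_iSup (fun _ : ENNReal.ofReal t < T => ENNReal.ofReal √t * eLpNorm (g t) ⊤ volume) ht.2

theorem ae_mul_enorm_le_xNorm {n : ℕ} {α : ℝ} {T : ℝ≥0∞} (g : ℝ → Rn n → ℂ) {t : ℝ}
    (ht : t ∈ timeSet T) : ∀ᵐ y, ENNReal.ofReal √t * ‖g t y‖ₑ ≤ xNorm α T g := by
  filter_upwards [ae_le_eLpNormEssSup (f := g t) (μ := volume)] with y hy
  refine le_trans ?_ (eLpNorm_le_xNorm g ht)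
  rw [eLpNorm_exponent_top]
  gcongr

theorem carleson_rpow_le_xNorm {n : ℕ} {α : ℝ} {T : ℝ≥0∞} (g : ℝ → Rn n → ℂ) (x : Rn n) {r : ℝ}
    (hr : 0 < r) (hrT : ENNReal.ofReal (r ^ 2) < T) :
    carleson α g x r ^ (1 / 2 : ℝ) ≤ xNorm α T g := by
  refine le_trans (le_iSup₂_of_le x r (le_iSup_of_le hr ?_)) le_add_self
  exact le_iSup (fun _ : ENNReal.ofReal (r ^ 2) < T => carleson α g x r ^ (1 / 2 : ℝ)) hrT

theorem xNorm_le {n : ℕ} {α : ℝ} {T : ℝ≥0∞} {g : ℝ → Rn n → ℂ} {A B : ℝ≥0∞}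
    (hA : ∀ t ∈ timeSet T, ∀ᵐ y, ENNReal.ofReal √t * ‖g t y‖ₑ ≤ A)
    (hB : ∀ (x : Rn n) (r : ℝ), 0 < r → ENNReal.ofReal (r ^ 2) < T →
      carleson α g x r ^ (1 / 2 : ℝ) ≤ B) :
    xNorm α T g ≤ A + B := by
  refine add_le_add (iSup_le fun t => iSup₂_le fun ht htT => ?_)
    (iSup₂_le fun x r => iSup₂_le fun hr hrT => hB x r hr hrT)
  have ht0 : ENNReal.ofReal √t ≠ 0 := by
    rw [Ne, ENNReal.ofReal_eq_zero, not_le]; exact Real.sqrt_pos.2 ht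
  rw [mul_comm, ← ENNReal.le_div_iff_mul_le (Or.inl ht0) (Or.inl ENNReal.ofReal_ne_top),
    eLpNorm_exponent_top]
  refine essSup_le_of_ae_le _ ?_
  filter_upwards [hA t ⟨ht, htT⟩] with y hy
  rwa [ENNReal.le_div_iff_mul_le (Or.inl ht0) (Or.inl ENNReal.ofReal_ne_top), mul_comm]

/-- The product of two elements of `X_{α;T}` is a source, by the Cauchy–Schwarz inequality. -/
theorem isSource_mul {n : ℕ} {α : ℝ} {T : ℝ≥0∞} {g h : ℝ → Rn n → ℂ} (hg : MemX α T g)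
    (hh : MemX α T h) :
    IsSource α T (fun t y => ‖g t y‖ₑ * ‖h t y‖ₑ) (xNorm α T g * xNorm α T h) where
  aemeasurable := hg.aestronglyMeasurable.enorm.mul hh.aestronglyMeasurable.enorm
  mul_le t ht := by
    filter_upwards [ae_mul_enorm_le_xNorm (α := α) g ht, ae_mul_enorm_le_xNorm (α := α) h ht]
      with y h1 h2
    have e : ENNReal.ofReal t = ENNReal.ofReal √t * ENNReal.ofReal √t := by
      rw [← ENNReal.ofReal_mul (Real.sqrt_nonneg t), Real.mul_self_sqrt ht.1.le]
    rw [e, mul_mul_mul_comm]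
    exact mul_le_mul' h1 h2
  carlesonMass_le x r hr hrT := by
    refine le_trans ?_ (mul_le_mul' (carleson_rpow_le_xNorm g x hr hrT)
      (carleson_rpow_le_xNorm h x hr hrT))
    have hsub : Ioo 0 (r ^ 2) ×ˢ Metric.ball x r ⊆ timeSet T ×ˢ (univ : Set (Rn n)) :=
      prod_mono (Ioo_subset_timeSet hrT.le) (subset_univ _)
    have hgm := hg.aestronglyMeasurable.enorm
    have hhm := hh.aestronglyMeasurable.enorm
    rw [carleson_eq_carlesonMass, carleson_eq_carlesonMass,
      carlesonMass_eq_lintegral_prod (hgm.mul hhm) x hrT,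
      carlesonMass_eq_lintegral_prod (hgm.pow_const 2) x hrT,
      carlesonMass_eq_lintegral_prod (hhm.pow_const 2) x hrT]
    set μ := (volume.restrict (Ioo 0 (r ^ 2) ×ˢ Metric.ball x r) : Measure (ℝ × Rn n)) with hμ
    set w : ℝ × Rn n → ℝ≥0∞ := fun p => ENNReal.ofReal (p.1 ^ (-α / 2)) with hw
    have hww : ∀ᵐ p ∂μ, ENNReal.ofReal (p.1 ^ (-α)) = w p * w p := by
      filter_upwards [ae_restrict_mem (measurableSet_Ioo.prod measurableSet_ball)] with p hp
      have hp0 : 0 < p.1 := hp.1.1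
      rw [hw, ← ENNReal.ofReal_mul (by positivity), ← Real.rpow_add hp0]
      congr 2; ring
    have hwm : Measurable w := by fun_prop
    have hgw := (hgm.mono_measure (Measure.restrict_mono hsub le_rfl)).mul hwm.aemeasurable
    have hhw := (hhm.mono_measure (Measure.restrict_mono hsub le_rfl)).mul hwm.aemeasurable
    have hCS := ENNReal.lintegral_mul_le_Lp_mul_Lq μ Real.HolderConjugate.two_two hgw hhw
    have e1 : ∫⁻ p, Function.uncurry (fun t y => ‖g t y‖ₑ * ‖h t y‖ₑ) p *
        ENNReal.ofReal (p.1 ^ (-α)) ∂μ = ∫⁻ p, ((fun p => ‖Function.uncurry g p‖ₑ * w p) *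
          fun p => ‖Function.uncurry h p‖ₑ * w p) p ∂μ := by
      refine lintegral_congr_ae ?_
      filter_upwards [hww] with p hp
      rw [hp]
      change _ = ‖g p.1 p.2‖ₑ * w p * (‖h p.1 p.2‖ₑ * w p)
      simp only [Function.uncurry]
      ring
    have e2 : ∀ k : ℝ → Rn n → ℂ, ∫⁻ p, Function.uncurry (fun t y => ‖k t y‖ₑ ^ 2) p *
        ENNReal.ofReal (p.1 ^ (-α)) ∂μ = ∫⁻ p, (‖Function.uncurry k p‖ₑ * w p) ^ (2 : ℝ) ∂μ := by
      intro k
      refine lintegral_congr_ae ?_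
      filter_upwards [hww] with p hp
      rw [hp, ENNReal.rpow_two, mul_pow, ← pow_two]
      rfl
    have hc : ∀ c : ℝ≥0∞, c = c ^ (1 / 2 : ℝ) * c ^ (1 / 2 : ℝ) := fun c => by
      rw [← ENNReal.rpow_add_of_nonneg _ _ (by norm_num) (by norm_num)]
      norm_num
    have e3 : Function.uncurry ((fun t y => ‖g t y‖ₑ * ‖h t y‖ₑ) : ℝ → Rn n → ℝ≥0∞)
        = Function.uncurry (fun t y => ‖g t y‖ₑ * ‖h t y‖ₑ) := rfl
    rw [ENNReal.mul_rpow_of_nonneg _ _ (by norm_num), ENNReal.mul_rpow_of_nonneg _ _ (by norm_num),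
      mul_mul_mul_comm, ← hc, e2 g, e2 h]
    gcongr
    exact e1.trans_le hCS

/-- The two bounds for the majorant of a source, for sources that are only almost everywhere
measurable on `(0,T) × ℝⁿ`. -/
theorem exists_majorant_bounds (n : ℕ) [NeZero n] {α : ℝ} (hα : 0 < α) : ∃ C : ℝ≥0,
    ∀ (T : ℝ≥0∞) (F : ℝ → Rn n → ℝ≥0∞) (A : ℝ≥0∞), IsSource α T F A →
      (∀ t ∈ timeSet T, ∀ x, majorant F t x ≤ C * A * ENNReal.ofReal (t ^ (-(1 / 2) : ℝ))) ∧
      ∀ (x : Rn n) (r : ℝ), 0 < r → ENNReal.ofReal (r ^ 2) < T →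
        carlesonMass α (fun t x => majorant F t x ^ 2) x r ≤ C * A ^ 2 := by
  obtain ⟨C₁, hC₁⟩ := exists_majorant_le n hα
  obtain ⟨C₂, hC₂⟩ := exists_carlesonMass_majorant_sq_le n hα
  refine ⟨C₁ + C₂ * C₁, fun T F A hF => ?_⟩
  have haem := hF.aemeasurable
  rw [restrict_timeSet_prod] at haem
  set F' : ℝ → Rn n → ℝ≥0∞ := fun t y => haem.mk _ (t, y) with hF'
  have hF'm : Measurable (Function.uncurry F') := haem.measurable_mk
  have hae : ∀ᵐ s ∂(volume.restrict (timeSet T)), F s =ᵐ[volume] F' s :=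
    Measure.ae_ae_of_ae_prod haem.ae_eq_mk
  have hmaj : ∀ t ∈ timeSet T, ∀ x, majorant F t x = majorant F' t x := fun t ht x => by
    refine lintegral_congr_ae ?_
    filter_upwards [ae_restrict_of_ae_restrict_of_subset (Ioo_subset_timeSet ht.2.le) hae]
      with s hs
    refine lintegral_congr_ae ?_
    filter_upwards [hs] with y hy
    rw [hy]
  have hmass : ∀ (x : Rn n) (r : ℝ), 0 < r → ENNReal.ofReal (r ^ 2) < T →
      carlesonMass α F' x r ≤ A := fun x r hr hrT => by
    refine le_trans (le_of_eq ?_) (hF.carlesonMass_le x r hr hrT)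
    unfold carlesonMass
    congr 1
    refine lintegral_congr_ae ?_
    filter_upwards [ae_restrict_of_ae_restrict_of_subset (Ioo_subset_timeSet hrT.le) hae]
      with s hs
    refine lintegral_congr_ae ?_
    filter_upwards [ae_restrict_of_ae hs] with y hy
    rw [hy]
  have hpt : ∀ t ∈ timeSet T, ∀ x,
      majorant F' t x ≤ C₁ * A * ENNReal.ofReal (t ^ (-(1 / 2) : ℝ)) := fun t ht x => by
    have ht0 : 0 < t := ht.1
    refine hC₁ F' hF'm t ht0 A (fun z => hmass z _ (Real.sqrt_pos.2 (by positivity)) ?_) ?_ x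
    · rw [Real.sq_sqrt (by positivity)]
      exact (ENNReal.ofReal_le_ofReal (by linarith)).trans_lt ht.2
    · filter_upwards [ae_restrict_of_ae_restrict_of_subset (Ioo_subset_timeSet ht.2.le) hae,
        ae_restrict_mem measurableSet_Ioo] with s hs hsm
      filter_upwards [hs, hF.mul_le s (Ioo_subset_timeSet ht.2.le hsm)] with y h1 h2
      rwa [← h1]
  refine ⟨fun t ht x => ?_, fun x r hr hrT => ?_⟩
  · rw [hmaj t ht]
    refine (hpt t ht x).trans ?_
    gcongr
    exact le_self_add
  · have h := hC₂ F' hF'm r hr A (C₁ * A) (fun z => hmass z r hr hrT)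
      (fun t ht x => hpt t (Ioo_subset_timeSet hrT.le ht) x) x
    calc _ = carlesonMass α (fun t x => majorant F' t x ^ 2) x r := by
          unfold carlesonMass
          congr 1
          refine setLIntegral_congr_fun measurableSet_Ioo fun t ht => ?_
          refine lintegral_congr fun y => ?_
          simp only [hmaj t (Ioo_subset_timeSet hrT.le ht)]
      _ ≤ _ := h
      _ = C₂ * C₁ * A ^ 2 := by ring
      _ ≤ _ := by
          gcongr
          push_cast
          exact le_add_self

/-- A function dominated by the majorant of a source belongs to `X_{α;T}`, with a bound. -/
theorem exists_xNorm_le_of_le_majorant (n : ℕ) [NeZero n] {α : ℝ} (hα : 0 < α) : ∃ C : ℝ≥0,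
    ∀ (T : ℝ≥0∞) (F : ℝ → Rn n → ℝ≥0∞) (A : ℝ≥0∞), IsSource α T F A →
      ∀ (g : ℝ → Rn n → ℂ) (K : ℝ≥0),
        (∀ t ∈ timeSet T, ∀ᵐ x, ‖g t x‖ₑ ≤ K * majorant F t x) → xNorm α T g ≤ C * K * A := by
  obtain ⟨C, hC⟩ := exists_majorant_bounds n hα
  refine ⟨C + C ^ (1 / 2 : ℝ), fun T F A hF g K hg => ?_⟩
  obtain ⟨h1, h2⟩ := hC T F A hF
  have := xNorm_le (α := α) (T := T) (g := g) (A := C * K * A)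
    (B := (C ^ (1 / 2 : ℝ) : ℝ≥0) * K * A) ?_ ?_
  · refine this.trans (le_of_eq ?_)
    push_cast
    ring
  · intro t ht
    filter_upwards [hg t ht] with x hx
    calc _ ≤ ENNReal.ofReal √t * (K * (C * A * ENNReal.ofReal (t ^ (-(1 / 2) : ℝ)))) := by
          gcongr
          exact hx.trans (by gcongr; exact h1 t ht x)
      _ = C * K * A * (ENNReal.ofReal √t * ENNReal.ofReal (t ^ (-(1 / 2) : ℝ))) := by ring
      _ = _ := by
          rw [← ENNReal.ofReal_mul (Real.sqrt_nonneg t), ← inv_sqrt_eq_rpow ht.1,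
            mul_inv_cancel₀ (Real.sqrt_pos.2 ht.1).ne', ENNReal.ofReal_one, mul_one]
  · intro x r hr hrT
    have h3 : carleson α g x r ≤ K ^ 2 * (C * A ^ 2) := by
      calc carleson α g x r ≤ ENNReal.ofReal (r ^ (2 * α - n)) *
            ∫⁻ t in Ioo 0 (r ^ 2), K ^ 2 * ∫⁻ y in Metric.ball x r,
              majorant F t y ^ 2 * ENNReal.ofReal (t ^ (-α)) := by
            unfold carleson
            gcongr ENNReal.ofReal _ * ?_
            refine setLIntegral_mono' measurableSet_Ioo fun t ht => ?_
            rw [← lintegral_const_mul' _ _ (by finiteness)]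
            refine lintegral_mono_ae ?_
            filter_upwards [ae_restrict_of_ae (hg t (Ioo_subset_timeSet hrT.le ht))] with y hy
            rw [← mul_assoc, ← mul_pow]
            gcongr
        _ = K ^ 2 * carlesonMass α (fun t x => majorant F t x ^ 2) x r := by
            rw [lintegral_const_mul' _ _ (by finiteness)]
            unfold carlesonMass
            ring
        _ ≤ _ := by
            gcongr
            exact h2 x r hr hrT
    calc _ ≤ (K ^ 2 * (C * A ^ 2)) ^ (1 / 2 : ℝ) := by gcongr
      _ = _ := by
          have hsq : ∀ a : ℝ≥0∞, (a ^ 2) ^ (1 / 2 : ℝ) = a := fun a => by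
            rw [← ENNReal.rpow_natCast, ← ENNReal.rpow_mul]; norm_num
          rw [ENNReal.mul_rpow_of_nonneg _ _ (by norm_num),
            ENNReal.mul_rpow_of_nonneg _ _ (by norm_num), hsq, hsq,
            ENNReal.coe_rpow_of_nonneg _ (by norm_num)]
          ring

/-! ### The kernel of `e^{tΔ} P_{jk} ∂_l` -/

/-- The character `ξ ↦ e^{2πi x·ξ}`. -/
def fourierPhase {n : ℕ} (x ξ : Rn n) : ℂ :=
  Complex.exp (↑(2 * π * inner ℝ ξ x) * Complex.I)

theorem norm_fourierPhase {n : ℕ} (x ξ : Rn n) : ‖fourierPhase x ξ‖ = 1 :=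
  Complex.norm_exp_ofReal_mul_I _

theorem continuous_fourierPhase {n : ℕ} :
    Continuous fun p : Rn n × Rn n => fourierPhase p.1 p.2 := by
  unfold fourierPhase
  fun_prop

theorem fourierPhase_smul {n : ℕ} (x ξ : Rn n) {σ : ℝ} (hσ : σ ≠ 0) :
    fourierPhase (σ⁻¹ • x) (σ • ξ) = fourierPhase x ξ := by
  simp only [fourierPhase, inner_smul_left, inner_smul_right]
  congr 4
  simp [hσ]

theorem oseenKernel_eq {n : ℕ} (j k l : Fin n) (t : ℝ) (x : Rn n) :
    oseenKernel j k l t x =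
      ∫ ξ, fourierPhase x ξ * (heatSymbol t ξ * leraySymbol j k ξ * derivSymbol l ξ) := by
  rw [oseenKernel, Real.fourierInv_eq']
  rfl

/-- The inverse Fourier transform of a dilated Schwartz function, multiplied by any power of
the dilation parameter, decays like a power of `σ + |x|`. -/
theorem exists_norm_integral_phase_le {n : ℕ} (Φ : 𝓢(Rn n, ℂ)) (d : ℕ) :
    ∃ C : ℝ, 0 ≤ C ∧ ∀ σ : ℝ, 0 < σ → ∀ x : Rn n,
      ‖∫ ξ, fourierPhase x ξ * Φ (σ • ξ)‖ ≤ C * σ ^ d * ((σ + ‖x‖) ^ (n + d))⁻¹ := by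
  refine ⟨2 ^ (n + d) * ((Finset.Iic (n + d, 0)).sup fun m => SchwartzMap.seminorm ℝ m.1 m.2)
    (𝓕⁻ Φ), mul_nonneg (by positivity) (apply_nonneg _ _), fun σ hσ x => ?_⟩
  have h := SchwartzMap.one_add_le_sup_seminorm_apply (𝕜 := ℝ) (m := (n + d, 0)) (k := n + d)
    (n := 0) le_rfl le_rfl (𝓕⁻ Φ) (σ⁻¹ • x)
  rw [norm_iteratedFDeriv_zero] at h
  set C := 2 ^ (n + d) * ((Finset.Iic (n + d, 0)).sup fun m => SchwartzMap.seminorm ℝ m.1 m.2)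
    (𝓕⁻ Φ) with hC
  have e : ∫ ξ, fourierPhase x ξ * Φ (σ • ξ) = ((σ ^ n)⁻¹ : ℝ) • 𝓕⁻ Φ (σ⁻¹ • x) := by
    rw [SchwartzMap.fourierInv_coe, Real.fourierInv_eq']
    have h2 := Measure.integral_comp_smul (volume : Measure (Rn n))
      (fun ξ => fourierPhase (σ⁻¹ • x) ξ * Φ ξ) σ
    simp only [fourierPhase_smul _ _ hσ.ne', finrank_euclideanSpace_fin] at h2
    rw [h2, abs_of_pos (by positivity)]
    rfl
  rw [e, norm_smul, Real.norm_of_nonneg (by positivity)]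
  have h3 : (1 + ‖σ⁻¹ • x‖) = (σ + ‖x‖) / σ := by
    rw [norm_smul, Real.norm_of_nonneg (by positivity)]
    field_simp
  have hx : 0 < σ + ‖x‖ := by positivity
  rw [h3, div_pow, div_mul_eq_mul_div, div_le_iff₀ (by positivity)] at h
  rw [← div_eq_mul_inv, le_div_iff₀ (by positivity)]
  calc (σ ^ n)⁻¹ * ‖(𝓕⁻ Φ) (σ⁻¹ • x)‖ * (σ + ‖x‖) ^ (n + d)
      = (σ ^ n)⁻¹ * ((σ + ‖x‖) ^ (n + d) * ‖(𝓕⁻ Φ) (σ⁻¹ • x)‖) := by ring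
    _ ≤ (σ ^ n)⁻¹ * (C * σ ^ (n + d)) := by gcongr
    _ = C * σ ^ d := by rw [pow_add]; field_simp

theorem hasTemperateGrowth_derivSymbol {n : ℕ} (l : Fin n) :
    (derivSymbol l : Rn n → ℂ).HasTemperateGrowth := by
  have h := ContinuousLinearMap.hasTemperateGrowth
    ((2 * (π : ℂ) * Complex.I) • (Complex.ofRealCLM.comp (EuclideanSpace.proj l : Rn n →L[ℝ] ℝ)))
  exact h

theorem continuous_derivSymbol {n : ℕ} (l : Fin n) : Continuous (derivSymbol l : Rn n → ℂ) := by
  unfold derivSymbol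
  fun_prop

theorem derivSymbol_smul {n : ℕ} (l : Fin n) (σ : ℝ) (ξ : Rn n) :
    derivSymbol l (σ • ξ) = σ * derivSymbol l ξ := by
  simp only [derivSymbol, PiLp.smul_apply, smul_eq_mul, Complex.ofReal_mul]
  ring

theorem norm_derivSymbol_le {n : ℕ} (l : Fin n) (ξ : Rn n) :
    ‖derivSymbol l ξ‖ ≤ 2 * π * ‖ξ‖ := by
  have h : ‖derivSymbol l ξ‖ = 2 * π * |ξ l| := by
    simp [derivSymbol, abs_of_pos Real.pi_pos]
  rw [h]
  gcongr
  exact PiLp.norm_apply_le ξ l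

theorem heatSymbol_eq_one_smul {n : ℕ} {t : ℝ} (ht : 0 < t) (ξ : Rn n) :
    heatSymbol t ξ = heatSymbol 1 (√t • ξ) := by
  simp only [heatSymbol, norm_smul, mul_pow, Real.norm_of_nonneg (Real.sqrt_nonneg t),
    Real.sq_sqrt ht.le]
  congr 3
  ring

theorem norm_heatSymbol {n : ℕ} (t : ℝ) (ξ : Rn n) :
    ‖heatSymbol t ξ‖ = Real.exp (-(4 * π ^ 2 * ‖ξ‖ ^ 2) * t) := by
  rw [heatSymbol, Complex.norm_real, Real.norm_of_nonneg (Real.exp_pos _).le]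
  congr 1
  ring

theorem continuous_heatSymbol {n : ℕ} :
    Continuous fun p : ℝ × Rn n => heatSymbol p.1 p.2 := by
  unfold heatSymbol
  fun_prop

/-- The symbol of `e^Δ ∂_l` as a Schwartz function. -/
def heatDerivSchwartz {n : ℕ} (l : Fin n) : 𝓢(Rn n, ℂ) :=
  SchwartzMap.smulLeftCLM ℂ (derivSymbol l) (𝓕 (heatSchwartz 1 one_pos 0))

theorem heatDerivSchwartz_apply {n : ℕ} (l : Fin n) (ξ : Rn n) :
    heatDerivSchwartz l ξ = derivSymbol l ξ * heatSymbol 1 ξ := by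
  rw [heatDerivSchwartz, SchwartzMap.smulLeftCLM_apply_apply (hasTemperateGrowth_derivSymbol l),
    fourier_heatSchwartz, smul_eq_mul]

/-- The symbol of `e^Δ ∂_j ∂_k ∂_l` as a Schwartz function. -/
def heatDerivDerivDerivSchwartz {n : ℕ} (j k l : Fin n) : 𝓢(Rn n, ℂ) :=
  SchwartzMap.smulLeftCLM ℂ (derivSymbol j)
    (SchwartzMap.smulLeftCLM ℂ (derivSymbol k) (heatDerivSchwartz l))

theorem heatDerivDerivDerivSchwartz_apply {n : ℕ} (j k l : Fin n) (ξ : Rn n) :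
    heatDerivDerivDerivSchwartz j k l ξ =
      derivSymbol j ξ * (derivSymbol k ξ * (derivSymbol l ξ * heatSymbol 1 ξ)) := by
  rw [heatDerivDerivDerivSchwartz,
    SchwartzMap.smulLeftCLM_apply_apply (hasTemperateGrowth_derivSymbol j),
    SchwartzMap.smulLeftCLM_apply_apply (hasTemperateGrowth_derivSymbol k),
    heatDerivSchwartz_apply, smul_eq_mul, smul_eq_mul]

theorem derivSymbol_mul_heatSymbol {n : ℕ} (l : Fin n) {t : ℝ} (ht : 0 < t) (ξ : Rn n) :
    derivSymbol l ξ * heatSymbol t ξ = ((√t)⁻¹ : ℝ) * heatDerivSchwartz l (√t • ξ) := by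
  have h : (√t : ℂ) ≠ 0 := by exact_mod_cast (Real.sqrt_pos.2 ht).ne'
  rw [heatDerivSchwartz_apply, derivSymbol_smul, ← heatSymbol_eq_one_smul ht]
  push_cast
  field_simp

theorem derivSymbol_mul_mul_mul_heatSymbol {n : ℕ} (j k l : Fin n) {t : ℝ} (ht : 0 < t)
    (ξ : Rn n) :
    derivSymbol j ξ * (derivSymbol k ξ * (derivSymbol l ξ * heatSymbol t ξ)) =
      (((√t) ^ 3)⁻¹ : ℝ) * heatDerivDerivDerivSchwartz j k l (√t • ξ) := by
  have h : (√t : ℂ) ≠ 0 := by exact_mod_cast (Real.sqrt_pos.2 ht).ne'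
  rw [heatDerivDerivDerivSchwartz_apply, derivSymbol_smul, derivSymbol_smul, derivSymbol_smul,
    ← heatSymbol_eq_one_smul ht]
  push_cast
  field_simp

theorem integrable_derivSymbol_mul_heatSymbol {n : ℕ} (l : Fin n) {t : ℝ} (ht : 0 < t) :
    Integrable fun ξ : Rn n => derivSymbol l ξ * heatSymbol t ξ := by
  simp only [derivSymbol_mul_heatSymbol l ht]
  exact ((heatDerivSchwartz l).integrable.comp_smul (Real.sqrt_pos.2 ht).ne').const_mul _

/-- Since `|ξ|⁻² e^{-4π²t|ξ|²} = 4π² ∫_t^∞ e^{-4π²τ|ξ|²} dτ`, the nonsmooth part of the symbol is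
an integral of smooth ones. -/
theorem heatSymbol_mul_rieszSymbol_mul {n : ℕ} (j k l : Fin n) (t : ℝ) (ξ : Rn n) :
    heatSymbol t ξ * (rieszSymbol j ξ * rieszSymbol k ξ) * derivSymbol l ξ =
      ∫ τ in Ioi t, derivSymbol j ξ * (derivSymbol k ξ * (derivSymbol l ξ * heatSymbol τ ξ)) := by
  simp only [← mul_assoc]
  rw [integral_const_mul]
  -- at `ξ = 0` the quotient in the Riesz symbol is zero, and both sides vanish
  rcases eq_or_ne ξ 0 with rfl | hξ
  · simp [rieszSymbol, derivSymbol]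
  have hpos : 0 < 4 * π ^ 2 * ‖ξ‖ ^ 2 := by
    have := norm_pos_iff.2 hξ
    positivity
  have h : ∀ τ, heatSymbol τ ξ = ((Real.exp (-(4 * π ^ 2 * ‖ξ‖ ^ 2) * τ) : ℝ) : ℂ) := by
    intro τ
    simp only [heatSymbol]
    congr 2
    ring
  simp only [h]
  rw [integral_complex_ofReal, integral_exp_mul_Ioi (by linarith)]
  have h0 : (‖ξ‖ : ℂ) ≠ 0 := by exact_mod_cast (norm_pos_iff.2 hξ).ne'
  have h1 : (π : ℂ) ≠ 0 := by exact_mod_cast Real.pi_ne_zero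
  simp only [rieszSymbol]
  push_cast
  field_simp
  ring

theorem integrable_phase_mul_derivSymbol {n : ℕ} (j k l : Fin n) {t : ℝ} (ht : 0 < t) (x : Rn n) :
    Integrable (Function.uncurry fun (τ : ℝ) (ξ : Rn n) => fourierPhase x ξ *
      (derivSymbol j ξ * (derivSymbol k ξ * (derivSymbol l ξ * heatSymbol τ ξ))))
      ((volume.restrict (Ioi t)).prod volume) := by
  have hc : Continuous (Function.uncurry fun (τ : ℝ) (ξ : Rn n) => fourierPhase x ξ *
      (derivSymbol j ξ * (derivSymbol k ξ * (derivSymbol l ξ * heatSymbol τ ξ)))) := by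
    have h0 : Continuous fun p : ℝ × Rn n => fourierPhase x p.2 :=
      continuous_fourierPhase.comp (continuous_const.prodMk continuous_snd)
    have hd : ∀ i : Fin n, Continuous fun p : ℝ × Rn n => derivSymbol i p.2 := fun i =>
      (continuous_derivSymbol i).comp continuous_snd
    exact h0.mul ((hd j).mul ((hd k).mul ((hd l).mul continuous_heatSymbol)))
  rw [integrable_prod_iff' hc.aestronglyMeasurable]
  have hn : ∀ (τ : ℝ) (ξ : Rn n), ‖fourierPhase x ξ *
      (derivSymbol j ξ * (derivSymbol k ξ * (derivSymbol l ξ * heatSymbol τ ξ)))‖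
      = ‖derivSymbol j ξ * derivSymbol k ξ * derivSymbol l ξ‖ *
        Real.exp (-(4 * π ^ 2 * ‖ξ‖ ^ 2) * τ) := by
    intro τ ξ
    simp only [norm_mul, norm_fourierPhase, norm_heatSymbol]
    ring
  have hz : ∀ ξ : Rn n, ξ = 0 ∨ -(4 * π ^ 2 * ‖ξ‖ ^ 2) < 0 := by
    intro ξ
    rcases eq_or_ne ξ 0 with h | h
    · exact Or.inl h
    · have := norm_pos_iff.2 h
      exact Or.inr (by have : 0 < 4 * π ^ 2 * ‖ξ‖ ^ 2 := by positivity
                       linarith)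
  refine ⟨Eventually.of_forall fun ξ => ?_, ?_⟩
  · have hci : Continuous fun τ : ℝ => fourierPhase x ξ *
        (derivSymbol j ξ * (derivSymbol k ξ * (derivSymbol l ξ * heatSymbol τ ξ))) :=
      continuous_const.mul (continuous_const.mul (continuous_const.mul (continuous_const.mul
        (continuous_heatSymbol.comp (by fun_prop : Continuous fun τ : ℝ => (τ, ξ))))))
    simp only [Function.uncurry_apply_pair]
    rw [← integrable_norm_iff hci.aestronglyMeasurable]
    simp only [hn]
    rcases hz ξ with rfl | h
    · simp [derivSymbol]
    · exact (integrableOn_exp_mul_Ioi h t).const_mul _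
  · refine (integrable_derivSymbol_mul_heatSymbol l ht).mono
      hc.norm.stronglyMeasurable.integral_prod_left'.aestronglyMeasurable
      (Eventually.of_forall fun ξ => ?_)
    simp only [Function.uncurry, hn, integral_const_mul]
    rcases hz ξ with rfl | h
    · simp [derivSymbol]
    have hpos : 0 < 4 * π ^ 2 * ‖ξ‖ ^ 2 := by linarith
    rw [integral_exp_mul_Ioi h, neg_div_neg_eq, norm_mul, norm_norm,
      Real.norm_of_nonneg (div_nonneg (Real.exp_pos _).le hpos.le)]
    simp only [norm_mul, norm_heatSymbol]
    rw [mul_div_assoc', div_le_iff₀ hpos]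
    calc _ = (‖derivSymbol j ξ‖ * ‖derivSymbol k ξ‖) *
          (‖derivSymbol l ξ‖ * Real.exp (-(4 * π ^ 2 * ‖ξ‖ ^ 2) * t)) := by ring
      _ ≤ ((2 * π * ‖ξ‖) * (2 * π * ‖ξ‖)) *
          (‖derivSymbol l ξ‖ * Real.exp (-(4 * π ^ 2 * ‖ξ‖ ^ 2) * t)) := by
        gcongr
        · exact norm_derivSymbol_le j ξ
        · exact norm_derivSymbol_le k ξ
      _ = _ := by ring

/-- The kernel in terms of inverse Fourier transforms of Schwartz functions, by Fubini's theorem. -/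
theorem oseenKernel_eq_add {n : ℕ} (j k l : Fin n) {t : ℝ} (ht : 0 < t) (x : Rn n) :
    oseenKernel j k l t x =
      (if j = k then 1 else 0) * (∫ ξ, fourierPhase x ξ * (derivSymbol l ξ * heatSymbol t ξ)) +
      ∫ τ in Ioi t, ∫ ξ, fourierPhase x ξ *
        (derivSymbol j ξ * (derivSymbol k ξ * (derivSymbol l ξ * heatSymbol τ ξ))) := by
  have hc : Continuous (fourierPhase x) :=
    continuous_fourierPhase.comp (by fun_prop : Continuous fun ξ : Rn n => (x, ξ))
  have hint := integrable_phase_mul_derivSymbol j k l ht x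
  rw [oseenKernel_eq, integral_integral_swap hint, ← integral_const_mul, ← integral_add]
  · refine integral_congr_ae (Eventually.of_forall fun ξ => ?_)
    beta_reduce
    rw [integral_const_mul, ← heatSymbol_mul_rieszSymbol_mul, leraySymbol]
    ring
  · refine ((integrable_derivSymbol_mul_heatSymbol l ht).bdd_mul (c := 1)
      hc.aestronglyMeasurable (Eventually.of_forall fun ξ => ?_)).const_mul _
    exact (norm_fourierPhase x ξ).le
  · exact hint.integral_prod_right

theorem integral_Ioi_inv_add_sq {t b : ℝ} (ht : 0 < t) (hb : 0 ≤ b) :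
    IntegrableOn (fun τ => ((τ + b) ^ 2)⁻¹) (Ioi t) ∧
      ∫ τ in Ioi t, ((τ + b) ^ 2)⁻¹ = (t + b)⁻¹ := by
  have hd : ∀ τ ∈ Ici t, HasDerivAt (fun τ => -(τ + b)⁻¹) (((τ + b) ^ 2)⁻¹) τ := by
    intro τ hτ
    have hτ' : τ + b ≠ 0 := by
      have : t ≤ τ := hτ
      linarith
    have h := (((hasDerivAt_id τ).add_const b).inv hτ').neg
    rw [neg_div, neg_neg, one_div] at h
    exact h
  have hl : Tendsto (fun τ : ℝ => -(τ + b)⁻¹) atTop (𝓝 0) := by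
    have h := (tendsto_inv_atTop_zero.comp (tendsto_atTop_add_const_right atTop b tendsto_id)).neg
    simpa using h
  have hp : ∀ τ ∈ Ioi t, 0 ≤ ((τ + b) ^ 2)⁻¹ := fun τ _ => by positivity
  refine ⟨integrableOn_Ioi_deriv_of_nonneg' hd hp hl, ?_⟩
  rw [integral_Ioi_of_hasDerivAt_of_nonneg' hd hp hl]
  simp

/-- The pointwise bound for the kernel of `e^{tΔ} P_{jk} ∂_l`: the kernel of `e^{τΔ} ∂_j ∂_k ∂_l` is
at most a multiple of `(√τ + |x|)^{-(n+3)}`, which is integrated over `τ > t`. -/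
theorem exists_norm_oseenKernel_le {n : ℕ} [NeZero n] (j k l : Fin n) : ∃ C : ℝ, 0 ≤ C ∧
    ∀ t : ℝ, 0 < t → ∀ x, ‖oseenKernel j k l t x‖ ≤ C * weight √t x := by
  obtain ⟨C₁, hC₁, h₁⟩ := exists_norm_integral_phase_le (heatDerivSchwartz l) 1
  obtain ⟨C₃, hC₃, h₃⟩ := exists_norm_integral_phase_le (heatDerivDerivDerivSchwartz j k l) 3
  refine ⟨C₁ + 2 * C₃, by positivity, fun t ht x => ?_⟩
  have hs : 0 < √t := Real.sqrt_pos.2 ht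
  set s := √t + ‖x‖ with hsdef
  have hspos : 0 < s := by positivity
  have b₁ : ‖∫ ξ, fourierPhase x ξ * (derivSymbol l ξ * heatSymbol t ξ)‖ ≤ C₁ * weight √t x := by
    have e : ∀ ξ, fourierPhase x ξ * (derivSymbol l ξ * heatSymbol t ξ) =
        ((√t)⁻¹ : ℝ) * (fourierPhase x ξ * heatDerivSchwartz l (√t • ξ)) := by
      intro ξ
      rw [derivSymbol_mul_heatSymbol l ht]
      ring
    simp only [e]
    rw [integral_const_mul, norm_mul, Complex.norm_real, Real.norm_of_nonneg (by positivity)]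
    refine (mul_le_mul_of_nonneg_left (h₁ _ hs x) (by positivity)).trans (le_of_eq ?_)
    rw [weight, pow_one]
    field_simp
  have b₃ : ∀ τ ∈ Ioi t, ‖∫ ξ, fourierPhase x ξ *
      (derivSymbol j ξ * (derivSymbol k ξ * (derivSymbol l ξ * heatSymbol τ ξ)))‖ ≤
      (C₃ * s ^ 2 * weight √t x) * ((τ + ‖x‖ ^ 2) ^ 2)⁻¹ := by
    intro τ hτ
    have hτ0 : 0 < τ := ht.trans hτ
    have hsτ : 0 < √τ := Real.sqrt_pos.2 hτ0
    have e : ∀ ξ, fourierPhase x ξ *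
        (derivSymbol j ξ * (derivSymbol k ξ * (derivSymbol l ξ * heatSymbol τ ξ))) =
        ((√τ ^ 3)⁻¹ : ℝ) * (fourierPhase x ξ * heatDerivDerivDerivSchwartz j k l (√τ • ξ)) := by
      intro ξ
      rw [derivSymbol_mul_mul_mul_heatSymbol j k l hτ0]
      ring
    simp only [e]
    rw [integral_const_mul, norm_mul, Complex.norm_real, Real.norm_of_nonneg (by positivity)]
    refine (mul_le_mul_of_nonneg_left (h₃ _ hsτ x) (by positivity)).trans ?_
    have hsσ : s ≤ √τ + ‖x‖ := by
      have := Real.sqrt_le_sqrt (le_of_lt hτ)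
      simp only [hsdef]
      linarith
    set σ := √τ + ‖x‖ with hσ
    have hσ0 : 0 < σ := by positivity
    have hσ2 : τ + ‖x‖ ^ 2 ≤ σ ^ 2 := by
      have := Real.sq_sqrt hτ0.le
      nlinarith [mul_nonneg hsτ.le (norm_nonneg x)]
    -- `n - 1` of the factors are estimated at time `t`, and four are kept, so that the integral
    -- over `τ` converges
    have hk : (σ ^ (n + 3))⁻¹ ≤ s ^ 2 * (s ^ (n + 1))⁻¹ * ((τ + ‖x‖ ^ 2) ^ 2)⁻¹ := by
      obtain ⟨m, hm⟩ := Nat.exists_eq_succ_of_ne_zero (NeZero.ne n)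
      have hx0 : 0 < τ + ‖x‖ ^ 2 := by positivity
      have e1 : s ^ 2 * (s ^ (n + 1))⁻¹ = (s ^ m)⁻¹ := by
        rw [hm, show m.succ + 1 = m + 2 by omega, pow_add]
        field_simp
      rw [e1, ← mul_inv]
      refine inv_anti₀ (by positivity) ?_
      calc s ^ m * (τ + ‖x‖ ^ 2) ^ 2 ≤ σ ^ m * (σ ^ 2) ^ 2 := by gcongr
        _ = σ ^ (n + 3) := by rw [hm, Nat.succ_eq_add_one]; ring
    calc (√τ ^ 3)⁻¹ * (C₃ * √τ ^ 3 * (σ ^ (n + 3))⁻¹) = C₃ * (σ ^ (n + 3))⁻¹ := by field_simp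
      _ ≤ C₃ * (s ^ 2 * (s ^ (n + 1))⁻¹ * ((τ + ‖x‖ ^ 2) ^ 2)⁻¹) := by gcongr
      _ = _ := by rw [weight]; ring
  have hI := integral_Ioi_inv_add_sq ht (sq_nonneg ‖x‖)
  have b₄ : ‖∫ τ in Ioi t, ∫ ξ, fourierPhase x ξ *
      (derivSymbol j ξ * (derivSymbol k ξ * (derivSymbol l ξ * heatSymbol τ ξ)))‖ ≤
      2 * C₃ * weight √t x := by
    refine (norm_integral_le_of_norm_le (hI.1.const_mul _)
      ((ae_restrict_iff' measurableSet_Ioi).2 (Eventually.of_forall b₃))).trans ?_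
    rw [integral_const_mul, hI.2, ← div_eq_mul_inv, div_le_iff₀ (by positivity)]
    have hs2 : s ^ 2 ≤ 2 * (t + ‖x‖ ^ 2) := by
      have := Real.sq_sqrt ht.le
      nlinarith [sq_nonneg (√t - ‖x‖)]
    have hw := (weight_pos hs x).le
    calc C₃ * s ^ 2 * weight √t x ≤ C₃ * (2 * (t + ‖x‖ ^ 2)) * weight √t x := by gcongr
      _ = _ := by ring
  rw [oseenKernel_eq_add j k l ht x]
  refine (norm_add_le _ _).trans ?_
  rw [norm_mul, add_mul]
  refine add_le_add (le_trans ?_ b₁) b₄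
  split_ifs <;> simp

/-- The pointwise bound for the kernel of `e^{tΔ} P ∇`, with one constant for all components. -/
theorem exists_enorm_oseenKernel_le (n : ℕ) [NeZero n] : ∃ C : ℝ≥0, ∀ (j k l : Fin n) (t : ℝ),
    0 < t → ∀ x, ‖oseenKernel j k l t x‖ₑ ≤ C * ENNReal.ofReal (weight √t x) := by
  choose C hC h using fun j k l : Fin n => exists_norm_oseenKernel_le j k l
  refine ⟨Real.toNNReal (∑ j, ∑ k, ∑ l, C j k l), fun j k l t ht x => ?_⟩
  have hle : C j k l ≤ ∑ j, ∑ k, ∑ l, C j k l :=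
    calc C j k l ≤ ∑ l, C j k l :=
          Finset.single_le_sum (fun l _ => hC j k l) (Finset.mem_univ l)
      _ ≤ ∑ k, ∑ l, C j k l :=
          Finset.single_le_sum (f := fun k => ∑ l, C j k l)
            (fun k _ => Finset.sum_nonneg fun l _ => hC j k l) (Finset.mem_univ k)
      _ ≤ _ := Finset.single_le_sum (f := fun j => ∑ k, ∑ l, C j k l)
            (fun j _ => Finset.sum_nonneg fun k _ => Finset.sum_nonneg fun l _ => hC j k l)
            (Finset.mem_univ j)
  have hw := (weight_pos (Real.sqrt_pos.2 ht) x).le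
  rw [← ofReal_norm, ← ENNReal.ofReal, ← ENNReal.ofReal_mul ((hC j k l).trans hle)]
  exact ENNReal.ofReal_le_ofReal ((h j k l t ht x).trans (by gcongr))

theorem measurable_oseenKernel {n : ℕ} (j k l : Fin n) :
    Measurable fun p : ℝ × Rn n => oseenKernel j k l p.1 p.2 := by
  simp only [oseenKernel_eq]
  have hd : ∀ i : Fin n, Measurable fun q : (ℝ × Rn n) × Rn n => derivSymbol i q.2 := fun i =>
    (continuous_derivSymbol i).measurable.comp measurable_snd
  have hr : ∀ i : Fin n, Measurable fun q : (ℝ × Rn n) × Rn n => rieszSymbol i q.2 := fun i =>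
    (hd i).div (by fun_prop)
  have hh : Measurable fun q : (ℝ × Rn n) × Rn n => heatSymbol q.1.1 q.2 :=
    continuous_heatSymbol.measurable.comp (g := fun p : ℝ × Rn n => heatSymbol p.1 p.2)
      (f := fun q : (ℝ × Rn n) × Rn n => (q.1.1, q.2)) (by fun_prop)
  have hp : Measurable fun q : (ℝ × Rn n) × Rn n => fourierPhase q.1.2 q.2 :=
    continuous_fourierPhase.measurable.comp (g := fun p : Rn n × Rn n => fourierPhase p.1 p.2)
      (f := fun q : (ℝ × Rn n) × Rn n => (q.1.2, q.2)) (by fun_prop)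
  have hm : Measurable fun q : (ℝ × Rn n) × Rn n => fourierPhase q.1.2 q.2 *
      (heatSymbol q.1.1 q.2 * leraySymbol j k q.2 * derivSymbol l q.2) :=
    hp.mul ((hh.mul (((hr j).mul (hr k)).const_add _)).mul (hd l))
  exact hm.stronglyMeasurable.integral_prod_right'.measurable

/-- The kernel is real because its symbol takes conjugate values at `ξ` and `-ξ`. -/
theorem oseenKernel_im {n : ℕ} (j k l : Fin n) (t : ℝ) (x : Rn n) :
    (oseenKernel j k l t x).im = 0 := by
  rw [← Complex.conj_eq_iff_im, oseenKernel_eq, ← integral_conj, ← integral_neg_eq_self]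
  refine integral_congr_ae (Eventually.of_forall fun ξ => ?_)
  have hp : (starRingEnd ℂ) (fourierPhase x (-ξ)) = fourierPhase x ξ := by
    rw [fourierPhase, fourierPhase, ← Complex.exp_conj, map_mul, Complex.conj_ofReal, Complex.conj_I,
      inner_neg_left]
    push_cast
    ring_nf
  have hd : ∀ i : Fin n, (starRingEnd ℂ) (derivSymbol i (-ξ)) = derivSymbol i ξ := by
    intro i
    rw [derivSymbol, derivSymbol, map_mul, map_mul, map_mul, Complex.conj_I, Complex.conj_ofReal,
      Complex.conj_ofReal, Complex.conj_ofNat, PiLp.neg_apply]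
    push_cast
    ring
  have hh : (starRingEnd ℂ) (heatSymbol t (-ξ)) = heatSymbol t ξ := by
    rw [heatSymbol, Complex.conj_ofReal, norm_neg]
    rfl
  have hr : ∀ i : Fin n, (starRingEnd ℂ) (rieszSymbol i (-ξ)) = rieszSymbol i ξ := by
    intro i
    rw [rieszSymbol, map_div₀, hd, Complex.conj_ofReal, norm_neg]
    rfl
  have hl : (starRingEnd ℂ) (leraySymbol j k (-ξ)) = leraySymbol j k ξ := by
    rw [leraySymbol, map_add, map_mul, hr, hr, leraySymbol]
    split_ifs <;> simp
  simp only [map_mul, hp, hd, hh, hl]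

/-! ### The heat extension of the initial datum -/

theorem exists_heatKernel_le (n : ℕ) : ∃ K : ℝ≥0, ∀ (t : ℝ), 0 < t → ∀ x y : Rn n,
    heatKernel t x y ≤ K * √t * weight √t (x - y) := by
  obtain ⟨K, hK0, hK⟩ := one_add_pow_le_gaussian (n + 1) (c := 1 / 4) (by norm_num)
  refine ⟨⟨K, hK0⟩, fun t ht x y => ?_⟩
  have hs : 0 < √t := Real.sqrt_pos.2 ht
  have h := hK (‖x - y‖ / √t) (by positivity)
  have h1 : (4 * π * t) ^ (-(n : ℝ) / 2) ≤ (√t ^ n)⁻¹ := by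
    have e : (√t ^ n)⁻¹ = t ^ (-(n : ℝ) / 2) := by
      rw [Real.sqrt_eq_rpow, ← Real.rpow_natCast, ← Real.rpow_mul ht.le, ← Real.rpow_neg ht.le]
      congr 1
      ring
    rw [e]
    refine Real.rpow_le_rpow_of_nonpos ht ?_ ?_
    · nlinarith [Real.pi_gt_three]
    · have : (0 : ℝ) ≤ n := Nat.cast_nonneg n
      linarith
  have h2 : 1 / 4 * (‖x - y‖ / √t) ^ 2 = ‖x - y‖ ^ 2 / (4 * t) := by
    rw [div_pow, Real.sq_sqrt ht.le]
    field_simp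
  have h3 : 1 + ‖x - y‖ / √t = (√t + ‖x - y‖) / √t := by field_simp
  rw [h2, h3, div_pow, div_mul_eq_mul_div, div_le_iff₀ (by positivity)] at h
  have hpos : 0 < √t + ‖x - y‖ := by positivity
  have h4 : Real.exp (-(‖x - y‖ ^ 2 / (4 * t))) ≤ K * √t ^ (n + 1) * weight √t (x - y) := by
    rw [weight, ← div_eq_mul_inv, le_div_iff₀ (by positivity), mul_comm]
    exact h
  calc heatKernel t x y ≤ (√t ^ n)⁻¹ * (K * √t ^ (n + 1) * weight √t (x - y)) := by
        unfold heatKernel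
        gcongr
    _ = K * √t * weight √t (x - y) := by
        rw [pow_succ]
        field_simp

theorem lintegral_heatKernel {n : ℕ} {t : ℝ} (ht : 0 < t) (x : Rn n) :
    ∫⁻ y, ENNReal.ofReal (heatKernel t x y) = 1 := by
  obtain ⟨h1, h2⟩ := integral_heatKernel ht x
  rw [← ofReal_integral_eq_lintegral_ofReal h1
    (Eventually.of_forall fun y => heatKernel_nonneg ht x y), h2, ENNReal.ofReal_one]

theorem measurable_ofReal_heatKernel {n : ℕ} (t : ℝ) (x : Rn n) :
    Measurable fun y => ENNReal.ofReal (heatKernel t x y) :=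
  ENNReal.measurable_ofReal.comp
    (measurable_heatKernel.comp (f := fun y : Rn n => ((t, x), y)) (by fun_prop))

/-- The Cauchy–Schwarz inequality for the average against the heat kernel. -/
theorem enorm_heatExt_sq_le {n : ℕ} (f : 𝓢'(Rn n, ℂ)) {s t : ℝ} (hs : 0 < s) (ht : 0 < t)
    (x : Rn n) : ‖heatExt f (s + t) x‖ₑ ^ 2 ≤
      ∫⁻ y, ENNReal.ofReal (heatKernel s x y) * ‖heatExt f t y‖ₑ ^ 2 := by
  set G : Rn n → ℝ≥0∞ := fun y => ENNReal.ofReal (heatKernel s x y) with hG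
  set U : Rn n → ℝ≥0∞ := fun y => ‖heatExt f t y‖ₑ with hU
  have hGm : Measurable G := measurable_ofReal_heatKernel s x
  have hUm : Measurable U := (continuous_heatExt f t).measurable.enorm
  have h1 : ‖heatExt f (s + t) x‖ₑ ≤ ∫⁻ y, G y * U y := by
    rw [(heatExt_add f hs ht x).2]
    refine (enorm_integral_le_lintegral_enorm _).trans (le_of_eq (lintegral_congr fun y => ?_))
    rw [enorm_mul, ← ofReal_norm, Complex.norm_real,
      Real.norm_of_nonneg (heatKernel_nonneg hs x y)]
  have hsq : ∀ a : ℝ≥0∞, a ^ (1 / 2 : ℝ) * a ^ (1 / 2 : ℝ) = a := fun a => by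
    rw [← ENNReal.rpow_add_of_nonneg _ _ (by norm_num) (by norm_num)]
    norm_num
  have h2 := ENNReal.lintegral_mul_le_Lp_mul_Lq volume Real.HolderConjugate.two_two
    (f := fun y => G y ^ (1 / 2 : ℝ)) (g := fun y => G y ^ (1 / 2 : ℝ) * U y)
    (hGm.pow_const _).aemeasurable ((hGm.pow_const _).mul hUm).aemeasurable
  have e1 : ∀ y, (G y ^ (1 / 2 : ℝ)) ^ (2 : ℝ) = G y := fun y => by
    rw [← ENNReal.rpow_mul]
    norm_num
  have e2 : ∀ y, (G y ^ (1 / 2 : ℝ) * U y) ^ (2 : ℝ) = G y * U y ^ 2 := fun y => by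
    rw [ENNReal.mul_rpow_of_nonneg _ _ (by norm_num), e1, ENNReal.rpow_two]
  have e3 : ∀ y, ((fun y => G y ^ (1 / 2 : ℝ)) * fun y => G y ^ (1 / 2 : ℝ) * U y) y
      = G y * U y := fun y => by
    change G y ^ (1 / 2 : ℝ) * (G y ^ (1 / 2 : ℝ) * U y) = _
    rw [← mul_assoc, hsq]
  simp only [e1, e2, e3] at h2
  rw [show ∫⁻ y, G y = 1 from lintegral_heatKernel hs x, ENNReal.one_rpow, one_mul] at h2
  calc ‖heatExt f (s + t) x‖ₑ ^ 2 ≤ ((∫⁻ y, G y * U y ^ 2) ^ (1 / 2 : ℝ)) ^ 2 := by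
        gcongr
        exact h1.trans h2
    _ = _ := by rw [sq, hsq]

/-- A Carleson bound at scale `r` on the heat extension gives a pointwise bound at time `2r²`. -/
theorem exists_enorm_heatExt_sq_le (n : ℕ) [NeZero n] {α : ℝ} (hα : 0 < α) : ∃ C : ℝ≥0,
    ∀ (f : 𝓢'(Rn n, ℂ)) (r : ℝ), 0 < r → ∀ A : ℝ≥0∞,
      (∀ z, carleson α (heatExt f) z r ≤ A) → ∀ x,
        ‖heatExt f (2 * r ^ 2) x‖ₑ ^ 2 ≤ C * A * ENNReal.ofReal ((r ^ 2)⁻¹) := by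
  obtain ⟨K, hK⟩ := exists_heatKernel_le n
  obtain ⟨C, hC⟩ := exists_lintegral_weight_mul_rpow_le n α
  refine ⟨2 * K * C, fun f r hr A hA x => ?_⟩
  have hUm : Measurable (Function.uncurry fun (s : ℝ) (y : Rn n) => ‖heatExt f s y‖ₑ ^ 2) :=
    (measurable_uncurry_heatExt f).enorm.pow_const 2
  have h := hC _ hUm r r hr le_rfl A (fun z => hA z) x
  -- `heatExt f (2 * r ^ 2)` is a Gaussian average of `heatExt f s` for every `s < r ^ 2`, at a
  -- scale comparable to `r`; these bounds are then averaged over `s`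
  set J : ℝ → ℝ≥0∞ := fun s => ∫⁻ y, ENNReal.ofReal (weight r (x - y)) *
    (‖heatExt f s y‖ₑ ^ 2 * ENNReal.ofReal (s ^ (-α))) with hJ
  have hs : ∀ s ∈ Ioo 0 (r ^ 2), ‖heatExt f (2 * r ^ 2) x‖ₑ ^ 2 ≤
      ENNReal.ofReal (K * (2 * r) * r ^ (2 * α)) * J s := by
    intro s hs
    have hτ : 0 < 2 * r ^ 2 - s := by nlinarith [hs.2]
    have h1 := enorm_heatExt_sq_le f hτ hs.1 x
    rw [sub_add_cancel] at h1
    refine h1.trans ?_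
    rw [hJ, ← lintegral_const_mul' _ _ ENNReal.ofReal_ne_top]
    refine lintegral_mono fun y => ?_
    have hr1 : r ≤ √(2 * r ^ 2 - s) := Real.le_sqrt_of_sq_le (by linarith [hs.2])
    have hr2 : √(2 * r ^ 2 - s) ≤ 2 * r :=
      (Real.sqrt_le_left (by positivity)).2 (by nlinarith [hs.1])
    have hw : weight √(2 * r ^ 2 - s) (x - y) ≤ weight r (x - y) := by
      have := weight_le_mul_weight (Real.sqrt_pos.2 hτ) hr (c := 1) (z := x - y) (w := x - y)
        (by linarith)
      rwa [one_pow, one_mul] at this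
    have hG : heatKernel (2 * r ^ 2 - s) x y ≤ K * (2 * r) * weight r (x - y) := by
      refine (hK _ hτ x y).trans ?_
      have := (weight_pos (Real.sqrt_pos.2 hτ) (x - y)).le
      gcongr
    have hα1 : 1 ≤ r ^ (2 * α) * s ^ (-α) := by
      have e : r ^ (2 * α) = (r ^ 2) ^ α := by
        rw [Real.rpow_mul hr.le, Real.rpow_two]
      rw [e, Real.rpow_neg hs.1.le, ← div_eq_mul_inv, one_le_div (Real.rpow_pos_of_pos hs.1 _)]
      exact Real.rpow_le_rpow hs.1.le hs.2.le hα.le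
    have hw0 := (weight_pos hr (x - y)).le
    have hs0 : 0 ≤ s ^ (-α) := Real.rpow_nonneg hs.1.le _
    calc ENNReal.ofReal (heatKernel (2 * r ^ 2 - s) x y) * ‖heatExt f s y‖ₑ ^ 2
        ≤ ENNReal.ofReal (K * (2 * r) * weight r (x - y) * (r ^ (2 * α) * s ^ (-α))) *
            ‖heatExt f s y‖ₑ ^ 2 := by
          gcongr
          exact hG.trans (le_mul_of_one_le_right (by positivity) hα1)
      _ = _ := by
          rw [show K * (2 * r) * weight r (x - y) * (r ^ (2 * α) * s ^ (-α)) =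
            (K * (2 * r) * r ^ (2 * α)) * (weight r (x - y) * s ^ (-α)) by ring,
            ENNReal.ofReal_mul (p := K * (2 * r) * r ^ (2 * α)) (by positivity),
            ENNReal.ofReal_mul hw0]
          ring
  have hI : ‖heatExt f (2 * r ^ 2) x‖ₑ ^ 2 * ENNReal.ofReal (r ^ 2) ≤
      ENNReal.ofReal (K * (2 * r) * r ^ (2 * α)) *
        (C * A * ENNReal.ofReal (r ^ (-(2 * α)) * r⁻¹)) := by
    calc ‖heatExt f (2 * r ^ 2) x‖ₑ ^ 2 * ENNReal.ofReal (r ^ 2)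
        = ∫⁻ _ in Ioo 0 (r ^ 2), ‖heatExt f (2 * r ^ 2) x‖ₑ ^ 2 := by
          rw [setLIntegral_const, Real.volume_Ioo, sub_zero]
      _ ≤ ∫⁻ s in Ioo 0 (r ^ 2), ENNReal.ofReal (K * (2 * r) * r ^ (2 * α)) * J s :=
          setLIntegral_mono' measurableSet_Ioo hs
      _ = ENNReal.ofReal (K * (2 * r) * r ^ (2 * α)) * ∫⁻ s in Ioo 0 (r ^ 2), J s :=
          lintegral_const_mul' _ _ ENNReal.ofReal_ne_top
      _ ≤ _ := by gcongr
  have hcancel : ENNReal.ofReal (r ^ 2) * ENNReal.ofReal ((r ^ 2)⁻¹) = 1 := by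
    rw [← ENNReal.ofReal_mul (by positivity), mul_inv_cancel₀ (by positivity), ENNReal.ofReal_one]
  calc ‖heatExt f (2 * r ^ 2) x‖ₑ ^ 2
      = ‖heatExt f (2 * r ^ 2) x‖ₑ ^ 2 * ENNReal.ofReal (r ^ 2) * ENNReal.ofReal ((r ^ 2)⁻¹) := by
        rw [mul_assoc, hcancel, mul_one]
    _ ≤ ENNReal.ofReal (K * (2 * r) * r ^ (2 * α)) *
        (C * A * ENNReal.ofReal (r ^ (-(2 * α)) * r⁻¹)) * ENNReal.ofReal ((r ^ 2)⁻¹) := by gcongr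
    _ = ENNReal.ofReal (K * (2 * r) * r ^ (2 * α) * (r ^ (-(2 * α)) * r⁻¹)) *
        (C * A) * ENNReal.ofReal ((r ^ 2)⁻¹) := by
        rw [ENNReal.ofReal_mul (p := K * (2 * r) * r ^ (2 * α)) (by positivity)]
        ring
    _ = _ := by
        have e : K * (2 * r) * r ^ (2 * α) * (r ^ (-(2 * α)) * r⁻¹) = ((2 * K : ℝ≥0) : ℝ) := by
          rw [Real.rpow_neg hr.le]
          have : r ^ (2 * α) ≠ 0 := (Real.rpow_pos_of_pos hr _).ne'
          push_cast
          field_simp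
        rw [e, ENNReal.ofReal_coe_nnreal]
        push_cast
        ring

theorem rpow_half_sq (a : ℝ≥0∞) : (a ^ (1 / 2 : ℝ)) ^ 2 = a := by
  rw [← ENNReal.rpow_two, ← ENNReal.rpow_mul]
  norm_num

theorem carleson_le_qNorm_sq {n : ℕ} {α : ℝ} {T : ℝ≥0∞} (f : 𝓢'(Rn n, ℂ)) (x : Rn n) {r : ℝ}
    (hr : 0 < r) (hrT : ENNReal.ofReal r < T) :
    carleson α (heatExt f) x r ≤ qNorm α T f ^ 2 := by
  rw [← rpow_half_sq (carleson α (heatExt f) x r)]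
  gcongr
  refine le_iSup₂_of_le x r (le_iSup_of_le hr ?_)
  exact le_iSup (fun _ : ENNReal.ofReal r < T => carleson α (heatExt f) x r ^ (1 / 2 : ℝ)) hrT

theorem le_mul_of_sq_le {C : ℝ≥0} {a b : ℝ≥0∞} (h : a ^ 2 ≤ C * b ^ 2) :
    a ≤ (NNReal.sqrt C : ℝ≥0) * b := by
  rw [← ENNReal.pow_le_pow_left_iff two_ne_zero, mul_pow, ← ENNReal.coe_pow, NNReal.sq_sqrt]
  exact h

/-- The heat extension maps `Q⁻¹_{α;S}` to `X_{α;T}` if `T ≤ S²`. -/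
theorem exists_xNorm_heatExt_le (n : ℕ) [NeZero n] {α : ℝ} (hα : 0 < α) : ∃ C : ℝ≥0,
    ∀ (S T : ℝ≥0∞), (∀ r : ℝ, 0 < r → ENNReal.ofReal (r ^ 2) < T → ENNReal.ofReal r < S) →
      ∀ f : 𝓢'(Rn n, ℂ), xNorm α T (heatExt f) ≤ C * qNorm α S f := by
  obtain ⟨C, hC⟩ := exists_enorm_heatExt_sq_le n hα
  refine ⟨NNReal.sqrt (2 * C) + 1, fun S T hST f => ?_⟩
  rw [ENNReal.coe_add, add_mul, ENNReal.coe_one, one_mul]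
  refine xNorm_le (fun t ht => Eventually.of_forall fun y => le_mul_of_sq_le ?_)
    fun x r hr hrT => ?_
  · set r := √(t / 2) with hr
    have hr0 : 0 < r := Real.sqrt_pos.2 (half_pos ht.1)
    have hr2 : r ^ 2 = t / 2 := Real.sq_sqrt (half_pos ht.1).le
    have hrS : ENNReal.ofReal r < S := by
      refine hST r hr0 (lt_of_le_of_lt (ENNReal.ofReal_le_ofReal ?_) ht.2)
      rw [hr2]
      linarith [ht.1]
    have h := hC f r hr0 _ (fun z => carleson_le_qNorm_sq f z hr0 hrS) y
    rw [show 2 * r ^ 2 = t by rw [hr2]; ring] at h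
    rw [mul_pow, ← ENNReal.ofReal_pow (Real.sqrt_nonneg t), Real.sq_sqrt ht.1.le]
    calc ENNReal.ofReal t * ‖heatExt f t y‖ₑ ^ 2
        ≤ ENNReal.ofReal t * (C * qNorm α S f ^ 2 * ENNReal.ofReal ((r ^ 2)⁻¹)) := by gcongr
      _ = ENNReal.ofReal (t * (r ^ 2)⁻¹) * (C * qNorm α S f ^ 2) := by
          rw [ENNReal.ofReal_mul ht.1.le]
          ring
      _ = _ := by
          have e : t * (r ^ 2)⁻¹ = 2 := by
            rw [hr2]
            field_simp [ht.1.ne']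
          rw [e, ENNReal.coe_mul, ← mul_assoc]
          norm_num
  · have h := carleson_le_qNorm_sq (α := α) f x hr (hST r hr hrT)
    calc carleson α (heatExt f) x r ^ (1 / 2 : ℝ) ≤ (qNorm α S f ^ 2) ^ (1 / 2 : ℝ) := by gcongr
      _ = _ := by
          rw [← ENNReal.rpow_two, ← ENNReal.rpow_mul]
          norm_num

/-- The maximum principle: the supremum of the heat extension does not increase in time. -/
theorem enorm_heatExt_sq_le_of_forall_le {n : ℕ} (f : 𝓢'(Rn n, ℂ)) {t₀ t : ℝ} (ht₀ : 0 < t₀)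
    (ht : t₀ < t) {M : ℝ≥0∞} (hM : ∀ x, ‖heatExt f t₀ x‖ₑ ^ 2 ≤ M) (x : Rn n) :
    ‖heatExt f t x‖ₑ ^ 2 ≤ M := by
  have h := enorm_heatExt_sq_le f (sub_pos.2 ht) ht₀ x
  rw [sub_add_cancel] at h
  calc ‖heatExt f t x‖ₑ ^ 2
      ≤ ∫⁻ y, ENNReal.ofReal (heatKernel (t - t₀) x y) * M := by
        refine h.trans (lintegral_mono fun y => ?_)
        gcongr
        exact hM y
    _ = M := by
        rw [lintegral_mul_const _ (measurable_ofReal_heatKernel _ _),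
          lintegral_heatKernel (sub_pos.2 ht), one_mul]

/-- The norms of `Q⁻¹_{α;S}` and `Q⁻¹_{α;T}` are equivalent for finite `S` and `T`: beyond scale
`ρ < T`, times before `ρ²` are handled by averaging over balls of radius `ρ`, and times after `ρ²`
by the maximum principle for the heat equation. -/
theorem exists_qNorm_le_mul_qNorm (n : ℕ) [NeZero n] {α : ℝ} (hα : 0 < α) (S T : ℝ≥0)
    (hT : 0 < T) : ∃ C : ℝ≥0, ∀ f : 𝓢'(Rn n, ℂ), qNorm α S f ≤ C * qNorm α T f := by
  obtain ⟨C₁, h₁⟩ := exists_enorm_heatExt_sq_le n hα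
  obtain ⟨C₂, h₂⟩ := exists_lintegral_weight_mul_rpow_le n α
  set ρ : ℝ := T / 2 with hρ
  have hρ0 : 0 < ρ := half_pos (by exact_mod_cast hT)
  have hρT : ENNReal.ofReal ρ < T := by
    rw [ENNReal.ofReal_lt_iff_lt_toReal hρ0.le ENNReal.coe_ne_top, ENNReal.coe_toReal]
    exact half_lt_self (by exact_mod_cast hT)
  set V := volume (Metric.ball (0 : Rn n) 1) with hV
  have hVtop : V ≠ ⊤ := measure_ball_lt_top.ne
  set c₂ : ℝ := 2 ^ (n + 1) * (S : ℝ) ^ (2 * α) * ρ ^ (-(2 * α)) with hc₂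
  set c₁ : ℝ := ((ρ / 2) ^ 2)⁻¹ * (ρ ^ 2) ^ (-α) * ((S : ℝ) ^ (2 * α) * (S : ℝ) ^ 2) with hc₁
  have hc₂0 : 0 ≤ c₂ := by positivity
  have hc₁0 : 0 ≤ c₁ := by positivity
  refine ⟨NNReal.sqrt (1 + (c₂.toNNReal * C₂ + c₁.toNNReal * (C₁ * V.toNNReal))), fun f => ?_⟩
  set A := qNorm α T f ^ 2 with hA
  refine iSup₂_le fun x r => iSup₂_le fun hr hrS => le_mul_of_sq_le ?_
  rw [rpow_half_sq]
  rcases lt_or_ge r ρ with hrρ | hρr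
  · refine (carleson_le_qNorm_sq f x hr
      ((ENNReal.ofReal_le_ofReal hrρ.le).trans_lt hρT)).trans (le_mul_of_one_le_left' ?_)
    exact_mod_cast le_self_add
  have hrS' : r ≤ S := by
    rw [ENNReal.ofReal_lt_iff_lt_toReal hr.le ENNReal.coe_ne_top, ENNReal.coe_toReal] at hrS
    exact hrS.le
  have hUm : Measurable (Function.uncurry fun (s : ℝ) (y : Rn n) => ‖heatExt f s y‖ₑ ^ 2) :=
    (measurable_uncurry_heatExt f).enorm.pow_const 2
  set I : ℝ → ℝ≥0∞ := fun t => ∫⁻ y in Metric.ball x r,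
    ‖heatExt f t y‖ₑ ^ 2 * ENNReal.ofReal (t ^ (-α)) with hI
  have hrpow : r ^ (2 * α) ≤ (S : ℝ) ^ (2 * α) := by gcongr
  have hrn : r ^ (2 * α - n) = r ^ (2 * α) * (r ^ n)⁻¹ := by
    rw [Real.rpow_sub hr, Real.rpow_natCast, div_eq_mul_inv]
  have early : ENNReal.ofReal (r ^ (2 * α - n)) * ∫⁻ t in Ioo 0 (ρ ^ 2), I t ≤
      ENNReal.ofReal c₂ * C₂ * A := by
    -- on the ball of radius `r` the weight of scale `r` is at least `(2 * r) ^ (-(n + 1))`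
    have hball : ∀ t, I t ≤ ENNReal.ofReal ((2 * r) ^ (n + 1)) * ∫⁻ y,
        ENNReal.ofReal (weight r (x - y)) * (‖heatExt f t y‖ₑ ^ 2 * ENNReal.ofReal (t ^ (-α))) := by
      intro t
      rw [← lintegral_const_mul' _ _ ENNReal.ofReal_ne_top]
      refine (setLIntegral_mono' measurableSet_ball fun y hy => ?_).trans
        (setLIntegral_le_lintegral _ _)
      rw [← mul_assoc, ← ENNReal.ofReal_mul (by positivity)]
      refine le_mul_of_one_le_left' ?_
      rw [← ENNReal.ofReal_one]
      refine ENNReal.ofReal_le_ofReal ?_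
      have hxy : ‖x - y‖ < r := by rwa [mem_ball_iff_norm'] at hy
      rw [weight, ← div_eq_mul_inv, one_le_div (by positivity)]
      gcongr
      linarith
    calc ENNReal.ofReal (r ^ (2 * α - n)) * ∫⁻ t in Ioo 0 (ρ ^ 2), I t
        ≤ ENNReal.ofReal (r ^ (2 * α - n)) * (ENNReal.ofReal ((2 * r) ^ (n + 1)) *
            (C₂ * A * ENNReal.ofReal (ρ ^ (-(2 * α)) * r⁻¹))) := by
          gcongr
          refine (lintegral_mono fun t => hball t).trans ?_
          rw [lintegral_const_mul' _ _ ENNReal.ofReal_ne_top]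
          gcongr
          exact h₂ _ hUm ρ r hρ0 hρr A (fun z => carleson_le_qNorm_sq f z hρ0 hρT) x
      _ = ENNReal.ofReal (r ^ (2 * α - n) * (2 * r) ^ (n + 1) * (ρ ^ (-(2 * α)) * r⁻¹)) *
            C₂ * A := by
          rw [ENNReal.ofReal_mul (p := r ^ (2 * α - n) * (2 * r) ^ (n + 1)) (by positivity),
            ENNReal.ofReal_mul (p := r ^ (2 * α - n)) (by positivity)]
          ring
      _ ≤ _ := by
          gcongr
          rw [hrn, hc₂]
          calc r ^ (2 * α) * (r ^ n)⁻¹ * (2 * r) ^ (n + 1) * (ρ ^ (-(2 * α)) * r⁻¹)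
              = 2 ^ (n + 1) * r ^ (2 * α) * ρ ^ (-(2 * α)) := by
                rw [mul_pow, pow_succ r n]
                field_simp
            _ ≤ _ := by gcongr
  have late : ENNReal.ofReal (r ^ (2 * α - n)) * ∫⁻ t in Ico (ρ ^ 2) (r ^ 2), I t ≤
      ENNReal.ofReal c₁ * (C₁ * V) * A := by
    set M : ℝ≥0∞ := C₁ * A * ENNReal.ofReal (((ρ / 2) ^ 2)⁻¹) with hM
    have hsup : ∀ t, ρ ^ 2 ≤ t → ∀ y, ‖heatExt f t y‖ₑ ^ 2 ≤ M := fun t ht y =>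
      enorm_heatExt_sq_le_of_forall_le f (t₀ := 2 * (ρ / 2) ^ 2) (by positivity)
        (by nlinarith [sq_pos_of_pos hρ0])
        (h₁ f (ρ / 2) (by positivity) A fun z => carleson_le_qNorm_sq f z (by positivity)
          ((ENNReal.ofReal_le_ofReal (by linarith)).trans_lt hρT)) y
    have hIt : ∀ t ∈ Ico (ρ ^ 2) (r ^ 2),
        I t ≤ M * ENNReal.ofReal ((ρ ^ 2) ^ (-α)) * volume (Metric.ball x r) := by
      intro t ht
      rw [← setLIntegral_const]
      refine lintegral_mono fun y => mul_le_mul' (hsup t ht.1 y) (ENNReal.ofReal_le_ofReal ?_)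
      exact Real.rpow_le_rpow_of_nonpos (by positivity) ht.1 (by linarith)
    calc ENNReal.ofReal (r ^ (2 * α - n)) * ∫⁻ t in Ico (ρ ^ 2) (r ^ 2), I t
        ≤ ENNReal.ofReal (r ^ (2 * α - n)) *
            (M * ENNReal.ofReal ((ρ ^ 2) ^ (-α)) * volume (Metric.ball x r) *
              ENNReal.ofReal (r ^ 2)) := by
          gcongr
          refine (setLIntegral_mono' measurableSet_Ico hIt).trans ?_
          rw [setLIntegral_const, Real.volume_Ico]
          gcongr
          nlinarith [sq_pos_of_pos hρ0]
      _ = ENNReal.ofReal (((ρ / 2) ^ 2)⁻¹ * (ρ ^ 2) ^ (-α) *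
            (r ^ (2 * α - n) * (r ^ n * r ^ 2))) * (C₁ * V) * A := by
          rw [volume_ball_eq x hr.le, ENNReal.ofReal_mul (p := ((ρ / 2) ^ 2)⁻¹ * (ρ ^ 2) ^ (-α))
            (by positivity), ENNReal.ofReal_mul (p := ((ρ / 2) ^ 2)⁻¹) (by positivity),
            ENNReal.ofReal_mul (p := r ^ (2 * α - n)) (by positivity),
            ENNReal.ofReal_mul (p := r ^ n) (by positivity)]
          ring
      _ ≤ _ := by
          gcongr
          rw [hrn, hc₁]
          have e : r ^ (2 * α) * (r ^ n)⁻¹ * (r ^ n * r ^ 2) = r ^ (2 * α) * r ^ 2 := by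
            field_simp
          rw [e]
          gcongr
  have hsplit : carleson α (heatExt f) x r ≤ ENNReal.ofReal (r ^ (2 * α - n)) *
      ((∫⁻ t in Ioo 0 (ρ ^ 2), I t) + ∫⁻ t in Ico (ρ ^ 2) (r ^ 2), I t) := by
    refine mul_le_mul_right ((lintegral_mono_set fun t ht => ?_).trans
      (lintegral_union_le _ _ _)) _
    exact (lt_or_ge t (ρ ^ 2)).imp (fun h => ⟨ht.1, h⟩) fun h => ⟨h, ht.2⟩
  calc carleson α (heatExt f) x r
      ≤ ENNReal.ofReal c₂ * C₂ * A + ENNReal.ofReal c₁ * (C₁ * V) * A := by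
        refine hsplit.trans ?_
        rw [mul_add]
        exact add_le_add early late
    _ ≤ _ := by
        rw [← add_mul, ENNReal.coe_add, ENNReal.coe_add, ENNReal.coe_mul, ENNReal.coe_mul,
          ENNReal.coe_mul, ENNReal.coe_toNNReal hVtop]
        exact mul_le_mul' le_add_self le_rfl

/-! ### Limits and sums in `X_{α;T}` -/

theorem xNorm_le_xNormVec {n : ℕ} {α : ℝ} {T : ℝ≥0∞} (u : Fin n → ℝ → Rn n → ℂ) (j : Fin n) :
    xNorm α T (u j) ≤ xNormVec α T u :=
  Finset.single_le_sum (f := fun j => xNorm α T (u j)) (fun _ _ => zero_le) (Finset.mem_univ j)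

theorem xNormVec_le {n : ℕ} {α : ℝ} {T : ℝ≥0∞} {u : Fin n → ℝ → Rn n → ℂ} {A : ℝ≥0∞}
    (h : ∀ j, xNorm α T (u j) ≤ A) : xNormVec α T u ≤ n * A := by
  refine (Finset.sum_le_sum fun j _ => h j).trans (le_of_eq ?_)
  simp

theorem rpow_half_le {a b : ℝ≥0∞} (h : a ≤ b ^ 2) : a ^ (1 / 2 : ℝ) ≤ b := by
  rw [← ENNReal.pow_le_pow_left_iff two_ne_zero, rpow_half_sq]
  exact h

theorem carleson_le_xNorm_sq {n : ℕ} {α : ℝ} {T : ℝ≥0∞} (g : ℝ → Rn n → ℂ) (x : Rn n) {r : ℝ}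
    (hr : 0 < r) (hrT : ENNReal.ofReal (r ^ 2) < T) : carleson α g x r ≤ xNorm α T g ^ 2 := by
  rw [← rpow_half_sq (carleson α g x r)]
  gcongr
  exact carleson_rpow_le_xNorm g x hr hrT

theorem carlesonMass_mono {n : ℕ} {α : ℝ} {T : ℝ≥0∞} {F G : ℝ → Rn n → ℝ≥0∞}
    (h : ∀ t ∈ timeSet T, ∀ᵐ y, F t y ≤ G t y) (x : Rn n) {r : ℝ}
    (hrT : ENNReal.ofReal (r ^ 2) < T) : carlesonMass α F x r ≤ carlesonMass α G x r := by
  refine mul_le_mul_right ?_ _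
  refine setLIntegral_mono' measurableSet_Ioo fun t ht => lintegral_mono_ae ?_
  filter_upwards [ae_restrict_of_ae (h t (Ioo_subset_timeSet hrT.le ht))] with y hy
  gcongr

/-- A triangle inequality in `X_{α;T}`; the constant is not optimal. -/
theorem xNorm_le_of_enorm_le_add {n : ℕ} {α : ℝ} {T : ℝ≥0∞} {g g₁ g₂ : ℝ → Rn n → ℂ}
    (h₁ : MemX α T g₁) (h₂ : MemX α T g₂)
    (h : ∀ t ∈ timeSet T, ∀ᵐ y, ‖g t y‖ₑ ≤ ‖g₁ t y‖ₑ + ‖g₂ t y‖ₑ) :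
    xNorm α T g ≤ 3 * (xNorm α T g₁ + xNorm α T g₂) := by
  set N := xNorm α T g₁ + xNorm α T g₂ with hN
  have e : 3 * N = N + 2 * N := by ring
  rw [e]
  refine xNorm_le (fun t ht => ?_) fun x r hr hrT => rpow_half_le ?_
  · filter_upwards [h t ht, ae_mul_enorm_le_xNorm (α := α) g₁ ht,
      ae_mul_enorm_le_xNorm (α := α) g₂ ht] with y hy h1 h2
    calc ENNReal.ofReal √t * ‖g t y‖ₑ ≤ ENNReal.ofReal √t * (‖g₁ t y‖ₑ + ‖g₂ t y‖ₑ) := by gcongr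
      _ ≤ N := by
        rw [mul_add]
        exact add_le_add h1 h2
  · have s₁ := isSource_mul h₁ h₁
    have s₂ := isSource_mul h₂ h₂
    have s := ((s₁.add s₂).add (s₁.add s₂)).carlesonMass_le x r hr hrT
    rw [carleson_eq_carlesonMass]
    refine (carlesonMass_mono (T := T) (fun t ht => ?_) x hrT).trans (s.trans ?_)
    · filter_upwards [h t ht] with y hy
      refine (pow_le_pow_left' hy 2).trans ?_
      change _ ≤ ‖g₁ t y‖ₑ * ‖g₁ t y‖ₑ + ‖g₂ t y‖ₑ * ‖g₂ t y‖ₑ +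
        (‖g₁ t y‖ₑ * ‖g₁ t y‖ₑ + ‖g₂ t y‖ₑ * ‖g₂ t y‖ₑ)
      simp only [enorm_eq_nnnorm]
      norm_cast
      rw [← NNReal.coe_le_coe]
      push_cast
      nlinarith [sq_nonneg (‖g₁ t y‖ - ‖g₂ t y‖)]
    · have e2 : (2 * N) ^ 2 = xNorm α T g₁ * xNorm α T g₁ + xNorm α T g₂ * xNorm α T g₂ +
        (xNorm α T g₁ * xNorm α T g₁ + xNorm α T g₂ * xNorm α T g₂) +
        (2 * xNorm α T g₁ ^ 2 + 2 * xNorm α T g₂ ^ 2 + 8 * xNorm α T g₁ * xNorm α T g₂) := by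
        rw [hN]
        ring
      rw [e2]
      exact le_self_add

theorem MemX.sub {n : ℕ} {α : ℝ} {T : ℝ≥0∞} {g h : ℝ → Rn n → ℂ} (hg : MemX α T g)
    (hh : MemX α T h) : MemX α T (fun t y => g t y - h t y) where
  aestronglyMeasurable := hg.aestronglyMeasurable.sub hh.aestronglyMeasurable
  slice t ht htT := (hg.slice t ht htT).sub (hh.slice t ht htT)
  norm_lt_top := (xNorm_le_of_enorm_le_add hg hh fun t _ => Eventually.of_forall fun y =>
    enorm_sub_le).trans_lt (ENNReal.mul_lt_top (by norm_num)
      (ENNReal.add_lt_top.2 ⟨hg.norm_lt_top, hh.norm_lt_top⟩))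

/-- Lower semicontinuity of the norm of `X_{α;T}` under pointwise convergence, by Fatou's lemma;
the constant is not optimal. -/
theorem xNorm_le_of_tendsto {n : ℕ} {α : ℝ} {T : ℝ≥0∞} {g : ℕ → ℝ → Rn n → ℂ}
    {g' : ℝ → Rn n → ℂ} (hm : ∀ m, Measurable (Function.uncurry (g m))) {A : ℝ≥0∞}
    (hA : ∀ m, xNorm α T (g m) ≤ A)
    (hlim : ∀ t ∈ timeSet T, ∀ y, Tendsto (fun m => g m t y) atTop (𝓝 (g' t y))) :
    xNorm α T g' ≤ 2 * A := by
  rw [two_mul]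
  refine xNorm_le (fun t ht => ?_) fun x r hr hrT => rpow_half_le ?_
  · have h := fun m => ae_mul_enorm_le_xNorm (α := α) (g m) ht
    filter_upwards [ae_all_iff.2 h] with y hy
    refine le_of_tendsto (ENNReal.Tendsto.const_mul (hlim t ht y).enorm
      (Or.inr ENNReal.ofReal_ne_top)) (Eventually.of_forall fun m => (hy m).trans (hA m))
  · have hFm : ∀ m, Measurable fun p : ℝ × Rn n =>
        ‖g m p.1 p.2‖ₑ ^ 2 * ENNReal.ofReal (p.1 ^ (-α)) := fun m =>
      ((hm m).enorm.pow_const 2).mul (by fun_prop)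
    have hpt : ∀ t ∈ Ioo 0 (r ^ 2), ∀ y, ‖g' t y‖ₑ ^ 2 * ENNReal.ofReal (t ^ (-α)) =
        liminf (fun m => ‖g m t y‖ₑ ^ 2 * ENNReal.ofReal (t ^ (-α))) atTop := by
      intro t ht y
      have h1 := (hlim t (Ioo_subset_timeSet hrT.le ht) y).enorm
      have h2 : Tendsto (fun m => ‖g m t y‖ₑ ^ 2) atTop (𝓝 (‖g' t y‖ₑ ^ 2)) :=
        ENNReal.Tendsto.pow h1
      have h3 : Tendsto (fun m => ‖g m t y‖ₑ ^ 2 * ENNReal.ofReal (t ^ (-α))) atTop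
          (𝓝 (‖g' t y‖ₑ ^ 2 * ENNReal.ofReal (t ^ (-α)))) :=
        ENNReal.Tendsto.mul_const h2 (Or.inr ENNReal.ofReal_ne_top)
      exact h3.liminf_eq.symm
    have hin : ∀ t ∈ Ioo 0 (r ^ 2),
        ∫⁻ y in Metric.ball x r, ‖g' t y‖ₑ ^ 2 * ENNReal.ofReal (t ^ (-α)) ≤
        liminf (fun m => ∫⁻ y in Metric.ball x r,
          ‖g m t y‖ₑ ^ 2 * ENNReal.ofReal (t ^ (-α))) atTop := by
      intro t ht
      simp only [hpt t ht]
      exact lintegral_liminf_le fun m =>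
        ((hm m).of_uncurry_left (x := t)).enorm.pow_const 2 |>.mul_const _
    have hout : ∫⁻ t in Ioo 0 (r ^ 2), ∫⁻ y in Metric.ball x r,
          ‖g' t y‖ₑ ^ 2 * ENNReal.ofReal (t ^ (-α)) ≤
        liminf (fun m => ∫⁻ t in Ioo 0 (r ^ 2), ∫⁻ y in Metric.ball x r,
          ‖g m t y‖ₑ ^ 2 * ENNReal.ofReal (t ^ (-α))) atTop :=
      (setLIntegral_mono' measurableSet_Ioo hin).trans
        (lintegral_liminf_le fun m => (hFm m).lintegral_prod_right')
    have hc : ENNReal.ofReal (r ^ (2 * α - n)) ≠ 0 := by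
      rw [Ne, ENNReal.ofReal_eq_zero, not_le]
      positivity
    rw [carleson, mul_comm, ← ENNReal.le_div_iff_mul_le (Or.inl hc) (Or.inl ENNReal.ofReal_ne_top)]
    refine hout.trans ?_
    refine liminf_le_of_frequently_le' (Frequently.of_forall fun m => ?_)
    rw [ENNReal.le_div_iff_mul_le (Or.inl hc) (Or.inl ENNReal.ofReal_ne_top), mul_comm]
    exact (carleson_le_xNorm_sq (g m) x hr hrT).trans (pow_le_pow_left' (hA m) 2)

/-! ### The bilinear term -/

theorem majorant_eq_lintegral_prod {n : ℕ} {T : ℝ≥0∞} {F : ℝ → Rn n → ℝ≥0∞}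
    (hF : AEMeasurable (Function.uncurry F) (volume.restrict (timeSet T ×ˢ (univ : Set (Rn n)))))
    {t : ℝ} (ht : t ∈ timeSet T) (x : Rn n) :
    majorant F t x = ∫⁻ p in Ioo 0 t ×ˢ univ,
      ENNReal.ofReal (weight √(t - p.1) (x - p.2)) * F p.1 p.2 := by
  have hsub : Ioo 0 t ×ˢ (univ : Set (Rn n)) ⊆ timeSet T ×ˢ univ :=
    prod_mono (Ioo_subset_timeSet ht.2.le) le_rfl
  have hw : Measurable fun p : ℝ × Rn n => ENNReal.ofReal (weight √(t - p.1) (x - p.2)) :=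
    measurable_weight_sqrt.comp (f := fun p : ℝ × Rn n => ((t, x), p)) (by fun_prop)
  have hm : AEMeasurable (fun p : ℝ × Rn n => ENNReal.ofReal (weight √(t - p.1) (x - p.2)) *
      Function.uncurry F p) (volume.restrict (Ioo 0 t ×ˢ univ)) :=
    hw.aemeasurable.mul (hF.mono_measure (Measure.restrict_mono hsub le_rfl))
  rw [Measure.volume_eq_prod, ← Measure.prod_restrict, Measure.restrict_univ] at hm ⊢
  exact (lintegral_prod _ hm).symm

theorem aestronglyMeasurable_oseenKernel_mul {n : ℕ} {T : ℝ≥0∞} {G : ℝ → Rn n → ℂ}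
    (hG : AEStronglyMeasurable (Function.uncurry G)
      (volume.restrict (timeSet T ×ˢ (univ : Set (Rn n))))) (j k l : Fin n) {t : ℝ}
    (ht : t ∈ timeSet T) (x : Rn n) :
    AEStronglyMeasurable
      (fun p : ℝ × Rn n => oseenKernel j k l (t - p.1) (x - p.2) * G p.1 p.2)
      (volume.restrict (Ioo 0 t ×ˢ univ)) := by
  have hsub : Ioo 0 t ×ˢ (univ : Set (Rn n)) ⊆ timeSet T ×ˢ univ :=
    prod_mono (Ioo_subset_timeSet ht.2.le) le_rfl
  have hK : Measurable fun p : ℝ × Rn n => oseenKernel j k l (t - p.1) (x - p.2) :=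
    (measurable_oseenKernel j k l).comp (f := fun p : ℝ × Rn n => (t - p.1, x - p.2))
      (by fun_prop)
  exact hK.aestronglyMeasurable.mul (hG.mono_measure (Measure.restrict_mono hsub le_rfl))

theorem lintegral_enorm_oseenKernel_mul_le {n : ℕ} {C : ℝ≥0}
    (hC : ∀ (j k l : Fin n) (t : ℝ), 0 < t → ∀ x,
      ‖oseenKernel j k l t x‖ₑ ≤ C * ENNReal.ofReal (weight √t x))
    (G : ℝ → Rn n → ℂ) (j k l : Fin n) (t : ℝ) (x : Rn n) :
    ∫⁻ p in Ioo 0 t ×ˢ univ, ‖oseenKernel j k l (t - p.1) (x - p.2) * G p.1 p.2‖ₑ ≤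
      C * ∫⁻ p in Ioo 0 t ×ˢ univ,
        ENNReal.ofReal (weight √(t - p.1) (x - p.2)) * ‖G p.1 p.2‖ₑ := by
  rw [← lintegral_const_mul' _ _ ENNReal.coe_ne_top]
  refine setLIntegral_mono' (measurableSet_Ioo.prod MeasurableSet.univ) fun p hp => ?_
  rw [enorm_mul, ← mul_assoc]
  gcongr
  exact hC j k l _ (sub_pos.2 hp.1.2) _

/-- The integrals of the Duhamel term converge absolutely, at every point, on `X_{α;T}`. -/
theorem integrableOn_oseenKernel_mul {n : ℕ} [NeZero n] {α : ℝ} (hα : 0 < α) {T : ℝ≥0∞}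
    {g h : ℝ → Rn n → ℂ} (hg : MemX α T g) (hh : MemX α T h) (j k l : Fin n) {t : ℝ}
    (ht : t ∈ timeSet T) (x : Rn n) :
    IntegrableOn (fun p : ℝ × Rn n =>
      oseenKernel j k l (t - p.1) (x - p.2) * (g p.1 p.2 * h p.1 p.2)) (Ioo 0 t ×ˢ univ) := by
  obtain ⟨C, hC⟩ := exists_enorm_oseenKernel_le n
  obtain ⟨C', hC'⟩ := exists_majorant_bounds n hα
  refine ⟨aestronglyMeasurable_oseenKernel_mul (G := fun t y => g t y * h t y)
    (hg.aestronglyMeasurable.mul hh.aestronglyMeasurable) j k l ht x, ?_⟩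
  have hs := isSource_mul hg hh
  have hb := lintegral_enorm_oseenKernel_mul_le hC (fun t y => g t y * h t y) j k l t x
  simp only [enorm_mul (g _ _)] at hb
  rw [← majorant_eq_lintegral_prod hs.aemeasurable ht] at hb
  refine hb.trans_lt (ENNReal.mul_lt_top ENNReal.coe_lt_top
    (((hC' T _ _ hs).1 t ht x).trans_lt ?_))
  exact ENNReal.mul_lt_top (ENNReal.mul_lt_top ENNReal.coe_lt_top
    (ENNReal.mul_lt_top hg.norm_lt_top hh.norm_lt_top)) ENNReal.ofReal_lt_top

theorem nsBilinear_eq_sum {n : ℕ} [NeZero n] {α : ℝ} (hα : 0 < α) {T : ℝ≥0∞}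
    {u : Fin n → ℝ → Rn n → ℂ} (hu : ∀ j, MemX α T (u j)) (j : Fin n) {t : ℝ}
    (ht : t ∈ timeSet T) (x : Rn n) :
    nsBilinear u j t x = ∑ i : Fin n × Fin n, ∫ p in Ioo 0 t ×ˢ univ,
      oseenKernel j i.1 i.2 (t - p.1) (x - p.2) * (u i.2 p.1 p.2 * u i.1 p.1 p.2) := by
  have hint := fun k l => integrableOn_oseenKernel_mul hα (hu l) (hu k) j k l ht x
  simp only [IntegrableOn, Measure.volume_eq_prod] at hint
  simp only [← Measure.prod_restrict, Measure.restrict_univ] at hint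
  rw [nsBilinear, Fintype.sum_prod_type]
  rw [integral_finsetSum _ fun k _ => integrable_finsetSum _ fun l _ =>
    (hint k l).integral_prod_left]
  refine Finset.sum_congr rfl fun k _ => ?_
  rw [integral_finsetSum _ fun l _ => (hint k l).integral_prod_left]
  refine Finset.sum_congr rfl fun l _ => ?_
  rw [Measure.volume_eq_prod, ← Measure.prod_restrict, Measure.restrict_univ,
    integral_prod _ (hint k l)]

/-- The source that dominates the difference `u ⊗ u - w ⊗ w`, from
`u_l u_k - w_l w_k = (u_l - w_l) u_k + w_l (u_k - w_k)`. -/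
def differenceSource {n : ℕ} (u w : Fin n → ℝ → Rn n → ℂ) : ℝ → Rn n → ℝ≥0∞ :=
  ∑ i : Fin n × Fin n, ((fun t y => ‖u i.2 t y - w i.2 t y‖ₑ * ‖u i.1 t y‖ₑ) +
    fun t y => ‖w i.2 t y‖ₑ * ‖u i.1 t y - w i.1 t y‖ₑ)

theorem isSource_differenceSource {n : ℕ} {α : ℝ} {T : ℝ≥0∞} {u w : Fin n → ℝ → Rn n → ℂ}
    (hu : ∀ j, MemX α T (u j)) (hw : ∀ j, MemX α T (w j)) :
    IsSource α T (differenceSource u w) ((xNormVec α T u + xNormVec α T w) *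
      xNormVec α T fun j t y => u j t y - w j t y) := by
  have h := IsSource.sum (α := α) (T := T) (Finset.univ : Finset (Fin n × Fin n))
    fun i _ => (isSource_mul ((hu i.2).sub (hw i.2)) (hu i.1)).add
      (isSource_mul (hw i.2) ((hu i.1).sub (hw i.1)))
  refine (congrArg (IsSource α T (differenceSource u w)) ?_).mpr h
  rw [Finset.sum_add_distrib, add_mul, Fintype.sum_prod_type_right,
    Fintype.sum_prod_type_right]
  simp only [xNormVec, Finset.sum_mul_sum]
  rw [Finset.sum_comm]
  simp only [mul_comm]

theorem exists_enorm_nsBilinear_sub_le_majorant (n : ℕ) [NeZero n] {α : ℝ} (hα : 0 < α) :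
    ∃ C : ℝ≥0, ∀ (T : ℝ≥0∞) (u w : Fin n → ℝ → Rn n → ℂ), (∀ j, MemX α T (u j)) →
      (∀ j, MemX α T (w j)) → ∀ (j : Fin n), ∀ t ∈ timeSet T, ∀ x : Rn n,
        ‖nsBilinear u j t x - nsBilinear w j t x‖ₑ ≤ C * majorant (differenceSource u w) t x := by
  obtain ⟨C, hC⟩ := exists_enorm_oseenKernel_le n
  refine ⟨C, fun T u w hu hw j t ht x => ?_⟩
  have hs := isSource_differenceSource hu hw
  set F : Fin n × Fin n → ℝ × Rn n → ℝ≥0∞ := fun i p =>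
    ‖u i.2 p.1 p.2 - w i.2 p.1 p.2‖ₑ * ‖u i.1 p.1 p.2‖ₑ +
      ‖w i.2 p.1 p.2‖ₑ * ‖u i.1 p.1 p.2 - w i.1 p.1 p.2‖ₑ with hF
  have hsub : Ioo 0 t ×ˢ (univ : Set (Rn n)) ⊆ timeSet T ×ˢ univ :=
    prod_mono (Ioo_subset_timeSet ht.2.le) le_rfl
  have hmono := Measure.restrict_mono (μ := (volume : Measure (ℝ × Rn n))) hsub le_rfl
  have hFm : ∀ i, AEMeasurable (F i) (volume.restrict (Ioo 0 t ×ˢ univ)) := fun i => by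
    have h1 := fun j => (hu j).aestronglyMeasurable.mono_measure hmono
    have h2 := fun j => (hw j).aestronglyMeasurable.mono_measure hmono
    exact (((h1 i.2).sub (h2 i.2)).enorm.mul (h1 i.1).enorm).add
      ((h2 i.2).enorm.mul ((h1 i.1).sub (h2 i.1)).enorm)
  have hwm : Measurable fun p : ℝ × Rn n => ENNReal.ofReal (weight √(t - p.1) (x - p.2)) :=
    measurable_weight_sqrt.comp (f := fun p : ℝ × Rn n => ((t, x), p)) (by fun_prop)
  rw [nsBilinear_eq_sum hα hu j ht, nsBilinear_eq_sum hα hw j ht, ← Finset.sum_sub_distrib]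
  refine (enorm_sum_le _ _).trans ?_
  rw [majorant_eq_lintegral_prod hs.aemeasurable ht]
  have hsum : ∀ p : ℝ × Rn n, differenceSource u w p.1 p.2 = ∑ i, F i p := fun p => by
    simp only [differenceSource, Finset.sum_apply, Pi.add_apply, hF]
  simp only [hsum, Finset.mul_sum]
  have hwFm : ∀ i, AEMeasurable (fun p : ℝ × Rn n =>
      ENNReal.ofReal (weight √(t - p.1) (x - p.2)) * F i p)
      (volume.restrict (Ioo 0 t ×ˢ univ)) := fun i => hwm.aemeasurable.mul (hFm i)
  rw [lintegral_finsetSum' _ fun i _ => hwFm i, Finset.mul_sum]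
  refine Finset.sum_le_sum fun i _ => ?_
  rw [← integral_sub (integrableOn_oseenKernel_mul hα (hu i.2) (hu i.1) j i.1 i.2 ht x)
    (integrableOn_oseenKernel_mul hα (hw i.2) (hw i.1) j i.1 i.2 ht x)]
  simp only [← mul_sub]
  refine (enorm_integral_le_lintegral_enorm _).trans ((lintegral_enorm_oseenKernel_mul_le hC
    (fun t y => u i.2 t y * u i.1 t y - w i.2 t y * w i.1 t y) j i.1 i.2 t x).trans ?_)
  gcongr with p
  simp only [hF]
  rw [← enorm_mul, ← enorm_mul]
  refine le_trans (le_of_eq ?_) (enorm_add_le _ _)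
  congr 1
  ring

/-- The bilinear estimate in `X_{α;T}`, together with its pointwise counterpart. -/
theorem exists_nsBilinear_sub_bounds (n : ℕ) [NeZero n] {α : ℝ} (hα : 0 < α) :
    ∃ C : ℝ≥0, ∀ (T : ℝ≥0∞) (u w : Fin n → ℝ → Rn n → ℂ), (∀ j, MemX α T (u j)) →
      (∀ j, MemX α T (w j)) → ∀ A : ℝ≥0∞, (xNormVec α T u + xNormVec α T w) *
        xNormVec α T (fun j t y => u j t y - w j t y) ≤ A →
      (∀ (j : Fin n), ∀ t ∈ timeSet T, ∀ x : Rn n,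
        ‖nsBilinear u j t x - nsBilinear w j t x‖ₑ ≤ C * A * ENNReal.ofReal (t ^ (-(1 / 2) : ℝ))) ∧
      ∀ g : Fin n → ℝ → Rn n → ℂ, (∀ j, ∀ t ∈ timeSet T, ∀ᵐ x,
        ‖g j t x‖ₑ ≤ ‖nsBilinear u j t x - nsBilinear w j t x‖ₑ) → xNormVec α T g ≤ C * A := by
  obtain ⟨C₁, h₁⟩ := exists_enorm_nsBilinear_sub_le_majorant n hα
  obtain ⟨C₂, h₂⟩ := exists_majorant_bounds n hα
  obtain ⟨C₃, h₃⟩ := exists_xNorm_le_of_le_majorant n hα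
  refine ⟨C₁ * C₂ + n * (C₃ * C₁), fun T u w hu hw A hA => ⟨fun j t ht x => ?_, fun g hg => ?_⟩⟩
  · have hs := isSource_differenceSource hu hw
    calc ‖nsBilinear u j t x - nsBilinear w j t x‖ₑ
        ≤ C₁ * (C₂ * A * ENNReal.ofReal (t ^ (-(1 / 2) : ℝ))) := by
          refine (h₁ T u w hu hw j t ht x).trans ?_
          gcongr
          refine ((h₂ T _ _ hs).1 t ht x).trans ?_
          gcongr
      _ = (C₁ * C₂) * A * ENNReal.ofReal (t ^ (-(1 / 2) : ℝ)) := by ring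
      _ ≤ _ := by
          gcongr
          push_cast
          exact le_self_add
  · have hs := isSource_differenceSource hu hw
    calc xNormVec α T g ≤ n * (C₃ * C₁ * A) := by
          refine xNormVec_le fun j => (h₃ T _ _ hs (g j) C₁ fun t ht => ?_).trans ?_
          · filter_upwards [hg j t ht] with x hx
            exact hx.trans (h₁ T u w hu hw j t ht x)
          · gcongr
      _ = (n * (C₃ * C₁)) * A := by ring
      _ ≤ _ := by
          gcongr
          push_cast
          exact le_add_self

theorem measurable_nsBilinear {n : ℕ} {u : Fin n → ℝ → Rn n → ℂ}
    (hu : ∀ j, Measurable (Function.uncurry (u j))) (j : Fin n) :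
    Measurable (Function.uncurry (nsBilinear u j)) := by
  have hin : ∀ k l : Fin n, Measurable fun q : (ℝ × Rn n) × ℝ => ∫ y,
      oseenKernel j k l (q.1.1 - q.2) (q.1.2 - y) * (u l q.2 y * u k q.2 y) := by
    intro k l
    have hK : Measurable fun q : ((ℝ × Rn n) × ℝ) × Rn n =>
        oseenKernel j k l (q.1.1.1 - q.1.2) (q.1.1.2 - q.2) :=
      (measurable_oseenKernel j k l).comp
        (f := fun q : ((ℝ × Rn n) × ℝ) × Rn n => (q.1.1.1 - q.1.2, q.1.1.2 - q.2)) (by fun_prop)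
    have hv : ∀ i, Measurable fun q : ((ℝ × Rn n) × ℝ) × Rn n => u i q.1.2 q.2 := fun i =>
      (hu i).comp (f := fun q : ((ℝ × Rn n) × ℝ) × Rn n => (q.1.2, q.2)) (by fun_prop)
    exact (hK.mul ((hv l).mul (hv k))).stronglyMeasurable.integral_prod_right'.measurable
  have hS : MeasurableSet {q : (ℝ × Rn n) × ℝ | q.2 ∈ Ioo 0 q.1.1} :=
    (measurableSet_lt measurable_const measurable_snd).inter
      (measurableSet_lt measurable_snd (by fun_prop))
  have hsum : Measurable fun q : (ℝ × Rn n) × ℝ => ∑ k, ∑ l, ∫ y,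
      oseenKernel j k l (q.1.1 - q.2) (q.1.2 - y) * (u l q.2 y * u k q.2 y) :=
    Finset.measurable_fun_sum _ fun k _ => Finset.measurable_fun_sum _ fun l _ => hin k l
  have h := (hsum.indicator hS).stronglyMeasurable.integral_prod_right' (ν := volume)
  convert h.measurable using 1
  funext p
  rw [Function.uncurry, nsBilinear, ← integral_indicator measurableSet_Ioo]
  rfl

theorem nsBilinear_im {n : ℕ} {u : Fin n → ℝ → Rn n → ℂ} (hu : ∀ j t x, (u j t x).im = 0)
    (j : Fin n) (t : ℝ) (x : Rn n) : (nsBilinear u j t x).im = 0 := by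
  rw [← Complex.conj_eq_iff_im, nsBilinear, ← integral_conj]
  simp only [map_sum, ← integral_conj, map_mul, Complex.conj_eq_iff_im.2 (hu _ _ _),
    Complex.conj_eq_iff_im.2 (oseenKernel_im _ _ _ _ _)]

/-! ### The Picard iteration -/

/-- The map whose fixed points are the mild solutions, extended by zero outside `(0,T)`. -/
def picardMap {n : ℕ} (T : ℝ≥0∞) (a : Fin n → 𝓢'(Rn n, ℂ)) (u : Fin n → ℝ → Rn n → ℂ)
    (j : Fin n) (t : ℝ) (x : Rn n) : ℂ :=
  (timeSet T ×ˢ (univ : Set (Rn n))).indicator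
    (fun p => heatExt (a j) p.1 p.2 - nsBilinear u j p.1 p.2) (t, x)

/-- The Picard iterates, starting from zero. -/
def picardSeq {n : ℕ} (T : ℝ≥0∞) (a : Fin n → 𝓢'(Rn n, ℂ)) : ℕ → Fin n → ℝ → Rn n → ℂ
  | 0 => fun _ _ _ => 0
  | m + 1 => picardMap T a (picardSeq T a m)

theorem picardMap_of_mem {n : ℕ} {T : ℝ≥0∞} (a : Fin n → 𝓢'(Rn n, ℂ)) (u : Fin n → ℝ → Rn n → ℂ)
    (j : Fin n) {t : ℝ} (ht : t ∈ timeSet T) (x : Rn n) :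
    picardMap T a u j t x = heatExt (a j) t x - nsBilinear u j t x :=
  indicator_of_mem (show (t, x) ∈ timeSet T ×ˢ (univ : Set (Rn n)) from ⟨ht, trivial⟩) _

theorem picardMap_of_notMem {n : ℕ} {T : ℝ≥0∞} (a : Fin n → 𝓢'(Rn n, ℂ))
    (u : Fin n → ℝ → Rn n → ℂ) (j : Fin n) {t : ℝ} (ht : t ∉ timeSet T) (x : Rn n) :
    picardMap T a u j t x = 0 :=
  indicator_of_notMem (fun h => ht h.1) _

theorem picardSeq_of_notMem {n : ℕ} {T : ℝ≥0∞} (a : Fin n → 𝓢'(Rn n, ℂ)) (m : ℕ) (j : Fin n)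
    {t : ℝ} (ht : t ∉ timeSet T) (x : Rn n) : picardSeq T a m j t x = 0 := by
  cases m with
  | zero => rfl
  | succ m => exact picardMap_of_notMem a _ j ht x

theorem measurable_picardSeq {n : ℕ} (T : ℝ≥0∞) (a : Fin n → 𝓢'(Rn n, ℂ)) (m : ℕ) (j : Fin n) :
    Measurable (Function.uncurry (picardSeq T a m j)) := by
  induction m generalizing j with
  | zero => exact measurable_const
  | succ m ih =>
    exact ((measurable_uncurry_heatExt (a j)).sub (measurable_nsBilinear ih j)).indicator
      ((measurableSet_timeSet T).prod MeasurableSet.univ)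

theorem picardSeq_im {n : ℕ} (T : ℝ≥0∞) {a : Fin n → 𝓢'(Rn n, ℂ)} (ha : ∀ j, IsRealDist (a j))
    (m : ℕ) (j : Fin n) (t : ℝ) (x : Rn n) : (picardSeq T a m j t x).im = 0 := by
  induction m generalizing j t x with
  | zero => rfl
  | succ m ih =>
    by_cases ht : t ∈ timeSet T
    · rw [picardSeq, picardMap_of_mem a _ j ht, Complex.sub_im, heatExt_im (ha j),
        nsBilinear_im ih, sub_zero]
    · rw [picardSeq_of_notMem a _ j ht, Complex.zero_im]

theorem nsBilinear_zero {n : ℕ} (j : Fin n) (t : ℝ) (x : Rn n) :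
    nsBilinear (fun _ _ _ => 0) j t x = 0 := by
  simp [nsBilinear]

theorem xNormVec_zero {n : ℕ} (α : ℝ) (T : ℝ≥0∞) :
    xNormVec α T (fun (_ : Fin n) (_ : ℝ) (_ : Rn n) => (0 : ℂ)) = 0 := by
  refine Finset.sum_eq_zero fun j _ => le_antisymm ?_ zero_le
  refine (xNorm_le (A := 0) (B := 0) (fun t _ => by simp) fun x r _ _ => ?_).trans (by simp)
  simp [carleson]

theorem MemX.of_measurable {n : ℕ} {α : ℝ} {T : ℝ≥0∞} {u : Fin n → ℝ → Rn n → ℂ}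
    (hu : ∀ j, Measurable (Function.uncurry (u j))) (h : xNormVec α T u < ⊤) (j : Fin n) :
    MemX α T (u j) :=
  ⟨(hu j).aestronglyMeasurable, fun t _ _ => ((hu j).of_uncurry_left (x := t)).aestronglyMeasurable,
    (xNorm_le_xNormVec u j).trans_lt h⟩

/-- The constant `C` is admissible in the bilinear estimate in `X_{α;T}`, for all `T`. -/
def IsBilinearConstant (n : ℕ) (α : ℝ) (C : ℝ≥0) : Prop :=
  ∀ (T : ℝ≥0∞) (u w : Fin n → ℝ → Rn n → ℂ), (∀ j, MemX α T (u j)) →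
    (∀ j, MemX α T (w j)) → ∀ A : ℝ≥0∞, (xNormVec α T u + xNormVec α T w) *
      xNormVec α T (fun j t y => u j t y - w j t y) ≤ A →
    (∀ (j : Fin n), ∀ t ∈ timeSet T, ∀ x : Rn n,
      ‖nsBilinear u j t x - nsBilinear w j t x‖ₑ ≤ C * A * ENNReal.ofReal (t ^ (-(1 / 2) : ℝ))) ∧
    ∀ g : Fin n → ℝ → Rn n → ℂ, (∀ j, ∀ t ∈ timeSet T, ∀ᵐ x,
      ‖g j t x‖ₑ ≤ ‖nsBilinear u j t x - nsBilinear w j t x‖ₑ) → xNormVec α T g ≤ C * A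

theorem xNormVec_picardMap_le {n : ℕ} {α : ℝ} {C : ℝ≥0} (hC : IsBilinearConstant n α C)
    {T : ℝ≥0∞} {a : Fin n → 𝓢'(Rn n, ℂ)} (ha : xNormVec α T (fun j => heatExt (a j)) < ⊤)
    {u : Fin n → ℝ → Rn n → ℂ} (hu : ∀ j, Measurable (Function.uncurry (u j)))
    (hu' : xNormVec α T u < ⊤) :
    xNormVec α T (picardMap T a u) ≤
      3 * (xNormVec α T (fun j => heatExt (a j)) + C * xNormVec α T u ^ 2) := by
  have h0 := xNormVec_zero (n := n) α T
  have hz : ∀ j : Fin n, MemX α T ((fun _ _ _ => 0 : Fin n → ℝ → Rn n → ℂ) j) :=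
    MemX.of_measurable (fun _ => measurable_const) (h0.trans_lt ENNReal.zero_lt_top)
  have hB : xNormVec α T (nsBilinear u) ≤ C * xNormVec α T u ^ 2 := by
    refine (hC T u _ (MemX.of_measurable hu hu') hz _ le_rfl).2 _ (fun j t _ =>
      Eventually.of_forall fun x => ?_) |>.trans (le_of_eq ?_)
    · rw [nsBilinear_zero, sub_zero]
    · simp only [h0, sub_zero, add_zero, sq]
  have hBm := MemX.of_measurable (α := α) (T := T) (measurable_nsBilinear hu)
    (hB.trans_lt (ENNReal.mul_lt_top ENNReal.coe_lt_top (ENNReal.pow_lt_top hu')))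
  have hHm := MemX.of_measurable (α := α) (T := T) (fun j => measurable_uncurry_heatExt (a j)) ha
  calc xNormVec α T (picardMap T a u)
      ≤ ∑ j, 3 * (xNorm α T (heatExt (a j)) + xNorm α T (nsBilinear u j)) := by
        refine Finset.sum_le_sum fun j _ => xNorm_le_of_enorm_le_add (hHm j) (hBm j)
          fun t ht => Eventually.of_forall fun x => ?_
        rw [picardMap_of_mem a u j ht]
        exact enorm_sub_le
    _ = 3 * (xNormVec α T (fun j => heatExt (a j)) + xNormVec α T (nsBilinear u)) := by
        rw [← Finset.mul_sum, Finset.sum_add_distrib]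
        rfl
    _ ≤ _ := by gcongr

theorem enorm_picardMap_sub {n : ℕ} {T : ℝ≥0∞} (a : Fin n → 𝓢'(Rn n, ℂ))
    (u w : Fin n → ℝ → Rn n → ℂ) (j : Fin n) {t : ℝ} (ht : t ∈ timeSet T) (x : Rn n) :
    ‖picardMap T a u j t x - picardMap T a w j t x‖ₑ =
      ‖nsBilinear u j t x - nsBilinear w j t x‖ₑ := by
  rw [picardMap_of_mem a u j ht, picardMap_of_mem a w j ht, sub_sub_sub_cancel_left,
    ← enorm_neg, neg_sub]

section Small

variable {n : ℕ} {α : ℝ} {C : ℝ≥0} {T : ℝ≥0∞} {a : Fin n → 𝓢'(Rn n, ℂ)} {h : ℝ≥0∞}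

theorem xNormVec_picardSeq_le (hC : IsBilinearConstant n α C)
    (ha : xNormVec α T (fun j => heatExt (a j)) ≤ h) (hh : h < ⊤) (hsmall : 4 * (C * (12 * h)) ≤ 1)
    (m : ℕ) : xNormVec α T (picardSeq T a m) ≤ 12 * h := by
  induction m with
  | zero => exact (xNormVec_zero α T).trans_le zero_le
  | succ m ih =>
    refine (xNormVec_picardMap_le hC (ha.trans_lt hh) (measurable_picardSeq T a m)
      (ih.trans_lt (ENNReal.mul_lt_top (by norm_num) hh))).trans ?_
    calc 3 * (xNormVec α T (fun j => heatExt (a j)) + C * xNormVec α T (picardSeq T a m) ^ 2)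
        ≤ 3 * (h + C * (12 * h) ^ 2) := by gcongr
      _ = 3 * h + 9 * h * (4 * (C * (12 * h))) := by ring
      _ ≤ 3 * h + 9 * h * 1 := by gcongr
      _ = 12 * h := by ring

theorem memX_picardSeq (hC : IsBilinearConstant n α C)
    (ha : xNormVec α T (fun j => heatExt (a j)) ≤ h) (hh : h < ⊤) (hsmall : 4 * (C * (12 * h)) ≤ 1)
    (m : ℕ) (j : Fin n) : MemX α T (picardSeq T a m j) :=
  MemX.of_measurable (measurable_picardSeq T a m)
    ((xNormVec_picardSeq_le hC ha hh hsmall m).trans_lt (ENNReal.mul_lt_top (by norm_num) hh)) j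

theorem two_mul_eq_inv_two_mul (q : ℝ≥0∞) : 2 * q = 2⁻¹ * (4 * q) := by
  rw [← mul_assoc, show (4 : ℝ≥0∞) = 2 * 2 by norm_num, ← mul_assoc,
    ENNReal.inv_mul_cancel two_ne_zero ENNReal.ofNat_ne_top, one_mul]

/-- The contraction estimate between the iterates `m` and `m + p`, uniformly in `p`: comparing them
directly keeps the constant of the triangle inequality from accumulating. -/
theorem xNormVec_picardSeq_sub_le (hC : IsBilinearConstant n α C)
    (ha : xNormVec α T (fun j => heatExt (a j)) ≤ h) (hh : h < ⊤) (hsmall : 4 * (C * (12 * h)) ≤ 1)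
    (m p : ℕ) :
    xNormVec α T (fun j t x => picardSeq T a (m + p) j t x - picardSeq T a m j t x) ≤
      2⁻¹ ^ m * (12 * h) := by
  induction m with
  | zero =>
    simp only [picardSeq, sub_zero, zero_add, pow_zero, one_mul]
    exact xNormVec_picardSeq_le hC ha hh hsmall p
  | succ m ih =>
    have hb := xNormVec_picardSeq_le hC ha hh hsmall
    have hA : (xNormVec α T (picardSeq T a (m + p)) + xNormVec α T (picardSeq T a m)) *
        xNormVec α T (fun j t x => picardSeq T a (m + p) j t x - picardSeq T a m j t x) ≤
        (12 * h + 12 * h) * (2⁻¹ ^ m * (12 * h)) := by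
      gcongr
      · exact hb _
      · exact hb _
    refine ((hC T _ _ (memX_picardSeq hC ha hh hsmall _) (memX_picardSeq hC ha hh hsmall _)
      _ hA).2 _ fun j t ht => Eventually.of_forall fun x => ?_).trans ?_
    · rw [show m + 1 + p = m + p + 1 by omega]
      exact (enorm_picardMap_sub a _ _ j ht x).le
    · calc C * ((12 * h + 12 * h) * (2⁻¹ ^ m * (12 * h)))
          = 2 * (C * (12 * h)) * (2⁻¹ ^ m * (12 * h)) := by ring
        _ = 2⁻¹ * (4 * (C * (12 * h))) * (2⁻¹ ^ m * (12 * h)) := by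
            rw [two_mul_eq_inv_two_mul (C * (12 * h))]
        _ ≤ 2⁻¹ * 1 * (2⁻¹ ^ m * (12 * h)) := by gcongr
        _ = 2⁻¹ ^ (m + 1) * (12 * h) := by rw [pow_succ]; ring

theorem tendsto_inv_two_pow_mul {c : ℝ≥0∞} (hc : c ≠ ⊤) :
    Tendsto (fun m : ℕ => (2⁻¹ : ℝ≥0∞) ^ m * c) atTop (𝓝 0) := by
  have h := ENNReal.Tendsto.mul_const (b := c)
    (ENNReal.tendsto_pow_atTop_nhds_zero_of_lt_one (r := 2⁻¹) (by norm_num)) (Or.inr hc)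
  rwa [zero_mul] at h

/-- The iterates converge at every point of `(0,T) × ℝⁿ`, by the pointwise bilinear estimate. -/
theorem exists_tendsto_picardSeq (hC : IsBilinearConstant n α C)
    (ha : xNormVec α T (fun j => heatExt (a j)) ≤ h) (hh : h < ⊤) (hsmall : 4 * (C * (12 * h)) ≤ 1)
    (j : Fin n) (t : ℝ) (x : Rn n) :
    ∃ z, Tendsto (fun m => picardSeq T a m j t x) atTop (𝓝 z) := by
  by_cases ht : t ∈ timeSet T
  swap
  · simp only [picardSeq_of_notMem a _ j ht]
    exact ⟨0, tendsto_const_nhds⟩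
  refine cauchySeq_tendsto_of_complete (EMetric.cauchySeq_iff'.2 fun ε hε => ?_)
  set c : ℝ≥0∞ := C * ((12 * h + 12 * h) * (12 * h)) * ENNReal.ofReal (t ^ (-(1 / 2) : ℝ)) with hc
  have hb := xNormVec_picardSeq_le hC ha hh hsmall
  have h12 : 12 * h < ⊤ := ENNReal.mul_lt_top (by norm_num) hh
  have hctop : c ≠ ⊤ := (ENNReal.mul_lt_top (ENNReal.mul_lt_top ENNReal.coe_lt_top
    (ENNReal.mul_lt_top (ENNReal.add_lt_top.2 ⟨h12, h12⟩) h12)) ENNReal.ofReal_lt_top).ne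
  obtain ⟨m, hm⟩ := ((tendsto_inv_two_pow_mul hctop).eventually (gt_mem_nhds hε)).exists
  refine ⟨m + 1, fun k hk => ?_⟩
  obtain ⟨p, rfl⟩ := Nat.exists_eq_add_of_le hk
  have hA : (xNormVec α T (picardSeq T a (m + p)) + xNormVec α T (picardSeq T a m)) *
      xNormVec α T (fun j t x => picardSeq T a (m + p) j t x - picardSeq T a m j t x) ≤
      (12 * h + 12 * h) * (2⁻¹ ^ m * (12 * h)) := by
    gcongr
    · exact hb _
    · exact hb _
    · exact xNormVec_picardSeq_sub_le hC ha hh hsmall m p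
  rw [show m + 1 + p = m + p + 1 by omega, edist_eq_enorm_sub]
  refine lt_of_le_of_lt ?_ hm
  refine (enorm_picardMap_sub a _ _ j ht x).le.trans
    (((hC T _ _ (memX_picardSeq hC ha hh hsmall _) (memX_picardSeq hC ha hh hsmall _)
      _ hA).1 j t ht x).trans (le_of_eq ?_))
  rw [hc]
  ring

end Small

/-- Two mild solutions that are small in `X_{α;T}` agree. -/
theorem ae_eq_of_isMildSolutionX {n : ℕ} {α : ℝ} {C δ : ℝ≥0} (hC : IsBilinearConstant n α C)
    (hδ : 4 * (C * δ) ≤ 1) {T : ℝ≥0∞} {a : Fin n → 𝓢'(Rn n, ℂ)} {u v : Fin n → ℝ → Rn n → ℂ}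
    (hu : IsMildSolutionX α T a u) (hv : IsMildSolutionX α T a v) (huδ : xNormVec α T u ≤ δ)
    (hvδ : xNormVec α T v ≤ δ) (j : Fin n) {t : ℝ} (ht : t ∈ timeSet T) :
    v j t =ᵐ[volume] u j t := by
  set d := xNormVec α T (fun j t x => u j t x - v j t x) with hd
  have hdtop : d ≠ ⊤ :=
    (ENNReal.sum_lt_top.2 fun j _ => ((hu.1 j).sub (hv.1 j)).norm_lt_top).ne
  have hA : (xNormVec α T u + xNormVec α T v) * d ≤ (δ + δ) * d := by gcongr
  have hle : d ≤ C * ((δ + δ) * d) := by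
    refine (hC T u v hu.1 hv.1 _ hA).2 _ fun j t ht => ?_
    filter_upwards [hu.2 t ht.1 ht.2 j, hv.2 t ht.1 ht.2 j] with x hx hx'
    rw [hx.2, hx'.2, sub_sub_sub_cancel_left, ← enorm_neg, neg_sub]
  have hδ' : 4 * ((C : ℝ≥0∞) * δ) ≤ 1 := by exact_mod_cast hδ
  have hhalf : d ≤ 2⁻¹ * d := by
    calc d ≤ C * ((δ + δ) * d) := hle
      _ = 2 * (C * δ) * d := by ring
      _ = 2⁻¹ * (4 * (C * δ)) * d := by rw [two_mul_eq_inv_two_mul (C * δ : ℝ≥0∞)]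
      _ ≤ 2⁻¹ * 1 * d := by gcongr
      _ = 2⁻¹ * d := by rw [mul_one]
  have hd0 : d = 0 := by
    by_contra hne
    have := ENNReal.half_lt_self hne hdtop
    rw [ENNReal.div_eq_inv_mul] at this
    exact absurd hhalf (not_le.2 this)
  have h0 : xNorm α T (fun t x => u j t x - v j t x) = 0 :=
    le_antisymm ((xNorm_le_xNormVec (fun j t x => u j t x - v j t x) j).trans hd0.le) zero_le
  filter_upwards [ae_mul_enorm_le_xNorm (α := α) (fun t x => u j t x - v j t x) ht] with x hx
  rw [h0, le_zero_iff, mul_eq_zero, ENNReal.ofReal_eq_zero, enorm_eq_zero, sub_eq_zero] at hx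
  exact (hx.resolve_left (not_le.2 (Real.sqrt_pos.2 ht.1))).symm

/-- The fixed point theorem: small initial data, measured by the heat extension, have a unique
small mild solution. -/
theorem exists_hasUniqueSmallMildSolution (n : ℕ) [NeZero n] {α : ℝ} (hα : 0 < α) :
    ∃ δ K : ℝ≥0, 0 < δ ∧ 0 < K ∧ ∀ (T : ℝ≥0∞) (a : Fin n → 𝓢'(Rn n, ℂ)) (η : ℝ≥0∞),
      K * xNormVec α T (fun j => heatExt (a j)) ≤ δ →
      K * xNormVec α T (fun j => heatExt (a j)) ≤ η → HasUniqueSmallMildSolution α T a δ η := by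
  obtain ⟨C, hC⟩ := exists_nsBilinear_sub_bounds n hα
  replace hC : IsBilinearConstant n α C := hC
  have hn : 1 ≤ n := Nat.one_le_iff_ne_zero.2 (NeZero.ne n)
  -- the iterates stay below `12 * h`; the factor `2` comes from Fatou's lemma, `n` from components
  refine ⟨(4 * (C + 1))⁻¹, n * (2 * 12), by positivity,
    mul_pos (by exact_mod_cast hn) (by norm_num), fun T a η hδ hη => ?_⟩
  set δ : ℝ≥0 := (4 * (C + 1))⁻¹ with hδdef
  set h := xNormVec α T (fun j => heatExt (a j)) with hh_def
  have hδC : 4 * (C * δ) ≤ 1 := by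
    rw [hδdef, ← mul_assoc, ← div_eq_mul_inv, div_le_one (by positivity)]
    gcongr
    exact le_self_add
  have hK : ((n * (2 * 12) : ℝ≥0) : ℝ≥0∞) * h = n * (2 * (12 * h)) := by
    push_cast
    ring
  rw [hK] at hδ hη
  have h12 : 12 * h ≤ δ := by
    refine le_trans ?_ hδ
    calc 12 * h = 1 * (1 * (12 * h)) := by ring
      _ ≤ n * (2 * (12 * h)) := by
        gcongr
        · exact_mod_cast hn
        · norm_num
  have h12top : 12 * h < ⊤ := h12.trans_lt ENNReal.coe_lt_top
  have hh : h < ⊤ := by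
    by_contra hne
    rw [not_lt_top_iff.1 hne] at h12top
    norm_num at h12top
  have hsmall : 4 * (C * (12 * h)) ≤ 1 := by
    calc 4 * (C * (12 * h)) ≤ 4 * (C * (δ : ℝ≥0∞)) := by gcongr
      _ ≤ 1 := by exact_mod_cast hδC
  choose u hu using exists_tendsto_picardSeq (α := α) (T := T) (a := a) hC le_rfl hh hsmall
  have hum : ∀ j, Measurable (Function.uncurry (u j)) := fun j =>
    measurable_of_tendsto_metrizable (measurable_picardSeq T a · j)
      (tendsto_pi_nhds.2 fun p => hu j p.1 p.2)
  have hub : xNormVec α T u ≤ n * (2 * (12 * h)) := xNormVec_le fun j =>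
    xNorm_le_of_tendsto (measurable_picardSeq T a · j) (fun m =>
      (xNorm_le_xNormVec _ j).trans (xNormVec_picardSeq_le hC le_rfl hh hsmall m))
      fun t _ y => hu j t y
  have huX : ∀ j, MemX α T (u j) :=
    MemX.of_measurable hum ((hub.trans hδ).trans_lt ENNReal.coe_lt_top)
  -- the iterates converge to the limit in norm
  have hdiff : ∀ m, xNormVec α T (fun j t x => u j t x - picardSeq T a m j t x) ≤
      2⁻¹ ^ m * (n * (2 * (12 * h))) := fun m => by
    have := xNormVec_le (α := α) (T := T) (u := fun j t x => u j t x - picardSeq T a m j t x)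
      fun j => xNorm_le_of_tendsto
        (g := fun p t x => picardSeq T a (m + p) j t x - picardSeq T a m j t x)
        (fun p => (measurable_picardSeq T a (m + p) j).sub (measurable_picardSeq T a m j))
        (fun p => (xNorm_le_xNormVec
          (fun j t x => picardSeq T a (m + p) j t x - picardSeq T a m j t x) j).trans
          (xNormVec_picardSeq_sub_le hC le_rfl hh hsmall m p))
        fun t _ y => ((hu j t y).comp (tendsto_add_atTop_nat m)).congr
          (fun p => by rw [Function.comp_apply, add_comm]) |>.sub_const _
    refine this.trans (le_of_eq ?_)
    ring
  -- the bilinear term is continuous along the iterates, so the limit is a fixed point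
  have hfix : ∀ j, ∀ t ∈ timeSet T, ∀ x,
      u j t x = heatExt (a j) t x - nsBilinear u j t x := fun j t ht x => by
    have hlim : Tendsto (fun m => nsBilinear (picardSeq T a m) j t x) atTop
        (𝓝 (nsBilinear u j t x)) := by
      rw [tendsto_iff_edist_tendsto_0]
      set c : ℝ≥0∞ := C * ((12 * h + n * (2 * (12 * h))) * (n * (2 * (12 * h)))) *
        ENNReal.ofReal (t ^ (-(1 / 2) : ℝ)) with hc
      have hN : n * (2 * (12 * h)) < ⊤ := hδ.trans_lt ENNReal.coe_lt_top
      have hctop : c ≠ ⊤ := (ENNReal.mul_lt_top (ENNReal.mul_lt_top ENNReal.coe_lt_top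
        (ENNReal.mul_lt_top (ENNReal.add_lt_top.2 ⟨h12top, hN⟩) hN)) ENNReal.ofReal_lt_top).ne
      refine tendsto_of_tendsto_of_tendsto_of_le_of_le tendsto_const_nhds
        (tendsto_inv_two_pow_mul hctop) (fun m => zero_le) fun m => ?_
      have hA : (xNormVec α T u + xNormVec α T (picardSeq T a m)) *
          xNormVec α T (fun j t x => u j t x - picardSeq T a m j t x) ≤
          (n * (2 * (12 * h)) + 12 * h) * (2⁻¹ ^ m * (n * (2 * (12 * h)))) := by
        gcongr
        · exact xNormVec_picardSeq_le hC le_rfl hh hsmall m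
        · exact hdiff m
      beta_reduce
      rw [edist_comm, edist_eq_enorm_sub]
      refine ((hC T u _ huX (memX_picardSeq hC le_rfl hh hsmall m) _ hA).1 j t ht x).trans
        (le_of_eq ?_)
      rw [hc]
      ring
    refine tendsto_nhds_unique ((hu j t x).comp (tendsto_add_atTop_nat 1)) ?_
    refine (hlim.const_sub (heatExt (a j) t x)).congr fun m => ?_
    exact (picardMap_of_mem a _ j ht x).symm
  have hsol : IsMildSolutionX α T a u := ⟨huX, fun t ht htT j => Eventually.of_forall fun x =>
    ⟨fun k l => integrableOn_oseenKernel_mul hα (huX l) (huX k) j k l ⟨ht, htT⟩ x,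
      hfix j t ⟨ht, htT⟩ x⟩⟩
  refine ⟨u, hsol, hub.trans hδ, hub.trans hη, fun ha j t _ _ => Eventually.of_forall fun x => ?_,
    fun v hv hvδ j t ht htT =>
      ae_eq_of_isMildSolutionX hC hδC hsol hv (hub.trans hδ) hvδ j ⟨ht, htT⟩⟩
  have him := (Complex.continuous_im.tendsto _).comp (hu j t x)
  refine tendsto_nhds_unique him ?_
  simp only [Function.comp_def, picardSeq_im T ha]
  exact tendsto_const_nhds

/-! ### Small data in `Q⁻¹_{α;T}` -/

/-- Data whose `Q⁻¹_{α;S}` norm is small have a unique small mild solution up to time `T ≤ S²`. -/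
theorem exists_hasUniqueSmallMildSolution_of_qNormVec_le (n : ℕ) [NeZero n] {α : ℝ} (hα : 0 < α) :
    ∃ δ C : ℝ≥0, 0 < δ ∧ ∀ (S T : ℝ≥0∞),
      (∀ r : ℝ, 0 < r → ENNReal.ofReal (r ^ 2) < T → ENNReal.ofReal r < S) →
      ∀ (a : Fin n → 𝓢'(Rn n, ℂ)) (η : ℝ≥0∞), C * qNormVec α S a ≤ δ →
        C * qNormVec α S a ≤ η → HasUniqueSmallMildSolution α T a δ η := by
  obtain ⟨δ, K, hδ, -, h⟩ := exists_hasUniqueSmallMildSolution n hα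
  obtain ⟨C, hC⟩ := exists_xNorm_heatExt_le n hα
  refine ⟨δ, K * C, hδ, fun S T hST a η h1 h2 => ?_⟩
  have hle : K * xNormVec α T (fun j => heatExt (a j)) ≤ (K * C : ℝ≥0) * qNormVec α S a := by
    rw [ENNReal.coe_mul, mul_assoc]
    gcongr
    rw [qNormVec, Finset.mul_sum]
    exact Finset.sum_le_sum fun j _ => hC S T hST (a j)
  exact h T a η (hle.trans h1) (hle.trans h2)

theorem ofReal_lt_sqrt {T : ℝ≥0} {r : ℝ} (hr : 0 < r) (h : ENNReal.ofReal (r ^ 2) < T) :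
    ENNReal.ofReal r < (NNReal.sqrt T : ℝ≥0) := by
  rw [ENNReal.ofReal_lt_iff_lt_toReal (by positivity) ENNReal.coe_ne_top,
    ENNReal.coe_toReal] at h ⊢
  rw [Real.coe_sqrt]
  exact Real.lt_sqrt_of_sq_lt h

theorem mul_le_of_le_div_add_one {C δ : ℝ≥0} {q : ℝ≥0∞} (h : q ≤ (δ / (C + 1) : ℝ≥0)) :
    C * q ≤ δ := by
  calc C * q ≤ C * (δ / (C + 1) : ℝ≥0) := by gcongr
    _ ≤ δ := by
      norm_cast
      rw [mul_div_assoc', div_le_iff₀ (by positivity), mul_comm]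
      gcongr
      exact le_self_add

end

end QNavierStokes

theorem theorem1p2 (n : ℕ) (hn : 2 ≤ n) (α : ℝ) (hα0 : 0 < α) (hα1 : α < 1) :
    -- global solutions
    (∃ ε δ C : ℝ≥0, 0 < ε ∧ 0 < δ ∧
      ∀ a : Fin n → 𝓢'(QNavierStokes.Rn n, ℂ), QNavierStokes.DivFree a →
        QNavierStokes.qNormVec α ⊤ a ≤ ε →
          QNavierStokes.HasUniqueSmallMildSolution α ⊤ a δ
            (C * QNavierStokes.qNormVec α ⊤ a)) ∧
    -- solutions on a given finite time interval
    (∀ T : ℝ≥0, 0 < T → ∃ ε δ C : ℝ≥0, 0 < ε ∧ 0 < δ ∧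
      ∀ a : Fin n → 𝓢'(QNavierStokes.Rn n, ℂ), QNavierStokes.DivFree a →
        QNavierStokes.qNormVec α T a ≤ ε →
          QNavierStokes.HasUniqueSmallMildSolution α T a δ
            (C * QNavierStokes.qNormVec α T a)) ∧
    -- local solutions for data in the vanishing space
    (∃ δ : ℝ≥0, 0 < δ ∧
      ∀ a : Fin n → 𝓢'(QNavierStokes.Rn n, ℂ), QNavierStokes.DivFree a →
        (∀ j, QNavierStokes.MemVQ α (a j)) →
          ∀ η : ℝ≥0, 0 < η → ∃ T₀ : ℝ≥0, 0 < T₀ ∧ ∀ T : ℝ≥0, 0 < T → T ≤ T₀ →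
            QNavierStokes.HasUniqueSmallMildSolution α T a δ η) := by
  have : NeZero n := ⟨by omega⟩
  obtain ⟨δ, C, hδ, h⟩ :=
    QNavierStokes.exists_hasUniqueSmallMildSolution_of_qNormVec_le n hα0
  refine ⟨⟨δ / (C + 1), δ, C, by positivity, hδ, fun a _ ha => ?_⟩, fun T hT => ?_,
    ⟨δ, hδ, fun a _ ha η hη => ?_⟩⟩
  · exact h ⊤ ⊤ (fun r _ _ => ENNReal.ofReal_lt_top) a _
      (QNavierStokes.mul_le_of_le_div_add_one ha) le_rfl
  · obtain ⟨C', hC'⟩ := QNavierStokes.exists_qNorm_le_mul_qNorm n hα0 (NNReal.sqrt T) T hT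
    have hle : ∀ a : Fin n → 𝓢'(QNavierStokes.Rn n, ℂ),
        C * QNavierStokes.qNormVec α (NNReal.sqrt T) a ≤
          (C * C' : ℝ≥0) * QNavierStokes.qNormVec α T a := fun a => by
      rw [ENNReal.coe_mul, mul_assoc]
      gcongr
      rw [QNavierStokes.qNormVec, QNavierStokes.qNormVec, Finset.mul_sum]
      exact Finset.sum_le_sum fun j _ => hC' (a j)
    refine ⟨δ / (C * C' + 1), δ, C * C', by positivity, hδ, fun a _ ha => ?_⟩
    exact h (NNReal.sqrt T) T (fun r hr hrT => QNavierStokes.ofReal_lt_sqrt hr hrT) a _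
      ((hle a).trans (QNavierStokes.mul_le_of_le_div_add_one ha)) (hle a)
  -- since the time horizon `T` corresponds to the scale `√T`, a scale `s` at which the data are
  -- small gives the time `s ^ 2`
  · have hε : (0 : ℝ≥0∞) < (min δ η / (C * n + 1) : ℝ≥0) := by
      have := lt_min hδ hη
      exact_mod_cast (by positivity : 0 < min δ η / (C * n + 1))
    have hev : ∀ᶠ s in 𝓝[>] (0 : ℝ≥0∞), ∀ j,
        QNavierStokes.qNorm α s (a j) ≤ (min δ η / (C * n + 1) : ℝ≥0) :=
      eventually_all.2 fun j => ((ha j).eventually (gt_mem_nhds hε)).mono fun _ => le_of_lt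
    obtain ⟨σ, hσ, hσ'⟩ := (mem_nhdsGT_iff_exists_Ioo_subset' ENNReal.zero_lt_top).1 hev
    obtain ⟨s, hs0, hsσ⟩ := ENNReal.lt_iff_exists_nnreal_btwn.1 hσ
    have hs : 0 < s := by exact_mod_cast hs0
    have hsmall : C * QNavierStokes.qNormVec α s a ≤ (min δ η : ℝ≥0) := by
      calc C * QNavierStokes.qNormVec α s a
          ≤ C * ∑ _j : Fin n, ((min δ η / (C * n + 1) : ℝ≥0) : ℝ≥0∞) := by
            refine mul_le_mul_right (Finset.sum_le_sum fun j _ => ?_) _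
            exact hσ' ⟨hs0, hsσ⟩ j
        _ = (C * n : ℝ≥0) * ((min δ η / (C * n + 1) : ℝ≥0) : ℝ≥0∞) := by
            rw [Finset.sum_const, Finset.card_univ, Fintype.card_fin, nsmul_eq_mul,
              ENNReal.coe_mul, ENNReal.coe_natCast, mul_assoc]
        _ ≤ _ := QNavierStokes.mul_le_of_le_div_add_one le_rfl
    refine ⟨s ^ 2, by positivity, fun T _ hTs => h s T (fun r hr hrT => ?_) a η
      (hsmall.trans (by exact_mod_cast min_le_left δ η))
      (hsmall.trans (by exact_mod_cast min_le_right δ η))⟩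
    refine (QNavierStokes.ofReal_lt_sqrt hr hrT).trans_le (ENNReal.coe_le_coe.2 ?_)
    rw [NNReal.sqrt_le_iff_le_sq]
    exact hTs
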